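/- Let $n\ge 3$, $0\le\delta<\tfrac12$, $\alpha_\delta=\frac{(n-2)\delta}{1-2\delta}$ and $p=n+2\alpha_\delta$. Then $\alpha_\delta\ge 0$ and $p\ge n$, and for every real $\alpha>\alpha_\delta$ there is a constant $C>0$, depending only on $n$, $\delta$ and $\alpha$, such that the following holds. Let $(M^n,g)$ be a connected smooth Riemannian manifold (without boundary), let $x_0\in M$ and $0<r_1<r_2$, and suppose that the closed ball of radius $2r_2$ about $x_0$ is compact (as is automatic when $M$ is closed, or complete). For $0<a<b$ write $A(a,b)=B(x_0,b)\setminus\overline{B(x_0,a)}$ for geodesic annuli. Let $u\in C^{1,1}_{loc}\big(A(\tfrac12 r_1,2r_2)\big)$, and suppose that the metric $g_u=e^{-2u}g$ satisfies $$\mathrm{Ric}(g_u)-2\delta\,\sigma_1(A_u)\,g\ \ge\ 0\qquad\text{almost everywhere in }A(\tfrac12 r_1,2r_2),$$ where $A_u=\frac{1}{n-2}\Big(\mathrm{Ric}(g_u)-\frac{R(g_u)}{2(n-1)}g_u\Big)$ is the Weyl–Schouten tensor of $g_u$, $R(g_u)$ is its scalar curvature, and $\sigma_1(A_u)=\mathrm{tr}(g^{-1}A_u)$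 is the trace of $A_u$ with respect to $g$. Then $$\int_{A(r_1,r_2)}|\nabla u|^p e^{\alpha u}\,dvol_g\ \le\ C\Big(\int_{A(\frac12 r_1,2r_2)}|Ric_g|^{p/2}e^{\alpha u}\,dvol_g+r_1^{-p}\int_{A(\frac12 r_1,r_1)}e^{\alpha u}\,dvol_g+r_2^{-p}\int_{A(r_2,2r_2)}e^{\alpha u}\,dvol_g\Big),$$ where the gradient, its norm and the norm of the Ricci tensor are those of $g$, and the integrals take values in $[0,\infty]$. -/

import Mathlib

open Bundle
open scoped Manifold ContDiff ENNReal MeasureTheory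

noncomputable section

namespace ConformalRicci

/-! ### Curvature of a metric given in coordinates

`G : EuclideanSpace ℝ (Fin n) → Matrix (Fin n) (Fin n) ℝ` is the matrix `(g_ij)` of a metric in a
coordinate system. For a metric of class `C^{1,1}` the derivatives of the Christoffel symbols exist
only almost everywhere, and so does the curvature; at the remaining points `fderiv` takes default
values, which are irrelevant because the curvature of such a metric is used almost everywhere only.
-/

/-- The partial derivative `∂_i f` at `y`. -/
def partialDeriv {n : ℕ} (i : Fin n) (f : EuclideanSpace ℝ (Fin n) → ℝ)
    (y : EuclideanSpace ℝ (Fin n)) : ℝ :=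
  fderiv ℝ f y (EuclideanSpace.single i 1)

/-- The Christoffel symbol `Γ^k_ij = (1/2) g^{kl} (∂_i g_jl + ∂_j g_il - ∂_l g_ij)`. -/
def christoffel {n : ℕ} (G : EuclideanSpace ℝ (Fin n) → Matrix (Fin n) (Fin n) ℝ)
    (k i j : Fin n) (y : EuclideanSpace ℝ (Fin n)) : ℝ :=
  (1 / 2) * ∑ l, (G y)⁻¹ k l *
    (partialDeriv i (fun z => G z j l) y + partialDeriv j (fun z => G z i l) y
      - partialDeriv l (fun z => G z i j) y)

/-- The Ricci tensor `R_ij = ∂_k Γ^k_ij - ∂_j Γ^k_ik + Γ^k_kl Γ^l_ij - Γ^k_jl Γ^l_ik`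
(positive on round spheres). -/
def ricci {n : ℕ} (G : EuclideanSpace ℝ (Fin n) → Matrix (Fin n) (Fin n) ℝ)
    (y : EuclideanSpace ℝ (Fin n)) : Matrix (Fin n) (Fin n) ℝ :=
  Matrix.of fun i j => ∑ k, (partialDeriv k (christoffel G k i j) y
    - partialDeriv j (christoffel G k i k) y
    + ∑ l, (christoffel G k k l y * christoffel G l i j y
      - christoffel G k j l y * christoffel G l i k y))

/-- The scalar curvature `R = g^{ij} R_ij`. -/
def scalarCurvature {n : ℕ} (G : EuclideanSpace ℝ (Fin n) → Matrix (Fin n) (Fin n) ℝ)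
    (y : EuclideanSpace ℝ (Fin n)) : ℝ :=
  ((G y)⁻¹ * ricci G y).trace

/-- The Weyl-Schouten tensor `A = (Ric - R g / (2 (n - 1))) / (n - 2)`. -/
def schouten {n : ℕ} (G : EuclideanSpace ℝ (Fin n) → Matrix (Fin n) (Fin n) ℝ)
    (y : EuclideanSpace ℝ (Fin n)) : Matrix (Fin n) (Fin n) ℝ :=
  (1 / ((n : ℝ) - 2)) •
    (ricci G y - (scalarCurvature G y / (2 * ((n : ℝ) - 1))) • G y)

/-- `σ_1(T)` for a bilinear form `T` on a space with inner product matrix `g`: the sum of the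
eigenvalues of `g⁻¹ T`. -/
def sigmaOne {n : ℕ} (g T : Matrix (Fin n) (Fin n) ℝ) : ℝ :=
  (g⁻¹ * T).trace

/-- The norm of a bilinear form `T` on a space with inner product matrix `g`:
`|T|^2 = g^{ik} g^{jl} T_ij T_kl`. -/
def tensorNorm {n : ℕ} (g T : Matrix (Fin n) (Fin n) ℝ) : ℝ :=
  Real.sqrt (∑ i, ∑ j, ∑ k, ∑ l, g⁻¹ i k * g⁻¹ j l * T i j * T k l)

/-- The conformal metric `g_f = e^{-2f} g`. -/
def conformalMetric {n : ℕ} (G : EuclideanSpace ℝ (Fin n) → Matrix (Fin n) (Fin n) ℝ)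
    (f : EuclideanSpace ℝ (Fin n) → ℝ) (y : EuclideanSpace ℝ (Fin n)) :
    Matrix (Fin n) (Fin n) ℝ :=
  Real.exp (-2 * f y) • G y

/-! ### Riemannian manifolds -/

section Manifold

variable {n : ℕ} {M : Type*} [TopologicalSpace M] [ChartedSpace (EuclideanSpace ℝ (Fin n)) M]

/-- `u` expressed in the preferred chart at `x`. -/
def localRep (u : M → ℝ) (x : M) : EuclideanSpace ℝ (Fin n) → ℝ :=
  fun y => u ((chartAt (EuclideanSpace ℝ (Fin n)) x).symm y)

/-- `u` is of class `C^{1,1}_loc` on the open set `U`: near every point of `U`, in a chart, `u` is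
differentiable with Lipschitz derivative. -/
def IsC11LocOn (n : ℕ) {M : Type*} [TopologicalSpace M]
    [ChartedSpace (EuclideanSpace ℝ (Fin n)) M] (u : M → ℝ) (U : Set M) : Prop :=
  ∀ x ∈ U, ∃ s ∈ nhds (chartAt (EuclideanSpace ℝ (Fin n)) x x),
    (∀ y ∈ s, DifferentiableAt ℝ (localRep u x) y) ∧
    ∃ K, LipschitzOnWith K (fderiv ℝ (localRep u x)) s

/-- The coordinate vector field `∂_i` of the chart `e`, at the point of the manifold with coordinates
`y`. -/
def coordVector (e : OpenPartialHomeomorph M (EuclideanSpace ℝ (Fin n)))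
    (y : EuclideanSpace ℝ (Fin n)) (i : Fin n) :
    TangentSpace 𝓘(ℝ, EuclideanSpace ℝ (Fin n)) (e.symm y) :=
  @mfderiv ℝ _ (EuclideanSpace ℝ (Fin n)) _ _ (EuclideanSpace ℝ (Fin n)) _
    𝓘(ℝ, EuclideanSpace ℝ (Fin n)) (EuclideanSpace ℝ (Fin n)) _ (chartedSpaceSelf _)
    (EuclideanSpace ℝ (Fin n)) _ _ (EuclideanSpace ℝ (Fin n)) _
    𝓘(ℝ, EuclideanSpace ℝ (Fin n)) M _ _ e.symm y
    (EuclideanSpace.single i (1 : ℝ) : EuclideanSpace ℝ (Fin n))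

variable [RiemannianBundle (fun x : M => TangentSpace 𝓘(ℝ, EuclideanSpace ℝ (Fin n)) x)]

/-- The matrix `g_ij = ⟨∂_i, ∂_j⟩` of the Riemannian metric in the chart `e`. -/
def metricMatrix (e : OpenPartialHomeomorph M (EuclideanSpace ℝ (Fin n)))
    (y : EuclideanSpace ℝ (Fin n)) : Matrix (Fin n) (Fin n) ℝ :=
  Matrix.of fun i j => inner ℝ (coordVector e y i) (coordVector e y j)

/-- The measure `√(det g_ij) dy` of a chart, transported to the manifold. -/
def chartVolume [MeasurableSpace M]
    (e : OpenPartialHomeomorph M (EuclideanSpace ℝ (Fin n))) : MeasureTheory.Measure M :=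
  ((MeasureTheory.volume.restrict e.target).withDensity
    (fun y => ENNReal.ofReal (Real.sqrt (metricMatrix e y).det))).map e.symm

variable (n M) in
/-- The Riemannian volume measure `dvol_g`. Since `chartVolume e` is the restriction of `dvol_g` to
the domain of `e`, and countably many of these domains cover a second countable manifold, `dvol_g`
is the supremum (the smallest upper bound) of the measures `chartVolume e` over all charts of the
atlas. -/
def riemannianVolume [MeasurableSpace M] : MeasureTheory.Measure M :=
  ⨆ e ∈ atlas (EuclideanSpace ℝ (Fin n)) M, chartVolume e

variable (n) in
/-- The norm `|∇u|` of the gradient at `x`: `|∇u|^2 = g^{ij} ∂_i u ∂_j u`. -/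
def gradNorm (u : M → ℝ) (x : M) : ℝ :=
  let y := chartAt (EuclideanSpace ℝ (Fin n)) x x
  let g := metricMatrix (chartAt (EuclideanSpace ℝ (Fin n)) x) y
  Real.sqrt (∑ i, ∑ j, g⁻¹ i j * partialDeriv i (localRep u x) y * partialDeriv j (localRep u x) y)

variable (n) in
/-- The norm `|Ric_g|` of the Ricci tensor of `g` at `x`. -/
def ricciNorm (x : M) : ℝ :=
  let y := chartAt (EuclideanSpace ℝ (Fin n)) x x
  let G := metricMatrix (chartAt (EuclideanSpace ℝ (Fin n)) x)
  tensorNorm (G y) (ricci G y)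

variable (n) in
/-- The inequality of quadratic forms `Ric(g_u) - 2 δ σ_1(A_u) g ≥ 0` at the point `x`, where
`g_u = e^{-2u} g` and `σ_1(A_u)` is the trace of the Weyl-Schouten tensor `A_u` of `g_u` with respect
to the background metric `g`. -/
def RicciPinchedAt (δ : ℝ) (u : M → ℝ) (x : M) : Prop :=
  let y := chartAt (EuclideanSpace ℝ (Fin n)) x x
  let G := metricMatrix (chartAt (EuclideanSpace ℝ (Fin n)) x)
  let Gu := conformalMetric G (localRep u x)
  ∀ ξ : Fin n → ℝ,
    0 ≤ ξ ⬝ᵥ (ricci Gu y - (2 * δ * sigmaOne (G y) (schouten Gu y)) • G y).mulVec ξ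

end Manifold

/-- The annulus `A(a, b) = B(x₀, b) \ closure B(x₀, a)`. -/
def annulus {M : Type*} [MetricSpace M] (x₀ : M) (a b : ℝ) : Set M :=
  Metric.ball x₀ b \ closure (Metric.ball x₀ a)

/-- `α_δ = (n - 2) δ / (1 - 2 δ)`. -/
def alphaDelta (n : ℕ) (δ : ℝ) : ℝ :=
  ((n : ℝ) - 2) / (1 - 2 * δ) * δ

/-- `p = n + 2 α_δ`. -/
def gradExponent (n : ℕ) (δ : ℝ) : ℝ :=
  (n : ℝ) + 2 * alphaDelta n δ

end ConformalRicci

end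

/-!
Write `N = |∇u|` and consider the vector field `V = N^{p-2} e^{αu} ∇u`. In terms of the background
metric `g`, the Ricci tensor of `e^{-2u} g` is
`Ric + (n-2) ∇²u + Δu g + (n-2) (∇u ⊗ ∇u - N² g)`
(`IsMetricAt.ricci_conformalMetric`). If the pinching condition is evaluated on `∇u`, the last two
terms cancel, and what is left, divided by `1 - 2δ`, reads
`0 ≤ (p-2) ∇²u(∇u, ∇u) + N² Δu + α_δ N⁴ + C |Ric| N²`
(`IsMetricAt.pinched_gradient`). Multiplied by `N^{p-4} e^{αu}`, the first two terms are
`div V - α N^p e^{αu}`; this is the reason for the value of `p`. Hence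
`div V ≥ e^{αu} ((α - α_δ) N^p - C |Ric| N^{p-2})`
almost everywhere (`IsMetricAt.le_gradFlux`).

The estimate results from testing with `η^p` for a radial cutoff `η` that equals `1` on `A(r₁, r₂)`
and is supported in a compact part of `A(r₁/2, 2r₂)`: since `∫ div (η^p V) = 0`
(`integral_testFlux_eq_zero`), the integral of `η^p N^p e^{αu}` is bounded by those of
`η^p |Ric| N^{p-2} e^{αu}` and `η^{p-1} |∇η| N^{p-1} e^{αu}`, and Young's inequality (`exists_young`,
`absorb_le`) absorbs the powers of `N`.

The divergence theorem is proved in coordinates, where it says that the integral of a derivative of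
a compactly supported Lipschitz function vanishes (`integral_divergence_eq_zero`). For this `N` has to
be locally Lipschitz also at the critical points of `u`, see `IsMetricAt.lipAt_sqrt_gradInner`. The
passage to the manifold uses a partition of unity, the description of the volume in charts
(`restrict_riemannianVolume`) and the invariance of gradient, Laplacian and Hessian under isometric
changes of coordinates (`IsIsometryAt`); curvature enters only through pointwise inequalities, so that
its invariance is not needed. That `|∇η|` is bounded by the Lipschitz constant of `η` for the
Riemannian distance is `abs_gradInner_le_of_lipschitz`. Finiteness of the right-hand side of the
estimate is not assumed; `lintegral_ofReal_le_of_integral_eq_zero` deals with this.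
-/

namespace ConformalRicci

section Proof

set_option linter.unusedSectionVars false

open Filter Topology Matrix MeasureTheory

variable {n : ℕ}

/-! ### Metrics and gradients in coordinates -/

section PartialDeriv

variable {f h : EuclideanSpace ℝ (Fin n) → ℝ} {y : EuclideanSpace ℝ (Fin n)}

lemma partialDeriv_congr (i : Fin n) (H : f =ᶠ[𝓝 y] h) :
    partialDeriv i f y = partialDeriv i h y := by
  simp only [partialDeriv, H.fderiv_eq]

lemma partialDeriv_add (i : Fin n) (hf : DifferentiableAt ℝ f y) (hh : DifferentiableAt ℝ h y) :
    partialDeriv i (fun z => f z + h z) y = partialDeriv i f y + partialDeriv i h y := by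
  simp only [partialDeriv]
  rw [fderiv_fun_add hf hh]; rfl

lemma partialDeriv_sub (i : Fin n) (hf : DifferentiableAt ℝ f y) (hh : DifferentiableAt ℝ h y) :
    partialDeriv i (fun z => f z - h z) y = partialDeriv i f y - partialDeriv i h y := by
  simp only [partialDeriv]
  rw [fderiv_fun_sub hf hh]; rfl

lemma partialDeriv_mul (i : Fin n) (hf : DifferentiableAt ℝ f y) (hh : DifferentiableAt ℝ h y) :
    partialDeriv i (fun z => f z * h z) y
      = f y * partialDeriv i h y + h y * partialDeriv i f y := by
  simp only [partialDeriv]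
  rw [fderiv_fun_mul hf hh]; simp

lemma partialDeriv_const_mul (i : Fin n) (c : ℝ) (hf : DifferentiableAt ℝ f y) :
    partialDeriv i (fun z => c * f z) y = c * partialDeriv i f y := by
  simp only [partialDeriv]
  rw [fderiv_const_mul hf]; simp

lemma partialDeriv_sum (i : Fin n) {ι : Type*} (s : Finset ι)
    {f : ι → EuclideanSpace ℝ (Fin n) → ℝ} (hf : ∀ a ∈ s, DifferentiableAt ℝ (f a) y) :
    partialDeriv i (fun z => ∑ a ∈ s, f a z) y = ∑ a ∈ s, partialDeriv i (f a) y := by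
  simp only [partialDeriv]
  rw [fderiv_fun_sum hf]; simp

lemma partialDeriv_comp (i : Fin n) {φ : ℝ → ℝ} {φ' : ℝ} (hφ : HasDerivAt φ φ' (f y))
    (hf : DifferentiableAt ℝ f y) :
    partialDeriv i (fun z => φ (f z)) y = φ' * partialDeriv i f y := by
  simp only [partialDeriv]
  have := (hφ.comp_hasFDerivAt y hf.hasFDerivAt).fderiv
  simp only [Function.comp_def] at this
  rw [this]; simp

lemma fderiv_apply_eq_sum (v : EuclideanSpace ℝ (Fin n)) :
    fderiv ℝ f y v = ∑ i, v i * partialDeriv i f y := by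
  have hv : v = ∑ i, v i • EuclideanSpace.single i (1 : ℝ) := by
    ext j
    simp [Finset.sum_apply, Pi.single_apply]
  conv_lhs => rw [hv]
  simp [partialDeriv]

end PartialDeriv

/-- `G` is the matrix of a Riemannian metric of class `C²` near `y`. -/
structure IsMetricAt (G : EuclideanSpace ℝ (Fin n) → Matrix (Fin n) (Fin n) ℝ)
    (y : EuclideanSpace ℝ (Fin n)) : Prop where
  contDiffAt : ∀ i j, ContDiffAt ℝ 2 (fun z => G z i j) y
  posDef : ∀ᶠ z in 𝓝 y, (G z).PosDef

section Metric

variable {G : EuclideanSpace ℝ (Fin n) → Matrix (Fin n) (Fin n) ℝ}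
  {y : EuclideanSpace ℝ (Fin n)}

lemma IsMetricAt.eventually (hG : IsMetricAt G y) : ∀ᶠ z in 𝓝 y, IsMetricAt G z := by
  have h1 : ∀ᶠ z in 𝓝 y, ∀ i j, ContDiffAt ℝ 2 (fun z => G z i j) z := by
    simp only [eventually_all]
    exact fun i j => (hG.contDiffAt i j).eventually (by simp)
  filter_upwards [h1, hG.posDef.eventually_nhds] with z h1 h2
  exact ⟨h1, h2⟩

lemma IsMetricAt.posDef_self (hG : IsMetricAt G y) : (G y).PosDef := hG.posDef.self_of_nhds

lemma IsMetricAt.differentiableAt (hG : IsMetricAt G y) (i j : Fin n) :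
    DifferentiableAt ℝ (fun z => G z i j) y :=
  (hG.contDiffAt i j).differentiableAt (by norm_num)

lemma _root_.Matrix.PosDef.apply_comm {A : Matrix (Fin n) (Fin n) ℝ} (hA : A.PosDef)
    (i j : Fin n) : A i j = A j i := by
  simpa using (hA.isHermitian.apply j i)

lemma _root_.Matrix.PosDef.isUnit_det_of_posDef {A : Matrix (Fin n) (Fin n) ℝ} (hA : A.PosDef) :
    IsUnit A.det := hA.det_pos.ne'.isUnit

lemma contDiffAt_det {m : ℕ} {k : ℕ∞ω} {A : EuclideanSpace ℝ (Fin n) → Matrix (Fin m) (Fin m) ℝ}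
    (hA : ∀ i j, ContDiffAt ℝ k (fun z => A z i j) y) :
    ContDiffAt ℝ k (fun z => (A z).det) y := by
  simp only [Matrix.det_apply]
  refine ContDiffAt.sum fun σ _ => ?_
  exact (contDiffAt_prod fun i _ => hA _ _).const_smul _

lemma IsMetricAt.contDiffAt_inv (hG : IsMetricAt G y) (i j : Fin n) :
    ContDiffAt ℝ 2 (fun z => (G z)⁻¹ i j) y := by
  have h1 : ContDiffAt ℝ 2 (fun z => (G z).det) y := contDiffAt_det hG.contDiffAt
  have h2 : ContDiffAt ℝ 2 (fun z => (G z).adjugate i j) y := by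
    simp only [Matrix.adjugate_apply]
    refine contDiffAt_det fun a b => ?_
    by_cases hab : a = j
    · subst hab
      simp only [Matrix.updateRow_self]
      exact contDiffAt_const
    · simp only [Matrix.updateRow_ne hab]
      exact hG.contDiffAt a b
  have h3 := (h1.inv hG.posDef_self.det_pos.ne').mul h2
  refine h3.congr_of_eventuallyEq ?_
  filter_upwards with z
  simp [Matrix.inv_def]

lemma IsMetricAt.differentiableAt_inv (hG : IsMetricAt G y) (i j : Fin n) :
    DifferentiableAt ℝ (fun z => (G z)⁻¹ i j) y :=
  (hG.contDiffAt_inv i j).differentiableAt (by norm_num)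

lemma contDiffAt_partialDeriv {f : EuclideanSpace ℝ (Fin n) → ℝ} {k m : ℕ∞ω}
    (hf : ContDiffAt ℝ k f y) (hm : m + 1 ≤ k) (i : Fin n) :
    ContDiffAt ℝ m (partialDeriv i f) y :=
  (hf.fderiv_right hm).clm_apply contDiffAt_const

lemma IsMetricAt.contDiffAt_christoffel (hG : IsMetricAt G y) (k i j : Fin n) :
    ContDiffAt ℝ 1 (christoffel G k i j) y := by
  unfold christoffel
  refine contDiffAt_const.mul (ContDiffAt.sum fun l _ => ?_)
  have h (a b c : Fin n) : ContDiffAt ℝ 1 (partialDeriv a (fun z => G z b c)) y :=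
    contDiffAt_partialDeriv (hG.contDiffAt b c) (by norm_num) a
  exact ((hG.contDiffAt_inv k l).of_le (by norm_num)).mul (((h _ _ _).add (h _ _ _)).sub (h _ _ _))

lemma IsMetricAt.differentiableAt_christoffel (hG : IsMetricAt G y) (k i j : Fin n) :
    DifferentiableAt ℝ (christoffel G k i j) y :=
  (hG.contDiffAt_christoffel k i j).differentiableAt (by norm_num)

lemma IsMetricAt.inv_comm (hG : IsMetricAt G y) (i j : Fin n) : (G y)⁻¹ i j = (G y)⁻¹ j i :=
  hG.posDef_self.inv.apply_comm i j

lemma IsMetricAt.sum_metric_mul_inv (hG : IsMetricAt G y) (i j : Fin n) :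
    ∑ k, G y i k * (G y)⁻¹ k j = if i = j then 1 else 0 := by
  have := congrFun (congrFun (Matrix.mul_nonsing_inv _ hG.posDef_self.isUnit_det_of_posDef) i) j
  rwa [Matrix.mul_apply, Matrix.one_apply] at this

lemma IsMetricAt.sum_inv_mul_metric (hG : IsMetricAt G y) (i j : Fin n) :
    ∑ k, (G y)⁻¹ i k * G y k j = if i = j then 1 else 0 := by
  have := congrFun (congrFun (Matrix.nonsing_inv_mul _ hG.posDef_self.isUnit_det_of_posDef) i) j
  rwa [Matrix.mul_apply, Matrix.one_apply] at this

lemma IsMetricAt.partialDeriv_comm (hG : IsMetricAt G y) (k i j : Fin n) :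
    partialDeriv k (fun z => G z i j) y = partialDeriv k (fun z => G z j i) y :=
  partialDeriv_congr k (hG.posDef.mono fun _ hz => hz.apply_comm i j)

lemma IsMetricAt.christoffel_comm (hG : IsMetricAt G y) (k i j : Fin n) :
    christoffel G k i j y = christoffel G k j i y := by
  unfold christoffel
  congr 1
  refine Finset.sum_congr rfl fun l _ => ?_
  rw [hG.partialDeriv_comm l i j]; ring

/-- The Christoffel symbols of the first kind. -/
lemma IsMetricAt.sum_metric_mul_christoffel (hG : IsMetricAt G y) (j k l : Fin n) :
    ∑ m, G y j m * christoffel G m k l y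
      = (1 / 2) * (partialDeriv k (fun z => G z l j) y + partialDeriv l (fun z => G z k j) y
        - partialDeriv j (fun z => G z k l) y) := by
  unfold christoffel
  have h (m : Fin n) : G y j m * ((1 / 2) * ∑ a, (G y)⁻¹ m a *
      (partialDeriv k (fun z => G z l a) y + partialDeriv l (fun z => G z k a) y
        - partialDeriv a (fun z => G z k l) y))
      = ∑ a, (1 / 2) * ((partialDeriv k (fun z => G z l a) y + partialDeriv l (fun z => G z k a) y
        - partialDeriv a (fun z => G z k l) y)) * (G y j m * (G y)⁻¹ m a) := by
    rw [Finset.mul_sum, Finset.mul_sum]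
    exact Finset.sum_congr rfl fun a _ => by ring
  simp only [h]
  rw [Finset.sum_comm]
  simp only [← Finset.mul_sum, hG.sum_metric_mul_inv]
  simp

/-- The Levi-Civita connection is compatible with the metric. -/
lemma IsMetricAt.partialDeriv_metric (hG : IsMetricAt G y) (k i j : Fin n) :
    partialDeriv k (fun z => G z i j) y
      = ∑ m, G y j m * christoffel G m k i y + ∑ m, G y i m * christoffel G m k j y := by
  rw [hG.sum_metric_mul_christoffel, hG.sum_metric_mul_christoffel, hG.partialDeriv_comm k j i]
  ring

/-- The components `∇^k f = g^{kl} ∂_l f` of the gradient. -/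
noncomputable def gradVec (G : EuclideanSpace ℝ (Fin n) → Matrix (Fin n) (Fin n) ℝ)
    (f : EuclideanSpace ℝ (Fin n) → ℝ) (k : Fin n) (y : EuclideanSpace ℝ (Fin n)) : ℝ :=
  ∑ l, (G y)⁻¹ k l * partialDeriv l f y

/-- The inner product `⟨∇f, ∇h⟩ = g^{ij} ∂_i f ∂_j h` of two gradients. -/
noncomputable def gradInner (G : EuclideanSpace ℝ (Fin n) → Matrix (Fin n) (Fin n) ℝ)
    (f h : EuclideanSpace ℝ (Fin n) → ℝ) (y : EuclideanSpace ℝ (Fin n)) : ℝ :=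
  ∑ i, ∑ j, (G y)⁻¹ i j * partialDeriv i f y * partialDeriv j h y

/-- The Hessian `∇²_ij f = ∂_i ∂_j f - Γ^m_ij ∂_m f`. -/
noncomputable def hessian (G : EuclideanSpace ℝ (Fin n) → Matrix (Fin n) (Fin n) ℝ)
    (f : EuclideanSpace ℝ (Fin n) → ℝ) (y : EuclideanSpace ℝ (Fin n)) :
    Matrix (Fin n) (Fin n) ℝ :=
  Matrix.of fun i j => partialDeriv i (partialDeriv j f) y
    - ∑ m, christoffel G m i j y * partialDeriv m f y

/-- The Laplacian `Δf = g^{ij} ∇²_ij f`. -/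
noncomputable def laplacian (G : EuclideanSpace ℝ (Fin n) → Matrix (Fin n) (Fin n) ℝ)
    (f : EuclideanSpace ℝ (Fin n) → ℝ) (y : EuclideanSpace ℝ (Fin n)) : ℝ :=
  ((G y)⁻¹ * hessian G f y).trace

lemma gradInner_eq_sum (f h : EuclideanSpace ℝ (Fin n) → ℝ) :
    gradInner G f h y = ∑ i, partialDeriv i f y * gradVec G h i y := by
  simp only [gradInner, gradVec, Finset.mul_sum]
  exact Finset.sum_congr rfl fun i _ => Finset.sum_congr rfl fun j _ => by ring

lemma IsMetricAt.sum_metric_mul_gradVec (hG : IsMetricAt G y)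
    (f : EuclideanSpace ℝ (Fin n) → ℝ) (i : Fin n) :
    ∑ k, G y i k * gradVec G f k y = partialDeriv i f y := by
  simp only [gradVec, Finset.mul_sum]
  rw [Finset.sum_comm]
  simp only [← mul_assoc, ← Finset.sum_mul, hG.sum_metric_mul_inv]
  simp

/-- The Christoffel symbols of `e^{-2f} g`. -/
lemma IsMetricAt.christoffel_conformalMetric (hG : IsMetricAt G y)
    {f : EuclideanSpace ℝ (Fin n) → ℝ} (hf : DifferentiableAt ℝ f y) (k i j : Fin n) :
    christoffel (conformalMetric G f) k i j y = christoffel G k i j y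
      + (-(if k = i then 1 else 0) * partialDeriv j f y
        - (if k = j then 1 else 0) * partialDeriv i f y + G y i j * gradVec G f k y) := by
  have hexp : HasDerivAt (fun t => Real.exp (-2 * t)) (Real.exp (-2 * f y) * (-2)) (f y) := by
    simpa using (((hasDerivAt_id (f y)).const_mul (-2)).exp)
  have hd (a b c : Fin n) : partialDeriv a (fun z => conformalMetric G f z b c) y
      = Real.exp (-2 * f y) * (partialDeriv a (fun z => G z b c) y
        - 2 * partialDeriv a f y * G y b c) := by
    simp only [conformalMetric, Matrix.smul_apply, smul_eq_mul]
    rw [partialDeriv_mul a (by fun_prop) (hG.differentiableAt b c),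
      partialDeriv_comp a hexp hf]
    ring
  have hinv (l : Fin n) : (conformalMetric G f y)⁻¹ k l = (Real.exp (-2 * f y))⁻¹ * (G y)⁻¹ k l := by
    have : (conformalMetric G f y)⁻¹ = (Real.exp (-2 * f y))⁻¹ • (G y)⁻¹ := by
      apply Matrix.inv_eq_left_inv
      simp only [conformalMetric, Matrix.smul_mul, Matrix.mul_smul, smul_smul]
      rw [Matrix.nonsing_inv_mul _ hG.posDef_self.isUnit_det_of_posDef, mul_inv_cancel₀ (Real.exp_pos _).ne',
        one_smul]
    rw [this]; rfl
  have hexp0 : Real.exp (-2 * f y) ≠ 0 := (Real.exp_pos _).ne'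
  unfold christoffel
  simp only [hd, hinv]
  have h1 (l : Fin n) : (Real.exp (-2 * f y))⁻¹ * (G y)⁻¹ k l *
      (Real.exp (-2 * f y) * (partialDeriv i (fun z => G z j l) y - 2 * partialDeriv i f y * G y j l)
      + Real.exp (-2 * f y) * (partialDeriv j (fun z => G z i l) y - 2 * partialDeriv j f y * G y i l)
      - Real.exp (-2 * f y) * (partialDeriv l (fun z => G z i j) y - 2 * partialDeriv l f y * G y i j))
      = (G y)⁻¹ k l * (partialDeriv i (fun z => G z j l) y + partialDeriv j (fun z => G z i l) y
        - partialDeriv l (fun z => G z i j) y)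
      - 2 * partialDeriv i f y * ((G y)⁻¹ k l * G y l j)
      - 2 * partialDeriv j f y * ((G y)⁻¹ k l * G y l i)
      + 2 * G y i j * ((G y)⁻¹ k l * partialDeriv l f y) := by
    rw [hG.posDef_self.apply_comm l j, hG.posDef_self.apply_comm l i]
    field_simp
    ring
  simp only [h1, Finset.sum_add_distrib, Finset.sum_sub_distrib, ← Finset.mul_sum,
    hG.sum_inv_mul_metric, gradVec]
  ring

end Metric

/-! ### The conformal change of the Ricci tensor -/

section RicciAlgebra

variable {g : Fin n → Fin n → ℝ} {u U : Fin n → ℝ} {W : Fin n → Fin n → Fin n → ℝ}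

/-- Contraction in the upper index of the tensor `W` that `christoffel_conformalMetric` adds to the
Christoffel symbols; `u` stands for `du`, and `U` for `∇u`. -/
lemma sum_mul_diffTensor
    (hW : ∀ k i j, W k i j = -(if k = i then 1 else 0) * u j - (if k = j then 1 else 0) * u i
      + g i j * U k) (a : Fin n → ℝ) (i j : Fin n) :
    ∑ l, a l * W l i j = -a i * u j - a j * u i + g i j * ∑ l, a l * U l := by
  simp only [hW, mul_add, mul_sub, Finset.sum_add_distrib, Finset.sum_sub_distrib, Finset.mul_sum]
  simp [mul_left_comm]

lemma trace_diffTensor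
    (hW : ∀ k i j, W k i j = -(if k = i then 1 else 0) * u j - (if k = j then 1 else 0) * u i
      + g i j * U k) (hg : ∀ i j, g i j = g j i) (hU : ∀ i, ∑ k, g i k * U k = u i) (l : Fin n) :
    ∑ k, W k k l = -n * u l := by
  have h : ∑ k, g k l * U k = u l := by
    rw [← hU l]; exact Finset.sum_congr rfl fun k _ => by rw [hg]
  simp only [hW, Finset.sum_add_distrib, Finset.sum_sub_distrib, h]
  simp

lemma diffTensor_comm
    (hW : ∀ k i j, W k i j = -(if k = i then 1 else 0) * u j - (if k = j then 1 else 0) * u i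
      + g i j * U k) (hg : ∀ i j, g i j = g j i) (k i j : Fin n) : W k i j = W k j i := by
  rw [hW, hW, hg i j]; ring

/-- The terms of the Ricci tensor of `e^{-2u} g` that are quadratic in `W`. -/
lemma ricci_quadratic_diffTensor
    (hW : ∀ k i j, W k i j = -(if k = i then 1 else 0) * u j - (if k = j then 1 else 0) * u i
      + g i j * U k) (hg : ∀ i j, g i j = g j i) (hU : ∀ i, ∑ k, g i k * U k = u i) (i j : Fin n) :
    ∑ k, ∑ l, (W k k l * W l i j - W k j l * W l i k)
      = (n - 2) * (u i * u j) - (n - 2) * (g i j * ∑ k, u k * U k) := by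
  have hE : ∑ k, ∑ l, W k k l * W l i j
      = 2 * n * (u i * u j) - n * (g i j * ∑ k, u k * U k) := by
    rw [Finset.sum_comm]
    simp only [← Finset.sum_mul, trace_diffTensor hW hg hU, mul_assoc]
    rw [← Finset.mul_sum, sum_mul_diffTensor hW]
    ring
  have hF : ∑ k, ∑ l, W k j l * W l i k
      = (n + 2) * (u i * u j) - 2 * (g i j * ∑ k, u k * U k) := by
    have h1 (k : Fin n) : ∑ l, W k j l * W l i k
        = (if k = j then 1 else 0) * (2 * (u i * u k) - g i k * ∑ l, u l * U l)
          - u j * W k k i + (-(2 * g i j) * (u k * U k) + g i k * U k * u j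
            + g i j * (u k * U k) - g j k * U k * u i) := by
      have h2 (l : Fin n) : W k j l * W l i k = -(if k = j then 1 else 0) * (u l * W l i k)
          - (if k = l then u j * W l i k else 0) + U k * (g j l * W l i k) := by
        rw [hW k j l]
        split_ifs <;> ring
      simp only [h2, Finset.sum_add_distrib, Finset.sum_sub_distrib, ← Finset.mul_sum,
        Finset.sum_ite_eq, Finset.mem_univ, if_true]
      rw [sum_mul_diffTensor hW u i k, sum_mul_diffTensor hW (fun l => g j l) i k, hU,
        diffTensor_comm hW hg k i k, hg j i]
      ring
    simp only [h1, Finset.sum_add_distrib, Finset.sum_sub_distrib, ← Finset.mul_sum,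
      ← Finset.sum_mul, hU, trace_diffTensor hW hg hU]
    simp only [ite_mul, one_mul, zero_mul, Finset.sum_ite_eq', Finset.mem_univ, if_true]
    ring
  simp only [Finset.sum_sub_distrib, hE, hF]
  ring

/-- The terms of the Ricci tensor of `e^{-2u} g` that are linear in `W`, as an identity between the
components at one point: `Γ` and `g` are the Christoffel symbols and the metric, and `dg`, `ddu` and
`dU` the first derivatives of `g_ij`, `u_i` and `U^k = g^{kl} u_l`. -/
lemma ricci_linear_diffTensor {Γ : Fin n → Fin n → Fin n → ℝ} {dg : Fin n → Fin n → Fin n → ℝ}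
    {ddu dU : Fin n → Fin n → ℝ}
    (hW : ∀ k i j, W k i j = -(if k = i then 1 else 0) * u j - (if k = j then 1 else 0) * u i
      + g i j * U k) (hg : ∀ i j, g i j = g j i) (hU : ∀ i, ∑ k, g i k * U k = u i)
    (hΓ : ∀ k i j, Γ k i j = Γ k j i)
    (hdg : ∀ k i j, dg k i j = ∑ m, g j m * Γ m k i + ∑ m, g i m * Γ m k j)
    (hddu : ∀ i j, ddu i j = ddu j i) (i j : Fin n) :
    ∑ k, (-(if k = i then 1 else 0) * ddu k j - (if k = j then 1 else 0) * ddu k i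
        + (g i j * dU k k + U k * dg k i j)) + n * ddu j i
      + ∑ k, ∑ l, (Γ k k l * W l i j + W k k l * Γ l i j - Γ k j l * W l i k - W k j l * Γ l i k)
      = (n - 2) * (ddu i j - ∑ m, Γ m i j * u m)
        + g i j * (∑ k, dU k k + ∑ k, ∑ l, Γ k k l * U l) := by
  have hA : ∑ k, ∑ l, Γ k k l * W l i j = -(∑ k, Γ k k i) * u j - (∑ k, Γ k k j) * u i
      + g i j * ∑ k, ∑ l, Γ k k l * U l := by
    have (k : Fin n) := sum_mul_diffTensor hW (fun l => Γ k k l) i j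
    simp only [this, Finset.sum_add_distrib, Finset.sum_sub_distrib, ← Finset.mul_sum,
      ← Finset.sum_mul, Finset.sum_neg_distrib]
  have hB : ∑ k, ∑ l, W k k l * Γ l i j = -n * ∑ m, Γ m i j * u m := by
    rw [Finset.sum_comm]
    simp only [← Finset.sum_mul, trace_diffTensor hW hg hU]
    rw [Finset.mul_sum]
    exact Finset.sum_congr rfl fun m _ => by ring
  have hC : ∑ k, ∑ l, Γ k j l * W l i k = -(∑ m, Γ m i j * u m) - (∑ k, Γ k k j) * u i
      + ∑ k, ∑ l, g i k * (Γ k j l * U l) := by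
    have (k : Fin n) : ∑ l, Γ k j l * W l i k = -(Γ k i j * u k) - Γ k k j * u i
        + ∑ l, g i k * (Γ k j l * U l) := by
      rw [sum_mul_diffTensor hW (fun l => Γ k j l) i k, hΓ k j i, hΓ k j k, Finset.mul_sum]
      ring
    simp only [this, Finset.sum_add_distrib, Finset.sum_sub_distrib, ← Finset.sum_mul,
      Finset.sum_neg_distrib]
  have hD : ∑ k, ∑ l, W k j l * Γ l i k = -(∑ m, Γ m i j * u m) - u j * (∑ k, Γ k k i)
      + ∑ k, U k * ∑ l, g j l * Γ l i k := by
    have (k : Fin n) : ∑ l, W k j l * Γ l i k = -(if k = j then 1 else 0) * ∑ l, Γ l i k * u l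
        - u j * Γ k k i + U k * ∑ l, g j l * Γ l i k := by
      have h2 (l : Fin n) : W k j l * Γ l i k = -(if k = j then 1 else 0) * (Γ l i k * u l)
          - (if k = l then u j * Γ l i k else 0) + U k * (g j l * Γ l i k) := by
        rw [hW k j l]
        split_ifs <;> ring
      simp only [h2, Finset.sum_add_distrib, Finset.sum_sub_distrib, ← Finset.mul_sum,
        Finset.sum_ite_eq, Finset.mem_univ, if_true, hΓ k i k]
    simp only [this, Finset.sum_add_distrib, Finset.sum_sub_distrib, ← Finset.mul_sum]
    simp
  have hcompat : ∑ k, U k * dg k i j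
      = ∑ k, ∑ l, g i k * (Γ k j l * U l) + ∑ k, U k * ∑ l, g j l * Γ l i k := by
    simp only [hdg, mul_add, Finset.sum_add_distrib]
    rw [add_comm]
    congr 1
    · rw [Finset.sum_comm]
      simp only [Finset.mul_sum]
      exact Finset.sum_congr rfl fun a _ => Finset.sum_congr rfl fun b _ => by
        rw [hΓ b a j]; ring
    · simp only [hΓ _ i]
  simp only [Finset.sum_add_distrib, Finset.sum_sub_distrib, hA, hB, hC, hD, hcompat]
  simp only [neg_mul, ite_mul, one_mul, zero_mul, Finset.sum_neg_distrib, Finset.sum_ite_eq',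
    Finset.mem_univ, if_true,
    ← Finset.mul_sum, hddu j i]
  ring

end RicciAlgebra

section Metric

variable {G : EuclideanSpace ℝ (Fin n) → Matrix (Fin n) (Fin n) ℝ}
  {y : EuclideanSpace ℝ (Fin n)} {f : EuclideanSpace ℝ (Fin n) → ℝ}

/-- `f` is differentiable near `y` and twice differentiable at `y`. -/
structure IsTwiceDiffAt (f : EuclideanSpace ℝ (Fin n) → ℝ) (y : EuclideanSpace ℝ (Fin n)) :
    Prop where
  eventually_differentiableAt : ∀ᶠ z in 𝓝 y, DifferentiableAt ℝ f z
  differentiableAt_fderiv : DifferentiableAt ℝ (fderiv ℝ f) y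

lemma IsTwiceDiffAt.differentiableAt (hf : IsTwiceDiffAt f y) : DifferentiableAt ℝ f y :=
  hf.eventually_differentiableAt.self_of_nhds

lemma IsTwiceDiffAt.differentiableAt_partialDeriv (hf : IsTwiceDiffAt f y) (i : Fin n) :
    DifferentiableAt ℝ (partialDeriv i f) y :=
  hf.differentiableAt_fderiv.clm_apply (differentiableAt_const _)

lemma IsTwiceDiffAt.partialDeriv_partialDeriv (hf : IsTwiceDiffAt f y) (i j : Fin n) :
    partialDeriv i (partialDeriv j f) y
      = fderiv ℝ (fderiv ℝ f) y (EuclideanSpace.single i 1) (EuclideanSpace.single j 1) := by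
  have := (hf.differentiableAt_fderiv.hasFDerivAt.clm_apply
    (hasFDerivAt_const (EuclideanSpace.single j (1 : ℝ)) y)).fderiv
  change fderiv ℝ (fun z => fderiv ℝ f z (EuclideanSpace.single j 1)) y _ = _
  rw [this]
  simp

lemma IsTwiceDiffAt.second_symm (hf : IsTwiceDiffAt f y) (v w : EuclideanSpace ℝ (Fin n)) :
    fderiv ℝ (fderiv ℝ f) y v w = fderiv ℝ (fderiv ℝ f) y w v :=
  second_derivative_symmetric_of_eventually
    (hf.eventually_differentiableAt.mono fun _ hz => hz.hasFDerivAt)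
    hf.differentiableAt_fderiv.hasFDerivAt v w

lemma IsTwiceDiffAt.partialDeriv_comm (hf : IsTwiceDiffAt f y) (i j : Fin n) :
    partialDeriv i (partialDeriv j f) y = partialDeriv j (partialDeriv i f) y := by
  rw [hf.partialDeriv_partialDeriv, hf.partialDeriv_partialDeriv, hf.second_symm]

lemma IsMetricAt.differentiableAt_gradVec (hG : IsMetricAt G y) (hf : IsTwiceDiffAt f y)
    (k : Fin n) : DifferentiableAt ℝ (gradVec G f k) y := by
  unfold gradVec
  exact DifferentiableAt.fun_sum fun l _ =>
    (hG.differentiableAt_inv k l).fun_mul (hf.differentiableAt_partialDeriv l)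

/-- Differentiating `u_i = g_ik u^k`. -/
lemma IsMetricAt.partialDeriv_partialDeriv (hG : IsMetricAt G y) (hf : IsTwiceDiffAt f y)
    (k i : Fin n) : partialDeriv k (partialDeriv i f) y
      = ∑ l, G y i l * partialDeriv k (gradVec G f l) y
        + ∑ l, gradVec G f l y * partialDeriv k (fun z => G z i l) y := by
  have h : partialDeriv i f =ᶠ[𝓝 y] fun z => ∑ l, G z i l * gradVec G f l z := by
    filter_upwards [hG.eventually] with z hz
    exact (hz.sum_metric_mul_gradVec f i).symm
  rw [partialDeriv_congr k h, partialDeriv_sum k _ fun l _ =>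
    (hG.differentiableAt i l).fun_mul (hG.differentiableAt_gradVec hf l), ← Finset.sum_add_distrib]
  exact Finset.sum_congr rfl fun l _ =>
    partialDeriv_mul k (hG.differentiableAt i l) (hG.differentiableAt_gradVec hf l)

/-- The Laplacian is the divergence of the gradient. -/
lemma IsMetricAt.laplacian_eq_divergence (hG : IsMetricAt G y) (hf : IsTwiceDiffAt f y) :
    laplacian G f y = ∑ k, partialDeriv k (gradVec G f k) y
      + ∑ k, ∑ l, christoffel G k k l y * gradVec G f l y := by
  have h1 : laplacian G f y = ∑ i, ∑ j, (G y)⁻¹ i j * partialDeriv i (partialDeriv j f) y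
      - ∑ i, ∑ j, (G y)⁻¹ i j * ∑ m, christoffel G m i j y * partialDeriv m f y := by
    simp only [laplacian, Matrix.trace, Matrix.diag, Matrix.mul_apply, hessian, Matrix.of_apply,
      mul_sub, Finset.sum_sub_distrib]
    congr 1
    · exact Finset.sum_congr rfl fun i _ => Finset.sum_congr rfl fun j _ => by
        rw [hf.partialDeriv_comm]
    · exact Finset.sum_congr rfl fun i _ => Finset.sum_congr rfl fun j _ => by
        simp only [hG.christoffel_comm _ j i]
  have h2 : ∑ i, ∑ j, (G y)⁻¹ i j * ∑ l, G y j l * partialDeriv i (gradVec G f l) y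
      = ∑ k, partialDeriv k (gradVec G f k) y := by
    refine Finset.sum_congr rfl fun i _ => ?_
    simp only [Finset.mul_sum]
    rw [Finset.sum_comm]
    simp only [← mul_assoc, ← Finset.sum_mul, hG.sum_inv_mul_metric]
    simp
  have h3 : ∑ i, ∑ j, (G y)⁻¹ i j * ∑ l, gradVec G f l y *
        ∑ m, G y j m * christoffel G m i l y
      = ∑ k, ∑ l, christoffel G k k l y * gradVec G f l y := by
    refine Finset.sum_congr rfl fun i _ => ?_
    simp only [Finset.mul_sum]
    rw [Finset.sum_comm]
    refine Finset.sum_congr rfl fun l _ => ?_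
    rw [Finset.sum_comm]
    have (m : Fin n) : ∑ j, (G y)⁻¹ i j * (gradVec G f l y * (G y j m * christoffel G m i l y))
        = (∑ j, (G y)⁻¹ i j * G y j m) * (christoffel G m i l y * gradVec G f l y) := by
      rw [Finset.sum_mul]
      exact Finset.sum_congr rfl fun j _ => by ring
    simp only [this, hG.sum_inv_mul_metric]
    simp
  have h4 : ∑ i, ∑ j, (G y)⁻¹ i j * ∑ l, gradVec G f l y *
        ∑ m, G y l m * christoffel G m i j y
      = ∑ i, ∑ j, (G y)⁻¹ i j * ∑ m, christoffel G m i j y * partialDeriv m f y := by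
    refine Finset.sum_congr rfl fun i _ => Finset.sum_congr rfl fun j _ => ?_
    congr 1
    simp only [Finset.mul_sum]
    rw [Finset.sum_comm]
    refine Finset.sum_congr rfl fun m _ => ?_
    rw [← hG.sum_metric_mul_gradVec f m, Finset.mul_sum]
    exact Finset.sum_congr rfl fun l _ => by rw [hG.posDef_self.apply_comm l m]; ring
  rw [h1]
  simp only [hG.partialDeriv_partialDeriv hf, mul_add, Finset.sum_add_distrib]
  rw [h2, ← h4, ← h3]
  simp only [hG.partialDeriv_metric, mul_add, Finset.sum_add_distrib]
  ring

/-- The Ricci tensor of `e^{-2f} g`. It suffices that `f` is twice differentiable at the point in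
question, which is what a `C^{1,1}` function offers almost everywhere. -/
lemma IsMetricAt.ricci_conformalMetric (hG : IsMetricAt G y) (hf : IsTwiceDiffAt f y)
    (i j : Fin n) :
    ricci (conformalMetric G f) y i j = ricci G y i j + (n - 2) * hessian G f y i j
      + laplacian G f y * G y i j + (n - 2) * (partialDeriv i f y * partialDeriv j f y
        - gradInner G f f y * G y i j) := by
  set W : Fin n → Fin n → Fin n → EuclideanSpace ℝ (Fin n) → ℝ := fun k i j z =>
    -(if k = i then 1 else 0) * partialDeriv j f z
        - (if k = j then 1 else 0) * partialDeriv i f z + G z i j * gradVec G f k z with hW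
  have hev : ∀ᶠ z in 𝓝 y, IsMetricAt G z ∧ DifferentiableAt ℝ f z :=
    hG.eventually.and hf.eventually_differentiableAt
  have hchr (k i j : Fin n) : christoffel (conformalMetric G f) k i j =ᶠ[𝓝 y]
      fun z => christoffel G k i j z + W k i j z := by
    filter_upwards [hev] with z hz
    exact hz.1.christoffel_conformalMetric hz.2 k i j
  have hdW (k i j : Fin n) : DifferentiableAt ℝ (W k i j) y :=
    (((hf.differentiableAt_partialDeriv j).const_mul _).fun_sub
      ((hf.differentiableAt_partialDeriv i).const_mul _)).add
      ((hG.differentiableAt i j).fun_mul (hG.differentiableAt_gradVec hf k))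
  have hWd (m k i j : Fin n) : partialDeriv m (W k i j) y
      = -(if k = i then 1 else 0) * partialDeriv m (partialDeriv j f) y
        - (if k = j then 1 else 0) * partialDeriv m (partialDeriv i f) y
        + (G y i j * partialDeriv m (gradVec G f k) y
          + gradVec G f k y * partialDeriv m (fun z => G z i j) y) := by
    rw [hW]
    dsimp only
    rw [partialDeriv_add m (((hf.differentiableAt_partialDeriv j).const_mul _).fun_sub
      ((hf.differentiableAt_partialDeriv i).const_mul _))
      ((hG.differentiableAt i j).fun_mul (hG.differentiableAt_gradVec hf k)),
      partialDeriv_sub m ((hf.differentiableAt_partialDeriv j).const_mul _)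
      ((hf.differentiableAt_partialDeriv i).const_mul _),
      partialDeriv_mul m (hG.differentiableAt i j) (hG.differentiableAt_gradVec hf k),
      partialDeriv_const_mul m _ (hf.differentiableAt_partialDeriv j),
      partialDeriv_const_mul m _ (hf.differentiableAt_partialDeriv i)]
  have hWdef (k i j : Fin n) : W k i j y = -(if k = i then 1 else 0) * partialDeriv j f y
        - (if k = j then 1 else 0) * partialDeriv i f y + G y i j * gradVec G f k y := rfl
  -- the trace `W^k_ik` is `- n ∂_i f` near `y`
  have htr : ∑ k, partialDeriv j (W k i k) y = -n * partialDeriv j (partialDeriv i f) y := by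
    have h1 : (fun z => ∑ k, W k i k z) =ᶠ[𝓝 y] fun z => -n * partialDeriv i f z := by
      filter_upwards [hG.eventually] with z hz
      have hWz : ∀ k i j, W k i j z = -(if k = i then 1 else 0) * partialDeriv j f z
        - (if k = j then 1 else 0) * partialDeriv i f z + G z i j * gradVec G f k z :=
        fun _ _ _ => rfl
      rw [← trace_diffTensor hWz hz.posDef_self.apply_comm (hz.sum_metric_mul_gradVec f) i]
      exact Finset.sum_congr rfl fun k _ =>
        diffTensor_comm hWz hz.posDef_self.apply_comm k i k
    rw [← partialDeriv_sum j _ fun k _ => hdW k i k, partialDeriv_congr j h1,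
      partialDeriv_const_mul j _ (hf.differentiableAt_partialDeriv i)]
  have hlin := ricci_linear_diffTensor (W := fun k i j => W k i j y)
    (Γ := fun k i j => christoffel G k i j y) (dU := fun k l => partialDeriv k (gradVec G f l) y)
    (dg := fun k i j => partialDeriv k (fun z => G z i j) y)
    (ddu := fun i j => partialDeriv i (partialDeriv j f) y) hWdef hG.posDef_self.apply_comm
    (hG.sum_metric_mul_gradVec f) hG.christoffel_comm hG.partialDeriv_metric hf.partialDeriv_comm i j
  have hquad := ricci_quadratic_diffTensor hWdef hG.posDef_self.apply_comm
    (hG.sum_metric_mul_gradVec f) i j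
  have hlap := hG.laplacian_eq_divergence hf
  have hinner := gradInner_eq_sum (G := G) (y := y) f f
  have hexpand : ricci (conformalMetric G f) y i j = ricci G y i j
      + (∑ k, partialDeriv k (W k i j) y - ∑ k, partialDeriv j (W k i k) y)
      + ∑ k, ∑ l, (christoffel G k k l y * W l i j y + W k k l y * christoffel G l i j y
        - christoffel G k j l y * W l i k y - W k j l y * christoffel G l i k y)
      + ∑ k, ∑ l, (W k k l y * W l i j y - W k j l y * W l i k y) := by
    simp only [ricci, Matrix.of_apply, ← Finset.sum_add_distrib, ← Finset.sum_sub_distrib]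
    refine Finset.sum_congr rfl fun k _ => ?_
    have hpt (k i j : Fin n) : christoffel (conformalMetric G f) k i j y
      = christoffel G k i j y + W k i j y := (hchr k i j).self_of_nhds
    rw [partialDeriv_congr k (hchr k i j), partialDeriv_congr j (hchr k i k),
      partialDeriv_add k (hG.differentiableAt_christoffel k i j) (hdW k i j),
      partialDeriv_add j (hG.differentiableAt_christoffel k i k) (hdW k i k)]
    simp only [hpt]
    have : ∀ a b c d e : ℝ, ∀ s t r : ℝ, s = c + t + r →
      a + b - (d + e) + s = a - d + c + (b - e) + t + r := by intros; linarith
    apply this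
    rw [← Finset.sum_add_distrib, ← Finset.sum_add_distrib]
    exact Finset.sum_congr rfl fun l _ => by ring
  rw [hexpand, htr]
  simp only [hWd]
  rw [hquad, hinner, hlap]
  simp only [hessian, Matrix.of_apply]
  linear_combination hlin

end Metric

/-! ### The pinching condition in the direction of the gradient -/

section Tensor

/-- The norm of a tensor is the Euclidean norm of its components in an orthonormal frame. -/
lemma exists_orthonormal_components {g : Matrix (Fin n) (Fin n) ℝ} (hg : g.PosDef)
    (T : Matrix (Fin n) (Fin n) ℝ) : ∃ B : Matrix (Fin n) (Fin n) ℝ, g⁻¹ = Bᵀ * B ∧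
      tensorNorm g T = Real.sqrt (∑ p : Fin n × Fin n, (B * T * Bᵀ) p.1 p.2 ^ 2) := by
  obtain ⟨B, hB⟩ : ∃ B : Matrix (Fin n) (Fin n) ℝ, g⁻¹ = Bᵀ * B := by
    open scoped MatrixOrder Matrix.Norms.L2Operator in
    obtain ⟨B, hB⟩ := CStarAlgebra.nonneg_iff_eq_star_mul_self.mp hg.inv.posSemidef.nonneg
    exact ⟨B, by rw [hB, Matrix.star_eq_conjTranspose,
      Matrix.conjTranspose_eq_transpose_of_trivial]⟩
  refine ⟨B, hB, ?_⟩
  unfold tensorNorm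
  congr 1
  have hsym (i j) : g⁻¹ i j = g⁻¹ j i := hg.inv.apply_comm i j
  have h1 : ∑ i, ∑ j, ∑ k, ∑ l, g⁻¹ i k * g⁻¹ j l * T i j * T k l
      = (Tᵀ * (g⁻¹ * T * g⁻¹)).trace := by
    simp only [Matrix.trace, Matrix.diag, Matrix.mul_apply, Matrix.transpose_apply, Finset.sum_mul,
      Finset.mul_sum]
    rw [Finset.sum_comm]
    refine Finset.sum_congr rfl fun j _ => Finset.sum_congr rfl fun i _ => ?_
    rw [Finset.sum_comm]
    refine Finset.sum_congr rfl fun l _ => Finset.sum_congr rfl fun k _ => ?_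
    rw [hsym j l]; ring
  have h2 : ∑ p : Fin n × Fin n, (B * T * Bᵀ) p.1 p.2 ^ 2
      = ((B * T * Bᵀ)ᵀ * (B * T * Bᵀ)).trace := by
    rw [Fintype.sum_prod_type, Finset.sum_comm]
    simp only [Matrix.trace, Matrix.diag, Matrix.mul_apply (M := (B * T * Bᵀ)ᵀ),
      Matrix.transpose_apply (M := B * T * Bᵀ), sq]
  rw [h1, h2, hB]
  simp only [Matrix.transpose_mul, Matrix.transpose_transpose, Matrix.mul_assoc]
  rw [Matrix.trace_mul_comm B]
  simp only [Matrix.mul_assoc]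

lemma tensorNorm_nonneg (g T : Matrix (Fin n) (Fin n) ℝ) : 0 ≤ tensorNorm g T := Real.sqrt_nonneg _

lemma abs_trace_inv_mul_le {g : Matrix (Fin n) (Fin n) ℝ} (hg : g.PosDef)
    (T : Matrix (Fin n) (Fin n) ℝ) : |(g⁻¹ * T).trace| ≤ n * tensorNorm g T := by
  obtain ⟨B, hB, hT⟩ := exists_orthonormal_components hg T
  have h1 : (g⁻¹ * T).trace = (B * T * Bᵀ).trace := by
    rw [hB, Matrix.mul_assoc, Matrix.trace_mul_comm]
  have h2 (a : Fin n) : |(B * T * Bᵀ) a a| ≤ tensorNorm g T := by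
    rw [hT]
    generalize B * T * Bᵀ = S
    exact Real.abs_le_sqrt (Finset.single_le_sum (f := fun p : Fin n × Fin n => S p.1 p.2 ^ 2)
      (fun p _ => sq_nonneg _) (Finset.mem_univ (a, a)))
  rw [h1, Matrix.trace]
  refine (Finset.abs_sum_le_sum_abs _ _).trans ((Finset.sum_le_sum fun a _ => h2 a).trans ?_)
  simp

/-- `|T(ξ, ξ)| ≤ |T| |ξ|²` for the vector `ξ` dual to `v`. -/
lemma abs_quadratic_le {g : Matrix (Fin n) (Fin n) ℝ} (hg : g.PosDef)
    (T : Matrix (Fin n) (Fin n) ℝ) (v : Fin n → ℝ) :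
    |(g⁻¹ *ᵥ v) ⬝ᵥ (T *ᵥ (g⁻¹ *ᵥ v))| ≤ tensorNorm g T * (v ⬝ᵥ (g⁻¹ *ᵥ v)) := by
  obtain ⟨B, hB, hT⟩ := exists_orthonormal_components hg T
  set c := B *ᵥ v with hc
  have h1 : (g⁻¹ *ᵥ v) ⬝ᵥ (T *ᵥ (g⁻¹ *ᵥ v)) = c ⬝ᵥ ((B * T * Bᵀ) *ᵥ c) := by
    rw [hB, hc]
    simp only [← Matrix.mulVec_mulVec, Matrix.dotProduct_mulVec, Matrix.vecMul_transpose]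
    rw [Matrix.mulVec_transpose]
  have h2 : v ⬝ᵥ (g⁻¹ *ᵥ v) = c ⬝ᵥ c := by
    rw [hB, hc]
    simp only [← Matrix.mulVec_mulVec, Matrix.dotProduct_mulVec, Matrix.vecMul_transpose]
  rw [h1, h2, hT]
  have hcc : 0 ≤ c ⬝ᵥ c := by
    simp only [dotProduct]; exact Finset.sum_nonneg fun i _ => mul_self_nonneg _
  have h3 : c ⬝ᵥ ((B * T * Bᵀ) *ᵥ c)
      = ∑ p : Fin n × Fin n, (B * T * Bᵀ) p.1 p.2 * (c p.1 * c p.2) := by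
    rw [Fintype.sum_prod_type]
    simp only [dotProduct, Matrix.mulVec, Finset.mul_sum]
    exact Finset.sum_congr rfl fun i _ => Finset.sum_congr rfl fun j _ => by ring
  have h4 : ∑ p : Fin n × Fin n, (c p.1 * c p.2) ^ 2 = (c ⬝ᵥ c) ^ 2 := by
    rw [Fintype.sum_prod_type]
    simp only [dotProduct, sq, Finset.sum_mul, Finset.mul_sum]
    exact Finset.sum_congr rfl fun i _ => Finset.sum_congr rfl fun j _ => by ring
  rw [h3]
  have h5 := Finset.sum_mul_sq_le_sq_mul_sq Finset.univ
    (fun p : Fin n × Fin n => (B * T * Bᵀ) p.1 p.2) (fun p => c p.1 * c p.2)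
  rw [h4] at h5
  have h6 := Real.abs_le_sqrt h5
  rwa [Real.sqrt_mul (Finset.sum_nonneg fun p _ => sq_nonneg _), Real.sqrt_sq hcc] at h6

end Tensor

section Metric

variable {G : EuclideanSpace ℝ (Fin n) → Matrix (Fin n) (Fin n) ℝ}
  {y : EuclideanSpace ℝ (Fin n)} {f h : EuclideanSpace ℝ (Fin n) → ℝ}

lemma gradInner_eq_dotProduct (f h : EuclideanSpace ℝ (Fin n) → ℝ) :
    gradInner G f h y
      = (fun i => partialDeriv i f y) ⬝ᵥ ((G y)⁻¹ *ᵥ fun i => partialDeriv i h y) := by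
  rw [gradInner_eq_sum]; rfl

lemma IsMetricAt.gradInner_self_nonneg (hG : IsMetricAt G y) (f : EuclideanSpace ℝ (Fin n) → ℝ) :
    0 ≤ gradInner G f f y := by
  rw [gradInner_eq_dotProduct]
  simpa using hG.posDef_self.inv.posSemidef.dotProduct_mulVec_nonneg fun i => partialDeriv i f y

/-- The value `∇²f(∇f, ∇f)` of the Hessian. -/
noncomputable def hessianGrad (G : EuclideanSpace ℝ (Fin n) → Matrix (Fin n) (Fin n) ℝ)
    (f : EuclideanSpace ℝ (Fin n) → ℝ) (y : EuclideanSpace ℝ (Fin n)) : ℝ :=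
  ∑ i, ∑ j, hessian G f y i j * gradVec G f i y * gradVec G f j y

lemma IsMetricAt.differentiableAt_gradInner_self (hG : IsMetricAt G y) (hf : IsTwiceDiffAt f y) :
    DifferentiableAt ℝ (gradInner G f f) y := by
  unfold gradInner
  exact DifferentiableAt.fun_sum fun i _ => DifferentiableAt.fun_sum fun j _ =>
    ((hG.differentiableAt_inv i j).fun_mul (hf.differentiableAt_partialDeriv i)).fun_mul
      (hf.differentiableAt_partialDeriv j)

/-- `⟨∇|∇f|², ∇f⟩ = 2 ∇²f(∇f, ∇f)`. -/
lemma IsMetricAt.gradInner_gradInner_self (hG : IsMetricAt G y) (hf : IsTwiceDiffAt f y) :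
    gradInner G (gradInner G f f) f y = 2 * hessianGrad G f y := by
  set U : Fin n → ℝ := fun k => gradVec G f k y with hU
  have hds (k : Fin n) : partialDeriv k (gradInner G f f) y
      = 2 * ∑ i, U i * partialDeriv k (partialDeriv i f) y
        - ∑ i, ∑ l, U i * U l * partialDeriv k (fun z => G z i l) y := by
    have h0 : gradInner G f f = fun z => ∑ i, partialDeriv i f z * gradVec G f i z := by
      funext z; exact gradInner_eq_sum f f
    have h1 : ∑ i, U i * partialDeriv k (partialDeriv i f) y
        = ∑ l, partialDeriv l f y * partialDeriv k (gradVec G f l) y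
          + ∑ i, ∑ l, U i * U l * partialDeriv k (fun z => G z i l) y := by
      simp only [hG.partialDeriv_partialDeriv hf, mul_add, Finset.sum_add_distrib, Finset.mul_sum]
      congr 1
      · rw [Finset.sum_comm]
        refine Finset.sum_congr rfl fun l _ => ?_
        rw [← hG.sum_metric_mul_gradVec f l, Finset.sum_mul]
        exact Finset.sum_congr rfl fun i _ => by rw [hG.posDef_self.apply_comm l i]; ring
      · exact Finset.sum_congr rfl fun i _ => Finset.sum_congr rfl fun l _ => by ring
    have h2 : partialDeriv k (gradInner G f f) y
        = ∑ l, partialDeriv l f y * partialDeriv k (gradVec G f l) y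
          + ∑ i, U i * partialDeriv k (partialDeriv i f) y := by
      rw [h0, partialDeriv_sum k _ fun i _ =>
        (hf.differentiableAt_partialDeriv i).fun_mul (hG.differentiableAt_gradVec hf i),
        ← Finset.sum_add_distrib]
      exact Finset.sum_congr rfl fun i _ =>
        partialDeriv_mul k (hf.differentiableAt_partialDeriv i) (hG.differentiableAt_gradVec hf i)
    rw [h2]
    linarith
  have hΓ : ∑ i, ∑ j, (∑ m, christoffel G m i j y * partialDeriv m f y) * U i * U j
      = (1 / 2) * ∑ k, ∑ i, ∑ l, U i * U l * partialDeriv k (fun z => G z i l) y * U k := by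
    have h1 (i j : Fin n) : ∑ m, christoffel G m i j y * partialDeriv m f y
        = ∑ l, U l * ((1 / 2) * (partialDeriv i (fun z => G z j l) y
          + partialDeriv j (fun z => G z i l) y - partialDeriv l (fun z => G z i j) y)) := by
      simp only [← hG.sum_metric_mul_christoffel, Finset.mul_sum]
      rw [Finset.sum_comm]
      refine Finset.sum_congr rfl fun m _ => ?_
      rw [← hG.sum_metric_mul_gradVec f m, Finset.mul_sum]
      exact Finset.sum_congr rfl fun l _ => by rw [hG.posDef_self.apply_comm l m]; ring
    have e1 : ∑ i, ∑ j, ∑ l, U l * partialDeriv i (fun z => G z j l) y * U i * U j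
        = ∑ k, ∑ i, ∑ l, U i * U l * partialDeriv k (fun z => G z i l) y * U k :=
      Finset.sum_congr rfl fun i _ => Finset.sum_congr rfl fun j _ =>
        Finset.sum_congr rfl fun l _ => by ring
    have e2 : ∑ i, ∑ j, ∑ l, U l * partialDeriv j (fun z => G z i l) y * U i * U j
        = ∑ k, ∑ i, ∑ l, U i * U l * partialDeriv k (fun z => G z i l) y * U k := by
      rw [Finset.sum_comm]
      exact Finset.sum_congr rfl fun i _ => Finset.sum_congr rfl fun j _ =>
        Finset.sum_congr rfl fun l _ => by ring
    have e3 : ∑ i, ∑ j, ∑ l, U l * partialDeriv l (fun z => G z i j) y * U i * U j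
        = ∑ k, ∑ i, ∑ l, U i * U l * partialDeriv k (fun z => G z i l) y * U k := by
      rw [Finset.sum_comm_cycle]
      exact Finset.sum_congr rfl fun i _ => Finset.sum_congr rfl fun j _ =>
        Finset.sum_congr rfl fun l _ => by ring
    have e4 : ∑ i, ∑ j, (∑ m, christoffel G m i j y * partialDeriv m f y) * U i * U j
        = (1 / 2) * (∑ i, ∑ j, ∑ l, U l * partialDeriv i (fun z => G z j l) y * U i * U j
          + ∑ i, ∑ j, ∑ l, U l * partialDeriv j (fun z => G z i l) y * U i * U j
          - ∑ i, ∑ j, ∑ l, U l * partialDeriv l (fun z => G z i j) y * U i * U j) := by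
      simp only [h1, ← Finset.sum_add_distrib, ← Finset.sum_sub_distrib, Finset.mul_sum,
        Finset.sum_mul]
      exact Finset.sum_congr rfl fun i _ => Finset.sum_congr rfl fun j _ =>
        Finset.sum_congr rfl fun l _ => by ring
    rw [e4, e1, e2, e3]; ring
  have hH : hessianGrad G f y = ∑ i, ∑ j, partialDeriv i (partialDeriv j f) y * U i * U j
      - ∑ i, ∑ j, (∑ m, christoffel G m i j y * partialDeriv m f y) * U i * U j := by
    simp only [hessianGrad, hessian, Matrix.of_apply, sub_mul, Finset.sum_sub_distrib, hU]
  rw [gradInner_eq_sum, hH, hΓ]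
  simp only [hds, sub_mul, Finset.sum_sub_distrib, Finset.mul_sum, Finset.sum_mul, mul_sub]
  congr 1
  · exact Finset.sum_congr rfl fun i _ => Finset.sum_congr rfl fun j _ => by ring
  · exact Finset.sum_congr rfl fun i _ => Finset.sum_congr rfl fun j _ =>
      Finset.sum_congr rfl fun l _ => by ring

lemma IsMetricAt.trace_inv_mul_ricci_conformalMetric (hG : IsMetricAt G y)
    (hf : IsTwiceDiffAt f y) :
    ((G y)⁻¹ * ricci (conformalMetric G f) y).trace = ((G y)⁻¹ * ricci G y).trace
      + 2 * (n - 1) * laplacian G f y - (n - 2) * (n - 1) * gradInner G f f y := by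
  have hM : ricci (conformalMetric G f) y = ricci G y + ((n : ℝ) - 2) • hessian G f y
      + (laplacian G f y - (n - 2) * gradInner G f f y) • G y
      + ((n : ℝ) - 2) • Matrix.vecMulVec (fun i => partialDeriv i f y)
        (fun i => partialDeriv i f y) := by
    ext i j
    rw [hG.ricci_conformalMetric hf]
    simp only [Matrix.add_apply, Matrix.smul_apply, Matrix.vecMulVec_apply, smul_eq_mul]
    ring
  have hgg : ((G y)⁻¹ * Matrix.vecMulVec (fun i => partialDeriv i f y)
        (fun i => partialDeriv i f y)).trace = gradInner G f f y := by
    rw [Matrix.mul_vecMulVec, Matrix.trace_vecMulVec, gradInner_eq_dotProduct, dotProduct_comm]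
  rw [hM]
  simp only [Matrix.mul_add, Matrix.mul_smul, Matrix.trace_add, Matrix.trace_smul, smul_eq_mul, hgg,
    Matrix.nonsing_inv_mul _ hG.posDef_self.isUnit_det_of_posDef, Matrix.trace_one, Fintype.card_fin]
  rw [← laplacian]
  ring

lemma IsMetricAt.sigmaOne_schouten_conformalMetric (hn : 3 ≤ n) (hG : IsMetricAt G y)
    (hf : IsTwiceDiffAt f y) :
    sigmaOne (G y) (schouten (conformalMetric G f) y) = scalarCurvature G y / (2 * (n - 1))
      + laplacian G f y - (n - 2) / 2 * gradInner G f f y := by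
  have hn' : (3 : ℝ) ≤ n := by exact_mod_cast hn
  set T := ((G y)⁻¹ * ricci (conformalMetric G f) y).trace with hT
  have hexp : Real.exp (-2 * f y) ≠ 0 := (Real.exp_pos _).ne'
  have hinv : (conformalMetric G f y)⁻¹ = (Real.exp (-2 * f y))⁻¹ • (G y)⁻¹ := by
    apply Matrix.inv_eq_left_inv
    simp only [conformalMetric, Matrix.smul_mul, Matrix.mul_smul, smul_smul]
    rw [Matrix.nonsing_inv_mul _ hG.posDef_self.isUnit_det_of_posDef, mul_inv_cancel₀ hexp, one_smul]
  have hR : scalarCurvature (conformalMetric G f) y = (Real.exp (-2 * f y))⁻¹ * T := by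
    rw [scalarCurvature, hinv, Matrix.smul_mul, Matrix.trace_smul, smul_eq_mul]
  have h1 : sigmaOne (G y) (schouten (conformalMetric G f) y) = T / (2 * (n - 1)) := by
    rw [sigmaOne, schouten, hR]
    simp only [conformalMetric, Matrix.mul_smul, Matrix.mul_sub, Matrix.trace_smul,
      Matrix.trace_sub, smul_eq_mul, Matrix.nonsing_inv_mul _ hG.posDef_self.isUnit_det_of_posDef,
      Matrix.trace_one, Fintype.card_fin, ← hT]
    have : (n : ℝ) - 2 ≠ 0 := by linarith
    have : (n : ℝ) - 1 ≠ 0 := by linarith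
    field_simp
    ring
  rw [h1, hT, hG.trace_inv_mul_ricci_conformalMetric hf, scalarCurvature]
  have : (n : ℝ) - 1 ≠ 0 := by linarith
  field_simp

/-- The pinching condition evaluated on `∇f` and divided by `1 - 2δ`. In this direction the two
first-order terms `(n-2)(∇f ⊗ ∇f - |∇f|² g)` in the conformal change of `Ric` cancel, so that the
only contribution in `|∇f|⁴` is that of `σ_1`. The coefficient of the Hessian is `p - 2`, which is
what makes the right-hand side, up to the factor `|∇f|^{p-4}`, the divergence of
`|∇f|^{p-2} ∇f`. -/
lemma IsMetricAt.pinched_gradient (hn : 3 ≤ n) {δ : ℝ} (hδ₀ : 0 ≤ δ) (hδ : δ < 1 / 2)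
    (hG : IsMetricAt G y) (hf : IsTwiceDiffAt f y)
    (hpin : ∀ ξ : Fin n → ℝ, 0 ≤ ξ ⬝ᵥ (ricci (conformalMetric G f) y
      - (2 * δ * sigmaOne (G y) (schouten (conformalMetric G f) y)) • G y).mulVec ξ) :
    0 ≤ (gradExponent n δ - 2) * hessianGrad G f y + laplacian G f y * gradInner G f f y
      + alphaDelta n δ * gradInner G f f y ^ 2
      + (1 + n) / (1 - 2 * δ) * tensorNorm (G y) (ricci G y) * gradInner G f f y := by
  have hn' : (3 : ℝ) ≤ n := by exact_mod_cast hn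
  have hδ' : 0 < 1 - 2 * δ := by linarith
  set s := gradInner G f f y with hs
  have hs0 : 0 ≤ s := hG.gradInner_self_nonneg f
  set v : Fin n → ℝ := fun i => partialDeriv i f y with hv
  set ξ : Fin n → ℝ := (G y)⁻¹ *ᵥ v with hξ
  have hξk (k : Fin n) : ξ k = gradVec G f k y := rfl
  have hvs : v ⬝ᵥ ξ = s := (gradInner_eq_dotProduct f f).symm
  have hGξ : G y *ᵥ ξ = v := by
    rw [hξ, Matrix.mulVec_mulVec, Matrix.mul_nonsing_inv _ hG.posDef_self.isUnit_det_of_posDef,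
      Matrix.one_mulVec]
  have hM : ricci (conformalMetric G f) y = ricci G y + ((n : ℝ) - 2) • hessian G f y
      + (laplacian G f y - (n - 2) * s) • G y + ((n : ℝ) - 2) • Matrix.vecMulVec v v := by
    ext i j
    rw [hG.ricci_conformalMetric hf]
    simp only [Matrix.add_apply, Matrix.smul_apply, Matrix.vecMulVec_apply, smul_eq_mul, hv, hs]
    ring
  have hH : ξ ⬝ᵥ (hessian G f y *ᵥ ξ) = hessianGrad G f y := by
    simp only [dotProduct, Matrix.mulVec, hessianGrad, hξk, Finset.mul_sum]
    exact Finset.sum_congr rfl fun i _ => Finset.sum_congr rfl fun j _ => by ring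
  have hvv : ξ ⬝ᵥ (Matrix.vecMulVec v v *ᵥ ξ) = s ^ 2 := by
    rw [Matrix.vecMulVec_mulVec, dotProduct_smul, hvs, dotProduct_comm, hvs]
    simp [sq]
  have h0 := hpin ξ
  rw [hM, hG.sigmaOne_schouten_conformalMetric hn hf] at h0
  simp only [Matrix.sub_mulVec, Matrix.add_mulVec, Matrix.smul_mulVec, dotProduct_sub,
    dotProduct_add, dotProduct_smul, smul_eq_mul, hH, hvv, hGξ] at h0
  rw [dotProduct_comm ξ v, hvs] at h0
  have hric := (abs_le.1 (abs_quadratic_le hG.posDef_self (ricci G y) v)).2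
  rw [← hξ, hvs] at hric
  have hscal : -scalarCurvature G y ≤ n * tensorNorm (G y) (ricci G y) :=
    (neg_le_abs _).trans (abs_trace_inv_mul_le hG.posDef_self (ricci G y))
  set N := tensorNorm (G y) (ricci G y) with hN
  have hN0 : 0 ≤ N := tensorNorm_nonneg _ _
  have hp : gradExponent n δ - 2 = (n - 2) / (1 - 2 * δ) := by
    rw [gradExponent, alphaDelta]; field_simp; ring
  rw [hp, alphaDelta]
  rw [← hs] at h0
  -- the scalar curvature term, with `δ / (n - 1) ≤ 1`
  have hterm : -(δ / (n - 1) * scalarCurvature G y * s) ≤ n * N * s := by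
    have h1 : 0 ≤ δ / ((n : ℝ) - 1) := div_nonneg hδ₀ (by linarith)
    have h2 : δ / ((n : ℝ) - 1) ≤ 1 := by rw [div_le_one (by linarith)]; linarith
    have h3 : δ / ((n : ℝ) - 1) * -scalarCurvature G y ≤ δ / ((n : ℝ) - 1) * (n * N) :=
      mul_le_mul_of_nonneg_left hscal h1
    have h4 : δ / ((n : ℝ) - 1) * (n * N) ≤ 1 * (n * N) :=
      mul_le_mul_of_nonneg_right h2 (by positivity)
    have h5 := mul_le_mul_of_nonneg_right (h3.trans h4) hs0
    linarith
  have key : 0 ≤ (n - 2) * hessianGrad G f y + (1 - 2 * δ) * (laplacian G f y * s)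
      + (n - 2) * δ * s ^ 2 + (1 + n) * N * s := by
    have e : 2 * δ * (scalarCurvature G y / (2 * (n - 1))) = δ / (n - 1) * scalarCurvature G y := by
      have : (n : ℝ) - 1 ≠ 0 := by linarith
      field_simp
    have e2 : 2 * δ * (scalarCurvature G y / (2 * (n - 1)) + laplacian G f y - (n - 2) / 2 * s) * s
        = δ / (n - 1) * scalarCurvature G y * s + 2 * δ * laplacian G f y * s
          - δ * (n - 2) * s ^ 2 := by
      rw [← e]; ring
    rw [e2] at h0
    nlinarith [h0, hric, hterm]
  have hfin := div_nonneg key hδ'.le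
  have e3 : (n - 2) / (1 - 2 * δ) * hessianGrad G f y + laplacian G f y * s
      + (n - 2) / (1 - 2 * δ) * δ * s ^ 2 + (1 + n) / (1 - 2 * δ) * N * s
      = ((n - 2) * hessianGrad G f y + (1 - 2 * δ) * (laplacian G f y * s)
      + (n - 2) * δ * s ^ 2 + (1 + n) * N * s) / (1 - 2 * δ) := by
    field_simp
  rwa [e3]

end Metric

/-! ### Invariance under changes of coordinates -/

section Invariant

/-- Shortcuts, since unfolding the norm on iterated spaces of continuous linear maps is slow. -/
noncomputable instance instNormedAddCommGroupBilin {E : Type*} [NormedAddCommGroup E]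
    [NormedSpace ℝ E] : NormedAddCommGroup (E →L[ℝ] E →L[ℝ] ℝ) :=
  ContinuousLinearMap.toNormedAddCommGroup

noncomputable instance instNormedSpaceBilin {E : Type*} [NormedAddCommGroup E]
    [NormedSpace ℝ E] : NormedSpace ℝ (E →L[ℝ] E →L[ℝ] ℝ) :=
  ContinuousLinearMap.toNormedSpace

/-- The Hessian of `f` with respect to a field `M` of bilinear forms is a tensor. It is written here
as `D²f(v, w) - K(v, w; ξ)`, where `M(ξ, ·) = Df` and
`K(v, w; ξ) = (D_v M(w, ξ) + D_w M(v, ξ) - D_ξ M(v, w)) / 2` is the Christoffel symbol of the first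
kind; all terms with second derivatives of the change of coordinates `τ` cancel. -/
lemma hessianForm_comp {E : Type*} [NormedAddCommGroup E] [NormedSpace ℝ E]
    {M M' : E → E →L[ℝ] E →L[ℝ] ℝ} {τ : E → E} {f f' : E → ℝ} {y : E}
    (hτ : ContDiffAt ℝ 2 τ y) (hM : DifferentiableAt ℝ M y) (hM' : DifferentiableAt ℝ M' (τ y))
    (hsymm : ∀ v w, M' (τ y) v w = M' (τ y) w v)
    (hMM' : ∀ᶠ z in 𝓝 y, ∀ v w, M z v w = M' (τ z) (fderiv ℝ τ z v) (fderiv ℝ τ z w))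
    (hf'1 : ∀ᶠ z in 𝓝 (τ y), DifferentiableAt ℝ f' z)
    (hf'2 : DifferentiableAt ℝ (fderiv ℝ f') (τ y)) (hff' : f =ᶠ[𝓝 y] f' ∘ τ)
    (hf2 : DifferentiableAt ℝ (fderiv ℝ f) y)
    {ξ : E} (hξ : ∀ v, M' (τ y) (fderiv ℝ τ y ξ) v = fderiv ℝ f' (τ y) v) (v w : E) :
    fderiv ℝ (fderiv ℝ f) y v w - (1 / 2) * (fderiv ℝ M y v w ξ + fderiv ℝ M y w v ξ
        - fderiv ℝ M y ξ v w)
      = fderiv ℝ (fderiv ℝ f') (τ y) (fderiv ℝ τ y v) (fderiv ℝ τ y w)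
        - (1 / 2) * (fderiv ℝ M' (τ y) (fderiv ℝ τ y v) (fderiv ℝ τ y w) (fderiv ℝ τ y ξ)
          + fderiv ℝ M' (τ y) (fderiv ℝ τ y w) (fderiv ℝ τ y v) (fderiv ℝ τ y ξ)
          - fderiv ℝ M' (τ y) (fderiv ℝ τ y ξ) (fderiv ℝ τ y v) (fderiv ℝ τ y w)) := by
  have hτd : DifferentiableAt ℝ τ y := hτ.differentiableAt (by norm_num)
  have hτe : ∀ᶠ z in 𝓝 y, DifferentiableAt ℝ τ z :=
    (hτ.eventually (by simp)).mono fun z hz => hz.differentiableAt (by norm_num)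
  have hτ2 : DifferentiableAt ℝ (fderiv ℝ τ) y :=
    (hτ.fderiv_right (m := 1) (by norm_num)).differentiableAt (by norm_num)
  have hτsymm (v w : E) : fderiv ℝ (fderiv ℝ τ) y v w = fderiv ℝ (fderiv ℝ τ) y w v :=
    second_derivative_symmetric_of_eventually (hτe.mono fun _ hz => hz.hasFDerivAt)
      hτ2.hasFDerivAt v w
  have hDτ (v : E) : HasFDerivAt (fun z => fderiv ℝ τ z v)
      ((fderiv ℝ (fderiv ℝ τ) y).flip v) y := by
    simpa using hτ2.hasFDerivAt.clm_apply (hasFDerivAt_const v y)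
  have hDM (k v w : E) : fderiv ℝ M y k v w
      = fderiv ℝ M' (τ y) (fderiv ℝ τ y k) (fderiv ℝ τ y v) (fderiv ℝ τ y w)
        + M' (τ y) (fderiv ℝ (fderiv ℝ τ) y k v) (fderiv ℝ τ y w)
        + M' (τ y) (fderiv ℝ τ y v) (fderiv ℝ (fderiv ℝ τ) y k w) := by
    have h1 : HasFDerivAt (fun z => M z v w) (((fderiv ℝ M y).flip v).flip w) y := by
      simpa using (hM.hasFDerivAt.clm_apply (hasFDerivAt_const v y)).clm_apply
        (hasFDerivAt_const w y)
    have h2 := ((hM'.hasFDerivAt.comp y hτd.hasFDerivAt).clm_apply (hDτ v)).clm_apply (hDτ w)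
    have h3 := (h2.congr_of_eventuallyEq (hMM'.mono fun z hz => hz v w)).unique h1
    have h4 := congrArg (fun L => L k) h3
    simp at h4
    rw [← h4]
    ring
  have hD2 : fderiv ℝ (fderiv ℝ f) y v w
      = fderiv ℝ (fderiv ℝ f') (τ y) (fderiv ℝ τ y v) (fderiv ℝ τ y w)
        + fderiv ℝ f' (τ y) (fderiv ℝ (fderiv ℝ τ) y v w) := by
    have h1 : HasFDerivAt (fun z => fderiv ℝ f z w) ((fderiv ℝ (fderiv ℝ f) y).flip w) y := by
      simpa using hf2.hasFDerivAt.clm_apply (hasFDerivAt_const w y)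
    have h2 := (hf'2.hasFDerivAt.comp y hτd.hasFDerivAt).clm_apply (hDτ w)
    have h3 : (fun z => fderiv ℝ f z w) =ᶠ[𝓝 y]
        fun z => (fderiv ℝ f' ∘ τ) z (fderiv ℝ τ z w) := by
      filter_upwards [hff'.eventuallyEq_nhds, hτe, hτd.continuousAt.eventually hf'1]
        with z hz1 hz2 hz3
      rw [hz1.fderiv_eq, fderiv_comp z hz3 hz2]
      rfl
    have h4 := congrArg (fun L => L v) ((h2.congr_of_eventuallyEq h3).unique h1)
    simp at h4
    rw [← h4]
    ring
  rw [hD2]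
  simp only [hDM]
  rw [← hξ, hτsymm w v, hτsymm ξ v, hτsymm ξ w, hsymm (fderiv ℝ (fderiv ℝ τ) y v w),
    hsymm (fderiv ℝ (fderiv ℝ τ) y v ξ), hsymm (fderiv ℝ τ y w)
      (fderiv ℝ (fderiv ℝ τ) y v ξ)]
  ring

/-- The bilinear form with matrix `A`. -/
noncomputable def bilinOfMatrix (A : Matrix (Fin n) (Fin n) ℝ) :
    EuclideanSpace ℝ (Fin n) →L[ℝ] EuclideanSpace ℝ (Fin n) →L[ℝ] ℝ :=
  ∑ i, ∑ j, A i j • (EuclideanSpace.proj i : EuclideanSpace ℝ (Fin n) →L[ℝ] ℝ).smulRight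
    (EuclideanSpace.proj j : EuclideanSpace ℝ (Fin n) →L[ℝ] ℝ)

lemma bilinOfMatrix_apply (A : Matrix (Fin n) (Fin n) ℝ) (v w : EuclideanSpace ℝ (Fin n)) :
    bilinOfMatrix A v w = ∑ i, ∑ j, A i j * (v i * w j) := by
  simp [bilinOfMatrix]

lemma bilinOfMatrix_eq_dotProduct (A : Matrix (Fin n) (Fin n) ℝ) (v w : EuclideanSpace ℝ (Fin n)) :
    bilinOfMatrix A v w = v.ofLp ⬝ᵥ (A *ᵥ w.ofLp) := by
  rw [bilinOfMatrix_apply]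
  simp only [dotProduct, Matrix.mulVec, Finset.mul_sum]
  exact Finset.sum_congr rfl fun i _ => Finset.sum_congr rfl fun j _ => by ring

lemma bilinear_eq_sum {φ : EuclideanSpace ℝ (Fin n) → EuclideanSpace ℝ (Fin n) → ℝ}
    (h1 : ∀ w, IsLinearMap ℝ fun v => φ v w) (h2 : ∀ v, IsLinearMap ℝ (φ v))
    (v w : EuclideanSpace ℝ (Fin n)) :
    φ v w = ∑ a, ∑ b, v a * w b * φ (EuclideanSpace.single a 1) (EuclideanSpace.single b 1) := by
  have hv (v : EuclideanSpace ℝ (Fin n)) : v = ∑ i, v i • EuclideanSpace.single i (1 : ℝ) := by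
    ext j
    simp [Finset.sum_apply, Pi.single_apply]
  have e1 (w : EuclideanSpace ℝ (Fin n)) :
      φ v w = ∑ a, v a * φ (EuclideanSpace.single a 1) w := by
    have := map_sum (IsLinearMap.mk' _ (h1 w)) (fun i => v i • EuclideanSpace.single i (1 : ℝ))
      Finset.univ
    rw [← hv v] at this
    simpa using this
  have e2 (v : EuclideanSpace ℝ (Fin n)) :
      φ v w = ∑ b, w b * φ v (EuclideanSpace.single b 1) := by
    have := map_sum (IsLinearMap.mk' _ (h2 v)) (fun i => w i • EuclideanSpace.single i (1 : ℝ))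
      Finset.univ
    rw [← hv w] at this
    simpa using this
  rw [e1]
  refine Finset.sum_congr rfl fun a _ => ?_
  rw [e2, Finset.mul_sum]
  exact Finset.sum_congr rfl fun b _ => by ring

variable {G : EuclideanSpace ℝ (Fin n) → Matrix (Fin n) (Fin n) ℝ}
  {y : EuclideanSpace ℝ (Fin n)} {f h : EuclideanSpace ℝ (Fin n) → ℝ}

lemma IsMetricAt.hasFDerivAt_bilinOfMatrix (hG : IsMetricAt G y) :
    HasFDerivAt (fun z => bilinOfMatrix (G z)) (∑ i, ∑ j, (fderiv ℝ (fun z => G z i j) y).smulRight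
      ((EuclideanSpace.proj i : EuclideanSpace ℝ (Fin n) →L[ℝ] ℝ).smulRight
    (EuclideanSpace.proj j : EuclideanSpace ℝ (Fin n) →L[ℝ] ℝ))) y := by
  unfold bilinOfMatrix
  refine HasFDerivAt.fun_sum fun i _ => HasFDerivAt.fun_sum fun j _ => ?_
  have := (hG.differentiableAt i j).hasFDerivAt.smul_const
    ((EuclideanSpace.proj i : EuclideanSpace ℝ (Fin n) →L[ℝ] ℝ).smulRight
    (EuclideanSpace.proj j : EuclideanSpace ℝ (Fin n) →L[ℝ] ℝ))
  exact this

lemma IsMetricAt.fderiv_bilinOfMatrix (hG : IsMetricAt G y) (k v w : EuclideanSpace ℝ (Fin n)) :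
    fderiv ℝ (fun z => bilinOfMatrix (G z)) y k v w
      = ∑ i, ∑ j, fderiv ℝ (fun z => G z i j) y k * (v i * w j) := by
  rw [hG.hasFDerivAt_bilinOfMatrix.fderiv]
  simp

/-- The gradient of `f`, with components `gradVec G f k`, as a vector of the model space. -/
noncomputable def gradField (G : EuclideanSpace ℝ (Fin n) → Matrix (Fin n) (Fin n) ℝ)
    (f : EuclideanSpace ℝ (Fin n) → ℝ) (y : EuclideanSpace ℝ (Fin n)) :
    EuclideanSpace ℝ (Fin n) := WithLp.toLp 2 fun k => gradVec G f k y

lemma IsMetricAt.bilinOfMatrix_gradient (hG : IsMetricAt G y) (v : EuclideanSpace ℝ (Fin n)) :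
    bilinOfMatrix (G y) (gradField G f y) v = fderiv ℝ f y v := by
  rw [bilinOfMatrix_apply, fderiv_apply_eq_sum, Finset.sum_comm]
  refine Finset.sum_congr rfl fun j _ => ?_
  rw [← hG.sum_metric_mul_gradVec f j, Finset.mul_sum]
  exact Finset.sum_congr rfl fun i _ => by
    rw [hG.posDef_self.apply_comm j i]; simp only [gradField]; ring

/-- The Hessian without Christoffel symbols of the second kind, in the form used by
`hessianForm_comp`. -/
lemma IsMetricAt.hessian_eq (hG : IsMetricAt G y) (hf : IsTwiceDiffAt f y) (i j : Fin n) :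
    hessian G f y i j = fderiv ℝ (fderiv ℝ f) y (EuclideanSpace.single i 1)
        (EuclideanSpace.single j 1)
      - (1 / 2) * (fderiv ℝ (fun z => bilinOfMatrix (G z)) y (EuclideanSpace.single i 1)
          (EuclideanSpace.single j 1) (gradField G f y)
        + fderiv ℝ (fun z => bilinOfMatrix (G z)) y (EuclideanSpace.single j 1)
          (EuclideanSpace.single i 1) (gradField G f y)
        - fderiv ℝ (fun z => bilinOfMatrix (G z)) y (gradField G f y)
          (EuclideanSpace.single i 1) (EuclideanSpace.single j 1)) := by
  have h1 : ∑ m, christoffel G m i j y * partialDeriv m f y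
      = (1 / 2) * (∑ l, gradVec G f l y * partialDeriv i (fun z => G z j l) y
        + ∑ l, gradVec G f l y * partialDeriv j (fun z => G z i l) y
        - ∑ l, gradVec G f l y * partialDeriv l (fun z => G z i j) y) := by
    have h2 (m : Fin n) : christoffel G m i j y * partialDeriv m f y
        = ∑ l, gradVec G f l y * (G y l m * christoffel G m i j y) := by
      rw [← hG.sum_metric_mul_gradVec f m, Finset.mul_sum]
      exact Finset.sum_congr rfl fun l _ => by rw [hG.posDef_self.apply_comm l m]; ring
    simp only [h2]
    rw [Finset.sum_comm]
    simp only [← Finset.mul_sum, hG.sum_metric_mul_christoffel]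
    rw [← Finset.sum_add_distrib, ← Finset.sum_sub_distrib, Finset.mul_sum]
    exact Finset.sum_congr rfl fun l _ => by ring
  rw [hessian, Matrix.of_apply, hf.partialDeriv_partialDeriv, h1]
  simp only [hG.fderiv_bilinOfMatrix]
  have h3 (k j : Fin n) : ∑ a, ∑ b, fderiv ℝ (fun z => G z a b) y (EuclideanSpace.single k 1) *
      ((EuclideanSpace.single j (1 : ℝ) : EuclideanSpace ℝ (Fin n)) a * (gradField G f y) b)
      = ∑ l, gradVec G f l y * partialDeriv k (fun z => G z j l) y := by
    rw [Finset.sum_eq_single j]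
    · simp [gradField, partialDeriv, mul_comm]
    · intro b _ hb
      simp [hb]
    · simp
  have h4 : ∑ a, ∑ b, fderiv ℝ (fun z => G z a b) y (gradField G f y) *
      ((EuclideanSpace.single i (1 : ℝ) : EuclideanSpace ℝ (Fin n)) a *
        (EuclideanSpace.single j (1 : ℝ) : EuclideanSpace ℝ (Fin n)) b)
      = ∑ l, gradVec G f l y * partialDeriv l (fun z => G z i j) y := by
    rw [Finset.sum_eq_single i, Finset.sum_eq_single j]
    · rw [fderiv_apply_eq_sum]
      simp [gradField]
    · intro b _ hb
      simp [hb]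
    · simp
    · intro b _ hb
      simp [hb]
    · simp
  rw [h3, h3, h4]

/-- The Jacobian matrix `∂_i τ^a`. -/
noncomputable def jacobian (τ : EuclideanSpace ℝ (Fin n) → EuclideanSpace ℝ (Fin n))
    (y : EuclideanSpace ℝ (Fin n)) : Matrix (Fin n) (Fin n) ℝ :=
  Matrix.of fun a i => fderiv ℝ τ y (EuclideanSpace.single i 1) a

lemma fderiv_apply_eq_jacobian_mulVec (τ : EuclideanSpace ℝ (Fin n) → EuclideanSpace ℝ (Fin n))
    (y v : EuclideanSpace ℝ (Fin n)) (a : Fin n) :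
    fderiv ℝ τ y v a = ∑ i, jacobian τ y a i * v i := by
  have hv : v = ∑ i, v i • EuclideanSpace.single i (1 : ℝ) := by
    ext j
    simp [Finset.sum_apply, Pi.single_apply]
  conv_lhs => rw [hv]
  simp [jacobian, mul_comm]

/-- `τ` is a change of coordinates near `y`, between coordinates in which the metric is `G` and
coordinates in which it is `G'`. Invertibility of the Jacobian is not required: it follows from the
nondegeneracy of `G`. -/
structure IsIsometryAt (τ : EuclideanSpace ℝ (Fin n) → EuclideanSpace ℝ (Fin n))
    (G G' : EuclideanSpace ℝ (Fin n) → Matrix (Fin n) (Fin n) ℝ)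
    (y : EuclideanSpace ℝ (Fin n)) : Prop where
  contDiffAt : ContDiffAt ℝ 2 τ y
  source : IsMetricAt G y
  target : IsMetricAt G' (τ y)
  eventually_eq : ∀ᶠ z in 𝓝 y, G z = (jacobian τ z)ᵀ * G' (τ z) * jacobian τ z

variable {τ : EuclideanSpace ℝ (Fin n) → EuclideanSpace ℝ (Fin n)}
  {G' : EuclideanSpace ℝ (Fin n) → Matrix (Fin n) (Fin n) ℝ}
  {f' h' : EuclideanSpace ℝ (Fin n) → ℝ}

lemma IsIsometryAt.differentiableAt (hτ : IsIsometryAt τ G G' y) : DifferentiableAt ℝ τ y :=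
  hτ.contDiffAt.differentiableAt (by norm_num)

lemma IsIsometryAt.metric_eq (hτ : IsIsometryAt τ G G' y) :
    G y = (jacobian τ y)ᵀ * G' (τ y) * jacobian τ y := hτ.eventually_eq.self_of_nhds

lemma IsIsometryAt.isUnit_det (hτ : IsIsometryAt τ G G' y) : IsUnit (jacobian τ y).det := by
  have h := congrArg Matrix.det hτ.metric_eq
  rw [Matrix.det_mul] at h
  have h0 := hτ.source.posDef_self.det_pos.ne'
  rw [h] at h0
  exact (right_ne_zero_of_mul h0).isUnit

lemma IsIsometryAt.inv_metric_eq (hτ : IsIsometryAt τ G G' y) :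
    (G' (τ y))⁻¹ = jacobian τ y * (G y)⁻¹ * (jacobian τ y)ᵀ := by
  have hJ := hτ.isUnit_det
  have hJt : IsUnit ((jacobian τ y)ᵀ).det := by rwa [Matrix.det_transpose]
  rw [hτ.metric_eq, Matrix.mul_inv_rev, Matrix.mul_inv_rev]
  simp only [← Matrix.mul_assoc]
  rw [Matrix.mul_nonsing_inv _ hJ, Matrix.one_mul, Matrix.mul_assoc, Matrix.nonsing_inv_mul _ hJt,
    Matrix.mul_one]

lemma IsIsometryAt.partialDeriv_eq (hτ : IsIsometryAt τ G G' y)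
    (hf' : DifferentiableAt ℝ f' (τ y)) (hff' : f =ᶠ[𝓝 y] f' ∘ τ) (i : Fin n) :
    partialDeriv i f y = ∑ a, jacobian τ y a i * partialDeriv a f' (τ y) := by
  rw [partialDeriv, hff'.fderiv_eq, fderiv_comp y hf' hτ.differentiableAt,
    ContinuousLinearMap.comp_apply, fderiv_apply_eq_sum]
  rfl

lemma IsIsometryAt.gradVec_eq (hτ : IsIsometryAt τ G G' y)
    (hf' : DifferentiableAt ℝ f' (τ y)) (hff' : f =ᶠ[𝓝 y] f' ∘ τ) (a : Fin n) :
    gradVec G' f' a (τ y) = ∑ i, jacobian τ y a i * gradVec G f i y := by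
  have h1 : (fun i => partialDeriv i f y)
      = (jacobian τ y)ᵀ *ᵥ fun a => partialDeriv a f' (τ y) := by
    funext i
    rw [hτ.partialDeriv_eq hf' hff']
    rfl
  have h2 : (fun a => gradVec G' f' a (τ y)) = jacobian τ y *ᵥ fun i => gradVec G f i y := by
    change (G' (τ y))⁻¹ *ᵥ (fun a => partialDeriv a f' (τ y))
      = jacobian τ y *ᵥ ((G y)⁻¹ *ᵥ fun i => partialDeriv i f y)
    rw [h1, hτ.inv_metric_eq, Matrix.mulVec_mulVec, Matrix.mulVec_mulVec, Matrix.mul_assoc]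
  exact congrFun h2 a

lemma IsIsometryAt.fderiv_gradient (hτ : IsIsometryAt τ G G' y)
    (hf' : DifferentiableAt ℝ f' (τ y)) (hff' : f =ᶠ[𝓝 y] f' ∘ τ) :
    fderiv ℝ τ y (gradField G f y) = gradField G' f' (τ y) := by
  ext a
  rw [fderiv_apply_eq_jacobian_mulVec]
  exact (hτ.gradVec_eq hf' hff' a).symm

lemma IsIsometryAt.gradInner_eq (hτ : IsIsometryAt τ G G' y)
    (hf' : DifferentiableAt ℝ f' (τ y)) (hff' : f =ᶠ[𝓝 y] f' ∘ τ)
    (hh' : DifferentiableAt ℝ h' (τ y)) (hhh' : h =ᶠ[𝓝 y] h' ∘ τ) :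
    gradInner G f h y = gradInner G' f' h' (τ y) := by
  rw [gradInner_eq_sum, gradInner_eq_sum]
  simp only [hτ.gradVec_eq hh' hhh', hτ.partialDeriv_eq hf' hff', Finset.mul_sum, Finset.sum_mul]
  rw [Finset.sum_comm]
  exact Finset.sum_congr rfl fun i _ => Finset.sum_congr rfl fun j _ => by ring

lemma IsIsometryAt.isTwiceDiffAt (hτ : IsIsometryAt τ G G' y) (hf' : IsTwiceDiffAt f' (τ y))
    (hff' : f =ᶠ[𝓝 y] f' ∘ τ) : IsTwiceDiffAt f y := by
  have hτe : ∀ᶠ z in 𝓝 y, DifferentiableAt ℝ τ z :=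
    (hτ.contDiffAt.eventually (by simp)).mono fun z hz => hz.differentiableAt (by norm_num)
  have hτ2 : DifferentiableAt ℝ (fderiv ℝ τ) y :=
    (hτ.contDiffAt.fderiv_right (m := 1) (by norm_num)).differentiableAt (by norm_num)
  have hev := hτ.differentiableAt.continuousAt.eventually hf'.eventually_differentiableAt
  constructor
  · filter_upwards [hff'.eventuallyEq_nhds, hτe, hev] with z h1 h2 h3
    exact (h3.comp z h2).congr_of_eventuallyEq h1
  · have h3 : fderiv ℝ f =ᶠ[𝓝 y] fun z => (fderiv ℝ f' (τ z)).comp (fderiv ℝ τ z) := by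
      filter_upwards [hff'.eventuallyEq_nhds, hτe, hev] with z hz1 hz2 hz3
      rw [hz1.fderiv_eq, fderiv_comp z hz3 hz2]
    refine DifferentiableAt.congr_of_eventuallyEq ?_ h3
    exact (hf'.differentiableAt_fderiv.comp y hτ.differentiableAt).clm_comp hτ2

lemma IsIsometryAt.hessian_eq (hτ : IsIsometryAt τ G G' y) (hf' : IsTwiceDiffAt f' (τ y))
    (hff' : f =ᶠ[𝓝 y] f' ∘ τ) :
    hessian G f y = (jacobian τ y)ᵀ * hessian G' f' (τ y) * jacobian τ y := by
  have hf := hτ.isTwiceDiffAt hf' hff'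
  have hMM' : ∀ᶠ z in 𝓝 y, ∀ v w, bilinOfMatrix (G z) v w
      = bilinOfMatrix (G' (τ z)) (fderiv ℝ τ z v) (fderiv ℝ τ z w) := by
    filter_upwards [hτ.eventually_eq] with z hz v w
    have hJ (v : EuclideanSpace ℝ (Fin n)) : (fderiv ℝ τ z v).ofLp = jacobian τ z *ᵥ v.ofLp :=
      funext fun a => fderiv_apply_eq_jacobian_mulVec τ z v a
    rw [hz, bilinOfMatrix_eq_dotProduct, bilinOfMatrix_eq_dotProduct, hJ, hJ,
      ← Matrix.mulVec_mulVec, ← Matrix.mulVec_mulVec, Matrix.dotProduct_mulVec _ (jacobian τ z)ᵀ,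
      Matrix.vecMul_transpose]
  have hM := hτ.source.hasFDerivAt_bilinOfMatrix.differentiableAt
  have hM' := hτ.target.hasFDerivAt_bilinOfMatrix.differentiableAt
  have hsymm (v w) : bilinOfMatrix (G' (τ y)) v w = bilinOfMatrix (G' (τ y)) w v := by
    rw [bilinOfMatrix_apply, bilinOfMatrix_apply, Finset.sum_comm]
    exact Finset.sum_congr rfl fun i _ => Finset.sum_congr rfl fun j _ => by
      rw [hτ.target.posDef_self.apply_comm j i]; ring
  ext i j
  rw [hτ.source.hessian_eq hf]
  rw [hessianForm_comp (M' := fun z => bilinOfMatrix (G' z)) hτ.contDiffAt hM hM' hsymm hMM'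
    hf'.eventually_differentiableAt hf'.differentiableAt_fderiv hff' hf.differentiableAt_fderiv
    (by
      intro v
      rw [hτ.fderiv_gradient hf'.differentiableAt hff', hτ.target.bilinOfMatrix_gradient])]
  rw [hτ.fderiv_gradient hf'.differentiableAt hff']
  have hlin := bilinear_eq_sum (φ := fun v w => fderiv ℝ (fderiv ℝ f') (τ y) v w
    - (1 / 2) * (fderiv ℝ (fun z => bilinOfMatrix (G' z)) (τ y) v w (gradField G' f' (τ y))
      + fderiv ℝ (fun z => bilinOfMatrix (G' z)) (τ y) w v (gradField G' f' (τ y))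
      - fderiv ℝ (fun z => bilinOfMatrix (G' z)) (τ y) (gradField G' f' (τ y)) v w))
    (fun w => ⟨fun v v' => by simp only [map_add, _root_.add_apply]; ring,
      fun c v => by
        simp only [map_smul, _root_.smul_apply, smul_eq_mul]; ring⟩)
    (fun v => ⟨fun w w' => by simp only [map_add, _root_.add_apply]; ring,
      fun c w => by
        simp only [map_smul, _root_.smul_apply, smul_eq_mul]; ring⟩)
  simp only [← hτ.target.hessian_eq hf'] at hlin
  rw [hlin]
  simp only [Matrix.mul_apply, Matrix.transpose_apply, Finset.sum_mul]
  rw [Finset.sum_comm]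
  exact Finset.sum_congr rfl fun b _ => Finset.sum_congr rfl fun a _ => by
    simp only [jacobian, Matrix.of_apply]; ring

lemma IsIsometryAt.laplacian_eq (hτ : IsIsometryAt τ G G' y) (hf' : IsTwiceDiffAt f' (τ y))
    (hff' : f =ᶠ[𝓝 y] f' ∘ τ) : laplacian G f y = laplacian G' f' (τ y) := by
  rw [laplacian, laplacian, hτ.hessian_eq hf' hff', hτ.inv_metric_eq]
  rw [Matrix.mul_assoc, Matrix.trace_mul_comm (jacobian τ y * (G y)⁻¹ * (jacobian τ y)ᵀ)]
  rw [Matrix.trace_mul_comm (G y)⁻¹]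
  simp only [Matrix.mul_assoc]
  rw [Matrix.trace_mul_comm (jacobian τ y)ᵀ]
  simp only [Matrix.mul_assoc]

lemma IsIsometryAt.hessianGrad_eq (hτ : IsIsometryAt τ G G' y) (hf' : IsTwiceDiffAt f' (τ y))
    (hff' : f =ᶠ[𝓝 y] f' ∘ τ) : hessianGrad G f y = hessianGrad G' f' (τ y) := by
  have h0 (G : EuclideanSpace ℝ (Fin n) → Matrix (Fin n) (Fin n) ℝ) (f y) :
      hessianGrad G f y
        = (fun k => gradVec G f k y) ⬝ᵥ (hessian G f y *ᵥ fun k => gradVec G f k y) := by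
    simp only [dotProduct, Matrix.mulVec, hessianGrad, Finset.mul_sum]
    exact Finset.sum_congr rfl fun i _ => Finset.sum_congr rfl fun j _ => by ring
  have h1 : (fun a => gradVec G' f' a (τ y)) = jacobian τ y *ᵥ fun i => gradVec G f i y :=
    funext fun a => hτ.gradVec_eq hf'.differentiableAt hff' a
  rw [h0, h0, h1, hτ.hessian_eq hf' hff', ← Matrix.mulVec_mulVec, ← Matrix.mulVec_mulVec,
    Matrix.dotProduct_mulVec _ (jacobian τ y)ᵀ, Matrix.vecMul_transpose]

end Invariant

/-! ### Locally Lipschitz functions -/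

section LipAt

variable {X Y Z : Type*} [PseudoMetricSpace X] [PseudoMetricSpace Y] [PseudoMetricSpace Z]

/-- `f` is Lipschitz in a neighbourhood of `x`. -/
def LipAt (f : X → Y) (x : X) : Prop := ∃ K, ∃ s ∈ 𝓝 x, LipschitzOnWith K f s

lemma LipAt.congr {f g : X → Y} {x : X} (hf : LipAt f x) (h : f =ᶠ[𝓝 x] g) : LipAt g x := by
  obtain ⟨K, s, hs, hK⟩ := hf
  refine ⟨K, s ∩ {z | f z = g z}, inter_mem hs h, fun a ha b hb => ?_⟩
  rw [← ha.2, ← hb.2]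
  exact hK ha.1 hb.1

lemma LipAt.continuousAt {f : X → Y} {x : X} (hf : LipAt f x) : ContinuousAt f x := by
  obtain ⟨K, s, hs, hK⟩ := hf
  exact hK.continuousOn.continuousAt hs

lemma LipAt.comp {f : Y → Z} {g : X → Y} {x : X} (hf : LipAt f (g x)) (hg : LipAt g x) :
    LipAt (fun z => f (g z)) x := by
  have hc := hg.continuousAt
  obtain ⟨K, s, hs, hK⟩ := hf
  obtain ⟨L, t, ht, hL⟩ := hg
  exact ⟨K * L, t ∩ g ⁻¹' s, inter_mem ht (hc hs),
    hK.comp (hL.mono Set.inter_subset_left) fun a ha => ha.2⟩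

lemma LipAt.prodMk {f : X → Y} {g : X → Z} {x : X} (hf : LipAt f x) (hg : LipAt g x) :
    LipAt (fun z => (f z, g z)) x := by
  obtain ⟨K, s, hs, hK⟩ := hf
  obtain ⟨L, t, ht, hL⟩ := hg
  exact ⟨max K L, s ∩ t, inter_mem hs ht,
    (hK.mono Set.inter_subset_left).prodMk (hL.mono Set.inter_subset_right)⟩

lemma LipAt.const (c : Y) (x : X) : LipAt (fun _ : X => c) x :=
  ⟨0, Set.univ, univ_mem, (LipschitzWith.const c).lipschitzOnWith⟩

lemma LipAt.eventually {f : X → Y} {x : X} (hf : LipAt f x) : ∀ᶠ z in 𝓝 x, LipAt f z := by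
  obtain ⟨K, s, hs, hK⟩ := hf
  filter_upwards [eventually_mem_nhds_iff.2 hs] with z hz
  exact ⟨K, s, hz, hK⟩

variable {E F : Type*} [NormedAddCommGroup E] [NormedSpace ℝ E] [NormedAddCommGroup F]
  [NormedSpace ℝ F]

lemma _root_.ContDiffAt.lipAt {f : E → F} {x : E} (hf : ContDiffAt ℝ 1 f x) : LipAt f x :=
  hf.exists_lipschitzOnWith

lemma LipAt.mul {f g : X → ℝ} {x : X} (hf : LipAt f x) (hg : LipAt g x) :
    LipAt (fun z => f z * g z) x :=
  LipAt.comp (f := fun p : ℝ × ℝ => p.1 * p.2)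
    (contDiff_fst.mul contDiff_snd).contDiffAt.lipAt (hf.prodMk hg)

lemma LipAt.add {f g : X → ℝ} {x : X} (hf : LipAt f x) (hg : LipAt g x) :
    LipAt (fun z => f z + g z) x :=
  LipAt.comp (f := fun p : ℝ × ℝ => p.1 + p.2)
    (contDiff_fst.add contDiff_snd).contDiffAt.lipAt (hf.prodMk hg)

lemma LipAt.sum {ι : Type*} {s : Finset ι} {f : ι → X → ℝ} {x : X}
    (hf : ∀ i ∈ s, LipAt (f i) x) : LipAt (fun z => ∑ i ∈ s, f i z) x := by
  classical
  induction s using Finset.induction_on with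
  | empty => simpa using LipAt.const (0 : ℝ) x
  | insert a s ha ih =>
    simp only [Finset.sum_insert ha]
    exact (hf a (Finset.mem_insert_self a s)).add
      (ih fun i hi => hf i (Finset.mem_insert_of_mem hi))

/-- A locally Lipschitz function with compact support is Lipschitz. -/
lemma exists_lipschitzWith_of_hasCompactSupport {f : X → ℝ} (hf : ∀ x, LipAt f x)
    (hc : HasCompactSupport f) : ∃ K, LipschitzWith K f := by
  have hcont : Continuous f := continuous_iff_continuousAt.2 fun x => (hf x).continuousAt
  -- one Lipschitz constant is good near all points of the support
  obtain ⟨N, hN⟩ : ∃ N : ℕ, ∀ x ∈ tsupport f, ∃ s ∈ 𝓝 x, LipschitzOnWith N f s := by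
    have := hc.isCompact.elim_directed_cover
      (fun N : ℕ => {x | ∃ s, IsOpen s ∧ x ∈ s ∧ LipschitzOnWith N f s})
      (fun N => by
        rw [isOpen_iff_mem_nhds]
        rintro x ⟨s, hs, hx, hL⟩
        filter_upwards [hs.mem_nhds hx] with z hz
        exact ⟨s, hs, hz, hL⟩)
      (fun x _ => by
        obtain ⟨K, s, hs, hK⟩ := hf x
        obtain ⟨N, hN⟩ := exists_nat_ge K
        exact Set.mem_iUnion.2 ⟨N, interior s, isOpen_interior, mem_interior_iff_mem_nhds.2 hs,
          (hK.mono interior_subset).weaken hN⟩)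
      (directed_of_isDirected_le fun a b hab => by
        rintro x ⟨s, hs, hx, hL⟩
        exact ⟨s, hs, hx, hL.weaken (by exact_mod_cast hab)⟩)
    obtain ⟨N, hN⟩ := this
    refine ⟨N, fun x hx => ?_⟩
    obtain ⟨s, hs, hxs, hL⟩ := hN hx
    exact ⟨s, hs.mem_nhds hxs, hL⟩
  obtain ⟨δ, hδ, hball⟩ := lebesgue_number_lemma_of_metric (ι := {s : Set X // LipschitzOnWith N f s})
    (c := fun s => interior s.1) hc.isCompact (fun _ => isOpen_interior) (fun x hx => by
      obtain ⟨s, hs, hL⟩ := hN x hx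
      exact Set.mem_iUnion.2 ⟨⟨s, hL⟩, mem_interior_iff_mem_nhds.2 hs⟩)
  obtain ⟨C, hC⟩ := hc.exists_bound_of_continuous hcont
  have hC0 : 0 ≤ C ∨ IsEmpty X := by
    rcases isEmpty_or_nonempty X with h | ⟨⟨x⟩⟩
    · exact Or.inr h
    · exact Or.inl ((norm_nonneg _).trans (hC x))
  rcases hC0 with hC0 | hX
  swap
  · exact ⟨0, fun x => hX.elim x⟩
  have key : ∀ x ∈ tsupport f, ∀ z, dist (f x) (f z) ≤ max (N : ℝ) (2 * C / δ) * dist x z := by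
    intro x hx z
    by_cases hxz : dist z x < δ
    · obtain ⟨⟨s, hL⟩, hs⟩ := hball x hx
      have h1 := hL.dist_le_mul x (interior_subset (hs (Metric.mem_ball_self hδ))) z
        (interior_subset (hs hxz))
      exact h1.trans (mul_le_mul_of_nonneg_right (le_max_left _ _) dist_nonneg)
    · rw [not_lt, dist_comm] at hxz
      have h1 : dist (f x) (f z) ≤ 2 * C := by
        rw [Real.dist_eq]
        have := abs_sub (f x) (f z)
        have h2 := hC x
        have h3 := hC z
        rw [Real.norm_eq_abs] at h2 h3
        linarith
      calc dist (f x) (f z) ≤ 2 * C / δ * δ := by rwa [div_mul_cancel₀ _ hδ.ne']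
        _ ≤ 2 * C / δ * dist x z := by gcongr
        _ ≤ _ := mul_le_mul_of_nonneg_right (le_max_right _ _) dist_nonneg
  have hmax : 0 ≤ max (N : ℝ) (2 * C / δ) := le_max_of_le_left (Nat.cast_nonneg _)
  refine ⟨⟨max (N : ℝ) (2 * C / δ), hmax⟩, LipschitzWith.of_dist_le_mul fun x z => ?_⟩
  by_cases hx : x ∈ tsupport f
  · exact key x hx z
  by_cases hz : z ∈ tsupport f
  · rw [dist_comm (f x), dist_comm x]; exact key z hz x
  · rw [image_eq_zero_of_notMem_tsupport hx, image_eq_zero_of_notMem_tsupport hz, dist_self]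
    positivity

end LipAt

section Integral

variable {E F : Type*} [NormedAddCommGroup E] [NormedSpace ℝ E] [FiniteDimensional ℝ E]
  [MeasurableSpace E] [BorelSpace E] [NormedAddCommGroup F] [NormedSpace ℝ F]
  [FiniteDimensional ℝ F]

/-- Rademacher's theorem for locally Lipschitz functions. -/
lemma ae_differentiableAt_of_lipAt (μ : Measure E) [μ.IsAddHaarMeasure] {f : E → F} {S : Set E}
    (hf : ∀ x ∈ S, LipAt f x) : ∀ᵐ x ∂μ, x ∈ S → DifferentiableAt ℝ f x := by
  rw [ae_iff]
  refine measure_null_of_locally_null _ fun x hx => ?_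
  simp only [Set.mem_ofPred_eq, Classical.not_imp] at hx
  obtain ⟨K, s, hs, hK⟩ := hf x hx.1
  refine ⟨{z | ¬(z ∈ S → DifferentiableAt ℝ f z)} ∩ interior s,
    inter_mem_nhdsWithin _ (interior_mem_nhds.2 hs), ?_⟩
  have h := (hK.mono interior_subset).ae_differentiableWithinAt_of_mem (μ := μ)
  rw [ae_iff] at h
  refine measure_mono_null (fun z hz => ?_) h
  simp only [Set.mem_ofPred_eq, Classical.not_imp]
  refine ⟨hz.2, fun hd => hz.1 fun _ => hd.differentiableAt (isOpen_interior.mem_nhds hz.2)⟩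

end Integral

/-! ### The divergence theorem in coordinates -/

lemma integral_partialDeriv_eq_zero {g : EuclideanSpace ℝ (Fin n) → ℝ} (hg : ∀ y, LipAt g y)
    (hc : HasCompactSupport g) (i : Fin n) :
    Integrable (partialDeriv i g) ∧ ∫ y, partialDeriv i g y = 0 := by
  obtain ⟨K, hK⟩ := exists_lipschitzWith_of_hasCompactSupport hg hc
  have hae : ∀ᵐ y, partialDeriv i g y = lineDeriv ℝ g y (EuclideanSpace.single i 1) := by
    filter_upwards [hK.ae_differentiableAt (μ := volume)] with y hy
    rw [hy.lineDeriv_eq_fderiv]; rfl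
  have hbound (y) : ‖partialDeriv i g y‖ ≤ K := by
    refine (ContinuousLinearMap.le_opNorm _ _).trans ?_
    have := norm_fderiv_le_of_lipschitz ℝ hK (x₀ := y)
    simpa using this
  have hsupp : Function.support (partialDeriv i g) ⊆ tsupport g := by
    intro y hy
    by_contra h
    apply hy
    rw [notMem_tsupport_iff_eventuallyEq] at h
    rw [partialDeriv, h.fderiv_eq]
    simp
  constructor
  · rw [← integrableOn_iff_integrable_of_support_subset hsupp]
    refine Measure.integrableOn_of_bounded (M := K) hc.isCompact.measure_lt_top.ne ?_ ?_
    · exact (measurable_fderiv_apply_const ℝ g _).aestronglyMeasurable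
    · exact ae_of_all _ hbound
  · rw [integral_congr_ae hae]
    have h := LipschitzWith.integral_lineDeriv_mul_eq (μ := volume)
      (LipschitzWith.const (1 : ℝ) : LipschitzWith 0 fun _ : EuclideanSpace ℝ (Fin n) => (1 : ℝ))
      hK hc (-EuclideanSpace.single i (1 : ℝ))
    have h0 (x v : EuclideanSpace ℝ (Fin n)) : lineDeriv ℝ (fun _ => (1 : ℝ)) x v = 0 := by
      simp [lineDeriv]
    simpa [h0] using h.symm

section Jacobi

variable {G : EuclideanSpace ℝ (Fin n) → Matrix (Fin n) (Fin n) ℝ}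
  {y : EuclideanSpace ℝ (Fin n)} {f h : EuclideanSpace ℝ (Fin n) → ℝ}

/-- Jacobi's formula for the derivative of a determinant. -/
lemma partialDeriv_det (hG : ∀ i j, DifferentiableAt ℝ (fun z => G z i j) y) (k : Fin n) :
    partialDeriv k (fun z => (G z).det) y
      = ∑ i, ∑ j, (G y).adjugate i j * partialDeriv k (fun z => G z j i) y := by
  have h1 : HasFDerivAt (fun z => (G z).det) (∑ σ : Equiv.Perm (Fin n), (Equiv.Perm.sign σ : ℝ) •
      ∑ i, (∏ j ∈ Finset.univ.erase i, G y (σ j) j) • fderiv ℝ (fun z => G z (σ i) i) y) y := by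
    simp only [Matrix.det_apply']
    refine HasFDerivAt.fun_sum fun σ _ => ?_
    exact (HasFDerivAt.finsetProd (u := Finset.univ) (fun i _ => (hG (σ i) i).hasFDerivAt)).const_mul
      ((Equiv.Perm.sign σ : ℤ) : ℝ)
  have h2 (i : Fin n) : ∑ j, (G y).adjugate i j * partialDeriv k (fun z => G z j i) y
      = ∑ σ : Equiv.Perm (Fin n), (Equiv.Perm.sign σ : ℝ) *
        ((∏ j ∈ Finset.univ.erase i, G y (σ j) j) * partialDeriv k (fun z => G z (σ i) i) y) := by
    have : ∑ j, (G y).adjugate i j * partialDeriv k (fun z => G z j i) y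
        = ((G y).updateCol i fun j => partialDeriv k (fun z => G z j i) y).det := by
      rw [← Matrix.cramer_apply, Matrix.cramer_eq_adjugate_mulVec]
      rfl
    rw [this, Matrix.det_apply']
    refine Finset.sum_congr rfl fun σ _ => ?_
    rw [← Finset.prod_erase_mul _ _ (Finset.mem_univ i)]
    congr 2
    · refine Finset.prod_congr rfl fun j hj => ?_
      rw [Matrix.updateCol_ne (Finset.ne_of_mem_erase hj)]
    · rw [Matrix.updateCol_self]
  simp only [h2]
  rw [partialDeriv, h1.fderiv, Finset.sum_comm]
  simp [partialDeriv, Finset.mul_sum]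

/-- `∂_k √det g = √det g Γ^l_lk`, which turns the Riemannian divergence into a Euclidean one. -/
lemma IsMetricAt.partialDeriv_sqrt_det (hG : IsMetricAt G y) (k : Fin n) :
    partialDeriv k (fun z => √(G z).det) y = √(G y).det * ∑ l, christoffel G l l k y := by
  have hpos := hG.posDef_self.det_pos
  have hd : DifferentiableAt ℝ (fun z => (G z).det) y :=
    (contDiffAt_det hG.contDiffAt).differentiableAt (by norm_num)
  have htr : ∑ l, christoffel G l l k y
      = (1 / 2) * ∑ l, ∑ m, (G y)⁻¹ l m * partialDeriv k (fun z => G z l m) y := by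
    have h1 : ∑ l, ∑ m, (G y)⁻¹ l m * partialDeriv l (fun z => G z k m) y
        = ∑ l, ∑ m, (G y)⁻¹ l m * partialDeriv m (fun z => G z l k) y := by
      rw [Finset.sum_comm]
      exact Finset.sum_congr rfl fun i _ => Finset.sum_congr rfl fun j _ => by
        rw [hG.inv_comm j i, hG.partialDeriv_comm j k i]
    unfold christoffel
    simp only [mul_sub, mul_add, Finset.sum_add_distrib, Finset.sum_sub_distrib, h1,
      ← Finset.mul_sum]
    ring
  have hinv (l m : Fin n) : (G y)⁻¹ l m = (G y).det⁻¹ * (G y).adjugate l m := by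
    simp [Matrix.inv_def]
  rw [partialDeriv_comp k (Real.hasDerivAt_sqrt hpos.ne') hd,
    partialDeriv_det hG.differentiableAt, htr]
  simp only [hinv, mul_assoc, ← Finset.mul_sum]
  have h2 : ∑ i, ∑ j, (G y).adjugate i j * partialDeriv k (fun z => G z j i) y
      = ∑ i, ∑ j, (G y).adjugate i j * partialDeriv k (fun z => G z i j) y :=
    Finset.sum_congr rfl fun i _ => Finset.sum_congr rfl fun j _ => by
      rw [hG.partialDeriv_comm k j i]
  rw [h2]
  have h4 : √(G y).det ≠ 0 := (Real.sqrt_pos.2 hpos).ne'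
  generalize ∑ i, ∑ j, (G y).adjugate i j * partialDeriv k (fun z => G z i j) y = S
  field_simp
  rw [Real.sq_sqrt hpos.le, mul_comm]

end Jacobi

section Divergence

variable {G : EuclideanSpace ℝ (Fin n) → Matrix (Fin n) (Fin n) ℝ}
  {y : EuclideanSpace ℝ (Fin n)} {f h F ψ : EuclideanSpace ℝ (Fin n) → ℝ}

/-- Cauchy-Schwarz for a positive definite matrix. -/
lemma sq_dotProduct_mulVec_le {A : Matrix (Fin n) (Fin n) ℝ} (hA : A.PosDef) (v w : Fin n → ℝ) :
    (v ⬝ᵥ (A *ᵥ w)) ^ 2 ≤ (v ⬝ᵥ (A *ᵥ v)) * (w ⬝ᵥ (A *ᵥ w)) := by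
  obtain ⟨B, hB, -⟩ := exists_orthonormal_components hA.inv 0
  rw [Matrix.nonsing_inv_nonsing_inv _ hA.isUnit_det_of_posDef] at hB
  have h (v w : Fin n → ℝ) : v ⬝ᵥ (A *ᵥ w) = (B *ᵥ v) ⬝ᵥ (B *ᵥ w) := by
    rw [hB, ← Matrix.mulVec_mulVec, Matrix.dotProduct_mulVec, Matrix.vecMul_transpose]
  rw [h, h, h]
  simp only [dotProduct]
  simpa [sq] using Finset.sum_mul_sq_le_sq_mul_sq Finset.univ (B *ᵥ v) (B *ᵥ w)

lemma IsMetricAt.sq_partialDeriv_le (hG : IsMetricAt G y) (f : EuclideanSpace ℝ (Fin n) → ℝ)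
    (i : Fin n) : partialDeriv i f y ^ 2 ≤ G y i i * gradInner G f f y := by
  -- Cauchy-Schwarz for `∂_i f = g(∂_i, ∇f)`
  have h := sq_dotProduct_mulVec_le hG.posDef_self (Pi.single i 1) (fun k => gradVec G f k y)
  have h1 : G y *ᵥ (fun k => gradVec G f k y) = fun i => partialDeriv i f y :=
    funext fun i => hG.sum_metric_mul_gradVec f i
  rw [h1] at h
  have h2 : (fun k => gradVec G f k y) ⬝ᵥ (fun i => partialDeriv i f y) = gradInner G f f y := by
    rw [dotProduct_comm, gradInner_eq_dotProduct]; rfl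
  rw [h2] at h
  simpa using h

/-- `f` has a locally Lipschitz derivative near `y`. -/
structure IsC11At (f : EuclideanSpace ℝ (Fin n) → ℝ) (y : EuclideanSpace ℝ (Fin n)) : Prop where
  eventually_differentiableAt : ∀ᶠ z in 𝓝 y, DifferentiableAt ℝ f z
  lipAt_fderiv : LipAt (fderiv ℝ f) y

lemma IsC11At.isTwiceDiffAt (hf : IsC11At f y) (h : DifferentiableAt ℝ (fderiv ℝ f) y) :
    IsTwiceDiffAt f y := ⟨hf.eventually_differentiableAt, h⟩

lemma IsC11At.lipAt_partialDeriv (hf : IsC11At f y) (i : Fin n) : LipAt (partialDeriv i f) y := by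
  have h : ContDiffAt ℝ 1 (fun L : EuclideanSpace ℝ (Fin n) →L[ℝ] ℝ =>
      L (EuclideanSpace.single i 1)) (fderiv ℝ f y) :=
    contDiffAt_id.clm_apply contDiffAt_const
  exact LipAt.comp (f := fun L : EuclideanSpace ℝ (Fin n) →L[ℝ] ℝ =>
      L (EuclideanSpace.single i 1)) (g := fderiv ℝ f) h.lipAt hf.lipAt_fderiv

lemma IsC11At.lipAt (hf : IsC11At f y) : LipAt f y := by
  have h1 : ContDiffAt ℝ ((0 : ℕ) + 1) f y := by
    rw [contDiffAt_succ_iff_hasFDerivAt]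
    refine ⟨fderiv ℝ f, ⟨_, hf.eventually_differentiableAt, fun z hz => hz.hasFDerivAt⟩, ?_⟩
    refine contDiffAt_zero.2 ⟨{z | LipAt (fderiv ℝ f) z}, hf.lipAt_fderiv.eventually, fun z hz => ?_⟩
    exact (LipAt.continuousAt hz).continuousWithinAt
  exact ContDiffAt.lipAt (by simpa using h1)

lemma IsMetricAt.lipAt_inv (hG : IsMetricAt G y) (i j : Fin n) : LipAt (fun z => (G z)⁻¹ i j) y :=
  ((hG.contDiffAt_inv i j).of_le (by norm_num)).lipAt

lemma IsMetricAt.lipAt_gradVec (hG : IsMetricAt G y) (hf : IsC11At f y) (k : Fin n) :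
    LipAt (gradVec G f k) y :=
  LipAt.sum fun l _ => (hG.lipAt_inv k l).mul (hf.lipAt_partialDeriv l)

lemma LipAt.exists_bound {f : EuclideanSpace ℝ (Fin n) → ℝ} (hf : LipAt f y) :
    ∃ A, 0 ≤ A ∧ (∀ᶠ z in 𝓝 y, |f z| ≤ A) ∧
      ∀ᶠ z in 𝓝 y ×ˢ 𝓝 y, |f z.1 - f z.2| ≤ A * dist z.1 z.2 := by
  have hc := hf.continuousAt
  obtain ⟨K, s, hs, hK⟩ := hf
  refine ⟨max (|f y| + 1) K, le_max_of_le_right K.2, ?_, ?_⟩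
  · have : ∀ᶠ z in 𝓝 y, |f z| < |f y| + 1 := hc.abs.eventually (gt_mem_nhds (lt_add_one _))
    exact this.mono fun z hz => hz.le.trans (le_max_left _ _)
  · filter_upwards [prod_mem_prod hs hs] with z hz
    have := hK.dist_le_mul _ hz.1 _ hz.2
    rw [Real.dist_eq] at this
    exact this.trans (mul_le_mul_of_nonneg_right (le_max_right _ _) dist_nonneg)

/-- `|∇f|` is locally Lipschitz, although it is the square root of a function vanishing
at the critical points of `f`: the differences of `|∇f|²` are bounded by the distance times the
sum of the values of `|∇f|`. -/
lemma IsMetricAt.lipAt_sqrt_gradInner (hG : IsMetricAt G y) (hf : IsC11At f y) :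
    LipAt (fun z => √(gradInner G f f z)) y := by
  choose A hA0 hA1 hA2 using fun i j => (hG.lipAt_inv i j).exists_bound
  choose B hB0 hB1 hB2 using fun i => (hf.lipAt_partialDeriv i).exists_bound
  have hGl (i) : LipAt (fun z => G z i i) y := ((hG.contDiffAt i i).of_le (by norm_num)).lipAt
  choose C hC0 hC1 _ using fun i => (hGl i).exists_bound
  set L : ℝ := ∑ i, ∑ j, (A i j * B i * √(C j) + A i j * B i * √(C j) + A i j * √(C i) * B j)
    with hL
  have hL0 : 0 ≤ L := Finset.sum_nonneg fun i _ => Finset.sum_nonneg fun j _ => by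
    have := hA0 i j; have := hB0 i; have := hB0 j
    positivity
  -- the partial derivatives are controlled by `|∇f|`
  have hpd : ∀ᶠ z in 𝓝 y, IsMetricAt G z ∧
      (∀ i, |partialDeriv i f z| ≤ √(C i) * √(gradInner G f f z)) ∧
      (∀ i j, |(G z)⁻¹ i j| ≤ A i j) ∧ ∀ i, |partialDeriv i f z| ≤ B i := by
    filter_upwards [hG.eventually, eventually_all.2 hC1,
      eventually_all.2 fun i => eventually_all.2 (hA1 i), eventually_all.2 hB1] with z h1 h2 h3 h4
    refine ⟨h1, fun i => ?_, h3, h4⟩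
    rw [← Real.sqrt_mul (hC0 i)]
    refine Real.abs_le_sqrt ((h1.sq_partialDeriv_le f i).trans ?_)
    exact mul_le_mul_of_nonneg_right ((le_abs_self _).trans (h2 i)) (h1.gradInner_self_nonneg f)
  have hmain : ∀ᶠ z in 𝓝 y ×ˢ 𝓝 y,
      |√(gradInner G f f z.1) - √(gradInner G f f z.2)| ≤ L * dist z.1 z.2 := by
    filter_upwards [hpd.prod_mk hpd, eventually_all.2 fun i => eventually_all.2 (hA2 i),
      eventually_all.2 hB2] with ⟨z, w⟩ ⟨⟨hz0, hz1, hz2, hz3⟩, ⟨hw0, hw1, hw2, hw3⟩⟩ h2 h3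
    dsimp only at *
    set N := √(gradInner G f f z)
    set N' := √(gradInner G f f w)
    set d := dist z w
    have hN : 0 ≤ N := Real.sqrt_nonneg _
    have hN' : 0 ≤ N' := Real.sqrt_nonneg _
    have hd : 0 ≤ d := dist_nonneg
    have hs : gradInner G f f z = N ^ 2 := (Real.sq_sqrt (hz0.gradInner_self_nonneg f)).symm
    have hs' : gradInner G f f w = N' ^ 2 := (Real.sq_sqrt (hw0.gradInner_self_nonneg f)).symm
    have key : |N ^ 2 - N' ^ 2| ≤ L * d * (N + N') := by
      rw [← hs, ← hs', gradInner, gradInner, ← Finset.sum_sub_distrib, hL, Finset.sum_mul,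
        Finset.sum_mul]
      refine (Finset.abs_sum_le_sum_abs _ _).trans (Finset.sum_le_sum fun i _ => ?_)
      rw [← Finset.sum_sub_distrib, Finset.sum_mul, Finset.sum_mul]
      refine (Finset.abs_sum_le_sum_abs _ _).trans (Finset.sum_le_sum fun j _ => ?_)
      have e : (G z)⁻¹ i j * partialDeriv i f z * partialDeriv j f z
          - (G w)⁻¹ i j * partialDeriv i f w * partialDeriv j f w
          = ((G z)⁻¹ i j - (G w)⁻¹ i j) * partialDeriv i f z * partialDeriv j f z
          + (G w)⁻¹ i j * (partialDeriv i f z - partialDeriv i f w) * partialDeriv j f z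
          + (G w)⁻¹ i j * partialDeriv i f w * (partialDeriv j f z - partialDeriv j f w) := by
        ring
      rw [e]
      have t1 : |((G z)⁻¹ i j - (G w)⁻¹ i j) * partialDeriv i f z * partialDeriv j f z|
          ≤ A i j * d * B i * (√(C j) * N) := by
        rw [abs_mul, abs_mul]
        exact mul_le_mul (mul_le_mul (h2 i j) (hz3 i) (abs_nonneg _)
          (mul_nonneg (hA0 i j) hd)) (hz1 j) (abs_nonneg _)
          (mul_nonneg (mul_nonneg (hA0 i j) hd) (hB0 i))
      have t2 : |(G w)⁻¹ i j * (partialDeriv i f z - partialDeriv i f w) * partialDeriv j f z|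
          ≤ A i j * (B i * d) * (√(C j) * N) := by
        rw [abs_mul, abs_mul]
        exact mul_le_mul (mul_le_mul (hw2 i j) (h3 i) (abs_nonneg _) (hA0 i j)) (hz1 j)
          (abs_nonneg _) (mul_nonneg (hA0 i j) (mul_nonneg (hB0 i) hd))
      have t3 : |(G w)⁻¹ i j * partialDeriv i f w * (partialDeriv j f z - partialDeriv j f w)|
          ≤ A i j * (√(C i) * N') * (B j * d) := by
        rw [abs_mul, abs_mul]
        exact mul_le_mul (mul_le_mul (hw2 i j) (hw1 i) (abs_nonneg _) (hA0 i j)) (h3 j)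
          (abs_nonneg _) (mul_nonneg (hA0 i j) (by positivity))
      refine (abs_add_three _ _ _).trans ((add_le_add_three t1 t2 t3).trans ?_)
      have p1 : 0 ≤ A i j * B i * √(C j) * d * N' := by
        have := hA0 i j; have := hB0 i; positivity
      have p2 : 0 ≤ A i j * √(C i) * B j * d * N := by
        have := hA0 i j; have := hB0 j; positivity
      nlinarith [p1, p2]
    rcases (add_nonneg hN hN').eq_or_lt with h0 | h0
    · have : N = 0 := by linarith
      have : N' = 0 := by linarith
      rw [‹N = 0›, ‹N' = 0›]
      simpa using mul_nonneg hL0 hd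
    · have e : |N ^ 2 - N' ^ 2| = |N - N'| * (N + N') := by
        rw [sq_sub_sq, abs_mul, abs_of_pos h0, mul_comm]
      rw [e] at key
      exact le_of_mul_le_mul_right key h0
  rw [← nhds_prod_eq, eventually_nhds_iff] at hmain
  obtain ⟨t, ht, hto, hyt⟩ := hmain
  obtain ⟨u, hu, v, hv, huv⟩ := mem_nhds_prod_iff.1 (hto.mem_nhds hyt)
  refine ⟨⟨L, hL0⟩, u ∩ v, inter_mem hu hv, LipschitzOnWith.of_dist_le_mul fun z hz w hw => ?_⟩
  rw [Real.dist_eq]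
  exact ht (z, w) (huv ⟨hz.1, hw.2⟩)

/-- The weight `|∇f|^{p-2} e^{αf}`. -/
noncomputable def gradWeight (p α : ℝ) (G : EuclideanSpace ℝ (Fin n) → Matrix (Fin n) (Fin n) ℝ)
    (f : EuclideanSpace ℝ (Fin n) → ℝ) (y : EuclideanSpace ℝ (Fin n)) : ℝ :=
  √(gradInner G f f y) ^ (p - 2) * Real.exp (α * f y)

/-- The divergence of `|∇f|^{p-2} e^{αf} ∇f`, in expanded form. Where `∇f = 0` the middle term
vanishes because `hessianGrad` does, whatever the value of `|∇f|^{p-4}`. -/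
noncomputable def gradFlux (p α : ℝ) (G : EuclideanSpace ℝ (Fin n) → Matrix (Fin n) (Fin n) ℝ)
    (f : EuclideanSpace ℝ (Fin n) → ℝ) (y : EuclideanSpace ℝ (Fin n)) : ℝ :=
  Real.exp (α * f y) * (√(gradInner G f f y) ^ (p - 2) * laplacian G f y
    + (p - 2) * √(gradInner G f f y) ^ (p - 4) * hessianGrad G f y
    + α * √(gradInner G f f y) ^ p)

/-- For `p ≥ 3` the function `t ↦ t^{p-2}` is `C¹`, so that the weight is locally Lipschitz also near
the critical points of `f`. -/
lemma IsMetricAt.lipAt_gradWeight (hG : IsMetricAt G y) (hf : IsC11At f y) {p α : ℝ} (hp : 3 ≤ p) :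
    LipAt (gradWeight p α G f) y := by
  refine LipAt.mul ?_ ?_
  · refine LipAt.comp (f := fun t : ℝ => t ^ (p - 2)) ?_ (hG.lipAt_sqrt_gradInner hf)
    exact (Real.contDiff_rpow_const_of_le (n := 1) (by norm_num; linarith)).contDiffAt.lipAt
  · refine LipAt.comp (f := fun t : ℝ => Real.exp (α * t)) ?_ hf.lipAt
    exact (Real.contDiff_exp.comp (contDiff_const.mul contDiff_id)).contDiffAt.lipAt

lemma IsMetricAt.partialDeriv_eq_zero (hG : IsMetricAt G y) (h0 : gradInner G f f y = 0)
    (i : Fin n) : partialDeriv i f y = 0 := by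
  have := hG.sq_partialDeriv_le f i
  rw [h0, mul_zero] at this
  exact pow_eq_zero_iff (two_ne_zero) |>.1 (le_antisymm this (sq_nonneg _))

/-- The product rule that identifies `gradFlux` as a divergence. -/
lemma IsMetricAt.gradWeight_mul_laplacian_add (hG : IsMetricAt G y) (hf : IsTwiceDiffAt f y)
    {p α : ℝ} (hp : 3 ≤ p) :
    gradWeight p α G f y * laplacian G f y + gradInner G (gradWeight p α G f) f y
      = gradFlux p α G f y := by
  have hs0 := hG.gradInner_self_nonneg f
  rcases hs0.eq_or_lt with h0 | h0
  · have hpd := hG.partialDeriv_eq_zero h0.symm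
    have hgv (k) : gradVec G f k y = 0 := by simp [gradVec, hpd]
    have hH : hessianGrad G f y = 0 := by simp [hessianGrad, hgv]
    have e1 : gradInner G (gradWeight p α G f) f y = 0 := by simp [gradInner, hpd]
    rw [e1, gradFlux, gradWeight, ← h0, hH, Real.sqrt_zero, Real.zero_rpow (by linarith),
      Real.zero_rpow (by linarith : p ≠ 0)]
    ring
  · set s := gradInner G f f y with hs
    have hN : 0 < √s := Real.sqrt_pos.2 h0
    have hds := hG.differentiableAt_gradInner_self hf
    have hφ : HasDerivAt (fun t => √t ^ (p - 2)) (1 / (2 * √s) * (p - 2) * √s ^ (p - 2 - 1)) s :=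
      (Real.hasDerivAt_sqrt h0.ne').rpow_const (Or.inl hN.ne')
    have hexp : HasDerivAt (fun t => Real.exp (α * t)) (Real.exp (α * f y) * α) (f y) := by
      simpa using (((hasDerivAt_id (f y)).const_mul α).exp)
    have hd1 : DifferentiableAt ℝ (fun z => √(gradInner G f f z) ^ (p - 2)) y :=
      DifferentiableAt.comp (g := fun t => √t ^ (p - 2)) y hφ.differentiableAt hds
    have hd2 : DifferentiableAt ℝ (fun z => Real.exp (α * f z)) y :=
      DifferentiableAt.comp (g := fun t => Real.exp (α * t)) y hexp.differentiableAt
        hf.differentiableAt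
    have hpd (i) : partialDeriv i (gradWeight p α G f) y
        = √s ^ (p - 2) * (Real.exp (α * f y) * α * partialDeriv i f y)
        + Real.exp (α * f y) * (1 / (2 * √s) * (p - 2) * √s ^ (p - 2 - 1)
          * partialDeriv i (gradInner G f f) y) := by
      unfold gradWeight
      rw [partialDeriv_mul i hd1 hd2, partialDeriv_comp i hφ hds,
        partialDeriv_comp i hexp hf.differentiableAt]
    have e1 : gradInner G (gradWeight p α G f) f y
        = √s ^ (p - 2) * Real.exp (α * f y) * α * s
          + Real.exp (α * f y) * (1 / (2 * √s) * (p - 2) * √s ^ (p - 2 - 1))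
            * (2 * hessianGrad G f y) := by
      have hA (A : ℝ) : A * s = ∑ i, A * (partialDeriv i f y * gradVec G f i y) := by
        rw [hs, gradInner_eq_sum, Finset.mul_sum]
      rw [← hG.gradInner_gradInner_self hf, hA, gradInner_eq_sum (gradWeight p α G f),
        gradInner_eq_sum (gradInner G f f), Finset.mul_sum, ← Finset.sum_add_distrib]
      refine Finset.sum_congr rfl fun i _ => ?_
      rw [hpd]; ring
    have r1 : √s ^ p = √s ^ (p - 2) * s := by
      conv_rhs => rw [← Real.sq_sqrt h0.le]
      rw [Real.sqrt_sq hN.le, ← Real.rpow_natCast (√s) 2, ← Real.rpow_add hN]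
      congr 1; push_cast; ring
    have r2 : √s ^ (p - 2 - 1) = √s ^ (p - 4) * √s := by
      rw [← Real.rpow_add_one hN.ne']
      congr 1; ring
    rw [e1, gradFlux, gradWeight, ← hs, r1, r2]
    field_simp
    ring

/-- The divergence of `ψ F ∇f` integrates to zero with respect to `√det g dy`. Only Lipschitz
regularity of `ψ`, `F` and `df` is available, so that the integrand exists almost everywhere, by
Rademacher's theorem. -/
lemma integral_divergence_eq_zero {Ω : Set (EuclideanSpace ℝ (Fin n))}
    (hG : ∀ y ∈ Ω, IsMetricAt G y) (hf : ∀ y ∈ Ω, IsC11At f y) (hF : ∀ y ∈ Ω, LipAt F y)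
    (hψ : ∀ y, LipAt ψ y) (hc : HasCompactSupport ψ) (hψΩ : tsupport ψ ⊆ Ω) :
    Integrable (fun y => √(G y).det * (ψ y * (F y * laplacian G f y + gradInner G F f y)
      + F y * gradInner G ψ f y)) ∧
    ∫ y, √(G y).det * (ψ y * (F y * laplacian G f y + gradInner G F f y)
      + F y * gradInner G ψ f y) = 0 := by
  set Z : Fin n → EuclideanSpace ℝ (Fin n) → ℝ := fun i y =>
    ψ y * (√(G y).det * (gradVec G f i y * F y)) with hZ
  have hdet {y} (hy : IsMetricAt G y) : ContDiffAt ℝ 1 (fun z => √(G z).det) y :=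
    ((contDiffAt_det hy.contDiffAt).of_le (by norm_num)).sqrt hy.posDef_self.det_pos.ne'
  have hzero {y} (hy : y ∉ tsupport ψ) : ψ =ᶠ[𝓝 y] 0 := notMem_tsupport_iff_eventuallyEq.1 hy
  have hZlip (i y) : LipAt (Z i) y := by
    by_cases hy : y ∈ tsupport ψ
    · have hy' := hψΩ hy
      exact (hψ y).mul ((hdet (hG y hy')).lipAt.mul
        (((hG y hy').lipAt_gradVec (hf y hy') i).mul (hF y hy')))
    · refine (LipAt.const (0 : ℝ) y).congr ?_
      filter_upwards [hzero hy] with z hz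
      simp [hZ, hz]
  have hZc (i) : HasCompactSupport (Z i) := hc.mul_right
  have hae : ∀ᵐ y, ∑ i, partialDeriv i (Z i) y
      = √(G y).det * (ψ y * (F y * laplacian G f y + gradInner G F f y)
        + F y * gradInner G ψ f y) := by
    filter_upwards [ae_differentiableAt_of_lipAt volume (S := Set.univ) (fun y _ => hψ y),
      ae_differentiableAt_of_lipAt volume hF,
      ae_differentiableAt_of_lipAt volume (fun y hy => (hf y hy).lipAt_fderiv)] with y h1 h2 h3
    by_cases hy : y ∈ tsupport ψ
    · have hy' := hψΩ hy
      have hf2 := (hf y hy').isTwiceDiffAt (h3 hy')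
      have hGy := hG y hy'
      have dψ := h1 trivial
      have dF := h2 hy'
      have dd : DifferentiableAt ℝ (fun z => √(G z).det) y :=
        (hdet hGy).differentiableAt (by norm_num)
      have dV := hGy.differentiableAt_gradVec hf2
      have hi (i) : partialDeriv i (Z i) y = √(G y).det * ψ y * F y *
            (partialDeriv i (gradVec G f i) y
              + ∑ l, christoffel G l l i y * gradVec G f i y)
          + √(G y).det * ψ y * (partialDeriv i F y * gradVec G f i y)
          + √(G y).det * F y * (partialDeriv i ψ y * gradVec G f i y) := by
        rw [hZ]
        dsimp only
        rw [partialDeriv_mul i dψ (dd.fun_mul ((dV i).fun_mul dF)),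
          partialDeriv_mul i dd ((dV i).fun_mul dF), partialDeriv_mul i (dV i) dF,
          hGy.partialDeriv_sqrt_det, ← Finset.sum_mul]
        ring
      simp only [hi, Finset.sum_add_distrib, ← Finset.mul_sum, ← gradInner_eq_sum]
      rw [Finset.sum_comm (f := fun i l => christoffel G l l i y * gradVec G f i y),
        ← hGy.laplacian_eq_divergence hf2]
      ring
    · have hz := hzero hy
      have e1 (i) : partialDeriv i (Z i) y = 0 := by
        have : Z i =ᶠ[𝓝 y] fun _ => 0 := by
          filter_upwards [hz] with z hz
          simp [hZ, hz]
        rw [partialDeriv_congr i this]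
        simp [partialDeriv]
      have e2 (i) : partialDeriv i ψ y = 0 := by
        rw [partialDeriv_congr i (hz : ψ =ᶠ[𝓝 y] fun _ => 0)]
        simp [partialDeriv]
      have e3 : ψ y = 0 := hz.self_of_nhds
      simp [e1, e2, e3, gradInner]
  have hint := fun i => integral_partialDeriv_eq_zero (hZlip i) (hZc i) i
  constructor
  · exact (integrable_finsetSum Finset.univ fun i _ => (hint i).1).congr hae
  · rw [← integral_congr_ae hae, integral_finsetSum _ fun i _ => (hint i).1]
    exact Finset.sum_eq_zero fun i _ => (hint i).2

end Divergence

/-! ### The metric in the charts of a manifold -/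

section Charts

variable {M : Type*} [TopologicalSpace M] [ChartedSpace (EuclideanSpace ℝ (Fin n)) M]

/-- The derivative of the inverse of a chart. The tangent space of `M` is a type synonym of the model
space; stating the values in the model space gives linear maps between fixed spaces. -/
noncomputable def chartDeriv (e : OpenPartialHomeomorph M (EuclideanSpace ℝ (Fin n)))
    (y : EuclideanSpace ℝ (Fin n)) : EuclideanSpace ℝ (Fin n) →L[ℝ] EuclideanSpace ℝ (Fin n) :=
  @mfderiv ℝ _ (EuclideanSpace ℝ (Fin n)) _ _ (EuclideanSpace ℝ (Fin n)) _
    𝓘(ℝ, EuclideanSpace ℝ (Fin n)) (EuclideanSpace ℝ (Fin n)) _ (chartedSpaceSelf _)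
    (EuclideanSpace ℝ (Fin n)) _ _ (EuclideanSpace ℝ (Fin n)) _
    𝓘(ℝ, EuclideanSpace ℝ (Fin n)) M _ _ e.symm y

variable [IsManifold 𝓘(ℝ, EuclideanSpace ℝ (Fin n)) ∞ M]
  {e e' : OpenPartialHomeomorph M (EuclideanSpace ℝ (Fin n))}

lemma chartDeriv_injective (he : e ∈ atlas (EuclideanSpace ℝ (Fin n)) M)
    {y : EuclideanSpace ℝ (Fin n)} (hy : y ∈ e.target) : Function.Injective (chartDeriv e y) :=
  (mdifferentiable_of_mem_atlas (I := 𝓘(ℝ, EuclideanSpace ℝ (Fin n))) he).symm.mfderiv_injective hy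

/-- The transition maps of the atlas are smooth. -/
lemma contDiffAt_transition (he : e ∈ atlas (EuclideanSpace ℝ (Fin n)) M)
    (he' : e' ∈ atlas (EuclideanSpace ℝ (Fin n)) M) {y : EuclideanSpace ℝ (Fin n)}
    (hy : y ∈ e.target) (hy' : e.symm y ∈ e'.source) {k : ℕ∞} :
    ContDiffAt ℝ k (fun z => e' (e.symm z)) y := by
  have h1 : ContMDiffAt 𝓘(ℝ, EuclideanSpace ℝ (Fin n)) 𝓘(ℝ, EuclideanSpace ℝ (Fin n)) ∞ e.symm y :=
    contMDiffAt_symm_of_mem_maximalAtlas (IsManifold.subset_maximalAtlas he) hy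
  have h2 : ContMDiffAt 𝓘(ℝ, EuclideanSpace ℝ (Fin n)) 𝓘(ℝ, EuclideanSpace ℝ (Fin n)) ∞ e'
      (e.symm y) :=
    contMDiffAt_of_mem_maximalAtlas (IsManifold.subset_maximalAtlas he') hy'
  exact ((contMDiffAt_iff_contDiffAt.1 (h2.comp y h1)).of_le (by exact_mod_cast le_top))

lemma eventually_overlap {y : EuclideanSpace ℝ (Fin n)} (hy : y ∈ e.target)
    (hy' : e.symm y ∈ e'.source) : ∀ᶠ z in 𝓝 y, z ∈ e.target ∧ e.symm z ∈ e'.source := by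
  filter_upwards [e.open_target.mem_nhds hy,
    (e.symm.continuousAt hy).preimage_mem_nhds (e'.open_source.mem_nhds hy')] with z h1 h2
  exact ⟨h1, h2⟩

lemma chartDeriv_eq_comp (he : e ∈ atlas (EuclideanSpace ℝ (Fin n)) M)
    (he' : e' ∈ atlas (EuclideanSpace ℝ (Fin n)) M) {y : EuclideanSpace ℝ (Fin n)}
    (hy : y ∈ e.target) (hy' : e.symm y ∈ e'.source) (v : EuclideanSpace ℝ (Fin n)) :
    chartDeriv e y v = chartDeriv e' (e' (e.symm y)) (fderiv ℝ (fun z => e' (e.symm z)) y v) := by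
  have h1 : e.symm =ᶠ[𝓝 y] e'.symm ∘ fun z => e' (e.symm z) := by
    filter_upwards [eventually_overlap hy hy'] with z hz
    simp [e'.left_inv hz.2]
  have h2 : MDifferentiableAt 𝓘(ℝ, EuclideanSpace ℝ (Fin n)) 𝓘(ℝ, EuclideanSpace ℝ (Fin n))
      (fun z => e' (e.symm z)) y :=
    ((contDiffAt_transition (k := 1) he he' hy hy').differentiableAt
      (by norm_num)).mdifferentiableAt
  have h3 : MDifferentiableAt 𝓘(ℝ, EuclideanSpace ℝ (Fin n)) 𝓘(ℝ, EuclideanSpace ℝ (Fin n))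
      e'.symm (e' (e.symm y)) := mdifferentiableAt_atlas_symm he' (e'.map_source hy')
  have h4 := mfderiv_comp y h3 h2
  rw [← h1.mfderiv_eq, mfderiv_eq_fderiv] at h4
  exact congrArg (fun L : EuclideanSpace ℝ (Fin n) →L[ℝ] EuclideanSpace ℝ (Fin n) => L v) h4

variable [RiemannianBundle (fun x : M => TangentSpace 𝓘(ℝ, EuclideanSpace ℝ (Fin n)) x)]

/-- The Riemannian inner product of the tangent space at `x`, for vectors of the model space. The
instance is given explicitly since the model space carries an inner product of its own. -/
noncomputable def innerAt (x : M) (v w : EuclideanSpace ℝ (Fin n)) : ℝ :=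
  @inner ℝ (TangentSpace 𝓘(ℝ, EuclideanSpace ℝ (Fin n)) x) _ v w

lemma innerAt_bilinear (x : M) : (∀ w, IsLinearMap ℝ fun v => innerAt (n := n) x v w) ∧
    ∀ v, IsLinearMap ℝ (innerAt (n := n) x v) := by
  refine ⟨fun w => ⟨fun v v' => ?_, fun c v => ?_⟩, fun v => ⟨fun w w' => ?_, fun c w => ?_⟩⟩
  · exact inner_add_left (𝕜 := ℝ) (E := TangentSpace 𝓘(ℝ, EuclideanSpace ℝ (Fin n)) x) v v' w
  · exact real_inner_smul_left (F := TangentSpace 𝓘(ℝ, EuclideanSpace ℝ (Fin n)) x) v w c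
  · exact inner_add_right (𝕜 := ℝ) (E := TangentSpace 𝓘(ℝ, EuclideanSpace ℝ (Fin n)) x) v w w'
  · exact real_inner_smul_right (F := TangentSpace 𝓘(ℝ, EuclideanSpace ℝ (Fin n)) x) v w c

lemma metricMatrix_apply (y : EuclideanSpace ℝ (Fin n)) (i j : Fin n) :
    metricMatrix e y i j = innerAt (e.symm y) (chartDeriv e y (EuclideanSpace.single i 1))
      (chartDeriv e y (EuclideanSpace.single j 1)) := rfl

lemma bilinOfMatrix_metricMatrix (y v w : EuclideanSpace ℝ (Fin n)) :
    bilinOfMatrix (metricMatrix e y) v w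
      = innerAt (e.symm y) (chartDeriv e y v) (chartDeriv e y w) := by
  have h := bilinear_eq_sum
    (φ := fun v w => innerAt (n := n) (e.symm y) (chartDeriv e y v) (chartDeriv e y w))
    (fun w => ⟨fun v v' => by
        rw [map_add]; exact ((innerAt_bilinear (e.symm y)).1 _).map_add _ _,
      fun c v => by rw [map_smul]; exact ((innerAt_bilinear (e.symm y)).1 _).map_smul _ _⟩)
    (fun v => ⟨fun w w' => by
        rw [map_add]; exact ((innerAt_bilinear (e.symm y)).2 _).map_add _ _,
      fun c w => by rw [map_smul]; exact ((innerAt_bilinear (e.symm y)).2 _).map_smul _ _⟩) v w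
  rw [h, bilinOfMatrix_apply]
  exact Finset.sum_congr rfl fun i _ => Finset.sum_congr rfl fun j _ => by
    rw [metricMatrix_apply]; ring

lemma posDef_metricMatrix (he : e ∈ atlas (EuclideanSpace ℝ (Fin n)) M)
    {y : EuclideanSpace ℝ (Fin n)} (hy : y ∈ e.target) : (metricMatrix e y).PosDef := by
  refine Matrix.PosDef.of_dotProduct_mulVec_pos ?_ fun v hv => ?_
  · ext i j
    exact real_inner_comm (F := TangentSpace 𝓘(ℝ, EuclideanSpace ℝ (Fin n)) (e.symm y)) _ _
  · have h1 := bilinOfMatrix_eq_dotProduct (metricMatrix e y) (WithLp.toLp 2 v) (WithLp.toLp 2 v)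
    rw [bilinOfMatrix_metricMatrix] at h1
    simp only [star_trivial]
    rw [← h1]
    have h2 : chartDeriv e y (WithLp.toLp 2 v) ≠ 0 := by
      intro h0
      rw [← map_zero (chartDeriv e y)] at h0
      apply hv
      have := chartDeriv_injective he hy h0
      simpa using congrArg WithLp.ofLp this
    exact real_inner_self_pos (F := TangentSpace 𝓘(ℝ, EuclideanSpace ℝ (Fin n)) (e.symm y)).2 h2

variable [IsContMDiffRiemannianBundle 𝓘(ℝ, EuclideanSpace ℝ (Fin n)) ∞ (EuclideanSpace ℝ (Fin n))
    (fun x : M => TangentSpace 𝓘(ℝ, EuclideanSpace ℝ (Fin n)) x)]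

lemma contDiffOn_metricMatrix (he : e ∈ atlas (EuclideanSpace ℝ (Fin n)) M) (i j : Fin n) :
    ContDiffOn ℝ ∞ (fun y => metricMatrix e y i j) e.target := by
  have h1 : ContMDiffOn 𝓘(ℝ, EuclideanSpace ℝ (Fin n)) 𝓘(ℝ, EuclideanSpace ℝ (Fin n)) ∞ e.symm
      e.target := contMDiffOn_symm_of_mem_maximalAtlas (IsManifold.subset_maximalAtlas he)
  have h2 := h1.contMDiffOn_tangentMapWithin (m := ∞) (by simp)
    e.open_target.uniqueMDiffOn
  have h3 (i : Fin n) : ContMDiffOn 𝓘(ℝ, EuclideanSpace ℝ (Fin n))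
      (𝓘(ℝ, EuclideanSpace ℝ (Fin n)).prod 𝓘(ℝ, EuclideanSpace ℝ (Fin n))) ∞
      (fun y => (⟨e.symm y, coordVector e y i⟩ :
        TotalSpace (EuclideanSpace ℝ (Fin n))
          (fun x : M => TangentSpace 𝓘(ℝ, EuclideanSpace ℝ (Fin n)) x))) e.target := by
    have h4 := (contMDiff_vectorSpace_iff_contDiff (𝕜 := ℝ) (n := ∞)
      (V := fun y : EuclideanSpace ℝ (Fin n) => (EuclideanSpace.single i (1 : ℝ) :
        TangentSpace 𝓘(ℝ, EuclideanSpace ℝ (Fin n)) y))).2 contDiff_const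
    have h6 := h2.comp (h4.contMDiffOn (s := e.target)) (fun y hy => hy)
    refine h6.congr fun y hy => ?_
    simp only [Function.comp_apply, tangentMapWithin, coordVector]
    rw [mfderivWithin_of_isOpen e.open_target hy]
  have h7 := (h3 i).inner_bundle (h3 j)
  exact contMDiffOn_iff_contDiffOn.1 h7

lemma isMetricAt_metricMatrix (he : e ∈ atlas (EuclideanSpace ℝ (Fin n)) M)
    {y : EuclideanSpace ℝ (Fin n)} (hy : y ∈ e.target) : IsMetricAt (metricMatrix e) y where
  contDiffAt i j := ((contDiffOn_metricMatrix he i j).contDiffAt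
    (e.open_target.mem_nhds hy)).of_le 
    (WithTop.coe_le_coe.2 le_top : ((2 : ℕ∞) : ℕ∞ω) ≤ ((⊤ : ℕ∞) : ℕ∞ω))
  posDef := (e.open_target.eventually_mem hy).mono fun _ hz => posDef_metricMatrix he hz

lemma isIsometryAt_transition (he : e ∈ atlas (EuclideanSpace ℝ (Fin n)) M)
    (he' : e' ∈ atlas (EuclideanSpace ℝ (Fin n)) M) {y : EuclideanSpace ℝ (Fin n)}
    (hy : y ∈ e.target) (hy' : e.symm y ∈ e'.source) :
    IsIsometryAt (fun z => e' (e.symm z)) (metricMatrix e) (metricMatrix e') y where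
  contDiffAt := contDiffAt_transition (k := 2) he he' hy hy'
  source := isMetricAt_metricMatrix he hy
  target := isMetricAt_metricMatrix he' (e'.map_source hy')
  eventually_eq := by
    filter_upwards [eventually_overlap hy hy'] with z hz
    ext i j
    rw [metricMatrix_apply, chartDeriv_eq_comp he he' hz.1 hz.2,
      chartDeriv_eq_comp he he' hz.1 hz.2]
    have h := bilinOfMatrix_metricMatrix (e := e') (e' (e.symm z))
      (fderiv ℝ (fun z => e' (e.symm z)) z (EuclideanSpace.single i 1))
      (fderiv ℝ (fun z => e' (e.symm z)) z (EuclideanSpace.single j 1))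
    rw [e'.left_inv hz.2] at h
    rw [← h, bilinOfMatrix_apply]
    simp only [Matrix.mul_apply, Matrix.transpose_apply, Finset.sum_mul, jacobian, Matrix.of_apply]
    rw [Finset.sum_comm]
    exact Finset.sum_congr rfl fun a _ => Finset.sum_congr rfl fun b _ => by ring

end Charts

/-! ### The Riemannian volume -/

section Volume

variable {M : Type*} [TopologicalSpace M] [ChartedSpace (EuclideanSpace ℝ (Fin n)) M]
  [RiemannianBundle (fun x : M => TangentSpace 𝓘(ℝ, EuclideanSpace ℝ (Fin n)) x)]
  [MeasurableSpace M] [BorelSpace M]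
  {e e' : OpenPartialHomeomorph M (EuclideanSpace ℝ (Fin n))}

/-- The measure `√(det g_ij) dy` on the image of a chart. -/
noncomputable def coordVolume (e : OpenPartialHomeomorph M (EuclideanSpace ℝ (Fin n))) :
    Measure (EuclideanSpace ℝ (Fin n)) :=
  (volume.restrict e.target).withDensity
    (fun y => ENNReal.ofReal (Real.sqrt (metricMatrix e y).det))

lemma aemeasurable_symm : AEMeasurable e.symm (coordVolume e) :=
  (e.symm.continuousOn.aemeasurable e.open_target.measurableSet).mono_ac
    (withDensity_absolutelyContinuous _ _)

lemma chartVolume_eq : chartVolume e = (coordVolume e).map e.symm := rfl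

lemma ae_coordVolume_mem_target : ∀ᵐ y ∂coordVolume e, y ∈ e.target :=
  (withDensity_absolutelyContinuous _ _).ae_le (ae_restrict_mem e.open_target.measurableSet)

lemma measurableSet_coord {A : Set M} (hA : MeasurableSet A) :
    MeasurableSet (e.target ∩ e.symm ⁻¹' A) := by
  have h := MeasurableSet.subtype_image e.open_target.measurableSet
    (e.continuousOn_symm.domRestrict.measurable hA)
  convert h using 1
  ext y
  simp [and_comm]

lemma chartVolume_apply {A : Set M} (hA : MeasurableSet A) :
    chartVolume e A = ∫⁻ y in e.target ∩ e.symm ⁻¹' A,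
      ENNReal.ofReal (Real.sqrt (metricMatrix e y).det) := by
  rw [chartVolume_eq, Measure.map_apply_of_aemeasurable aemeasurable_symm hA, coordVolume,
    withDensity_apply', Measure.restrict_restrict' e.open_target.measurableSet, Set.inter_comm]

lemma ae_chartVolume_mem_source : ∀ᵐ x ∂chartVolume e, x ∈ e.source := by
  have h : MeasurableSet {x | x ∈ e.source} := e.open_source.measurableSet
  rw [chartVolume_eq, ae_map_iff aemeasurable_symm h]
  exact ae_coordVolume_mem_target.mono fun y hy => e.map_target hy

lemma aemeasurable_chart : AEMeasurable e (chartVolume e) := by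
  have h : (chartVolume e).restrict e.source = chartVolume e :=
    Measure.restrict_eq_self_of_ae_mem ae_chartVolume_mem_source
  rw [← h]
  exact e.continuousOn.aemeasurable e.open_source.measurableSet

lemma map_chartVolume : (chartVolume e).map e = coordVolume e := by
  have h := aemeasurable_chart (e := e)
  rw [chartVolume_eq] at h ⊢
  rw [AEMeasurable.map_map_of_aemeasurable h aemeasurable_symm]
  conv_rhs => rw [← Measure.map_id (μ := coordVolume e)]
  exact Measure.map_congr (ae_coordVolume_mem_target.mono fun y hy => e.right_inv hy)

lemma ae_chartVolume {P : M → Prop} (h : ∀ᵐ y ∂coordVolume e, P (e.symm y)) :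
    ∀ᵐ x ∂chartVolume e, P x := by
  rw [← map_chartVolume] at h
  filter_upwards [ae_of_ae_map aemeasurable_chart h, ae_chartVolume_mem_source] with x hx hxs
  rwa [e.left_inv hxs] at hx

variable [IsManifold 𝓘(ℝ, EuclideanSpace ℝ (Fin n)) ∞ M]
  [IsContMDiffRiemannianBundle 𝓘(ℝ, EuclideanSpace ℝ (Fin n)) ∞ (EuclideanSpace ℝ (Fin n))
    (fun x : M => TangentSpace 𝓘(ℝ, EuclideanSpace ℝ (Fin n)) x)]

lemma det_fderiv_eq_det_jacobian (τ : EuclideanSpace ℝ (Fin n) → EuclideanSpace ℝ (Fin n))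
    (y : EuclideanSpace ℝ (Fin n)) : (fderiv ℝ τ y).det = (jacobian τ y).det := by
  have h : jacobian τ y = LinearMap.toMatrix (EuclideanSpace.basisFun (Fin n) ℝ).toBasis
      (EuclideanSpace.basisFun (Fin n) ℝ).toBasis (fderiv ℝ τ y : _ →ₗ[ℝ] _) := by
    ext i j
    simp [LinearMap.toMatrix_apply, jacobian]
  rw [h, LinearMap.det_toMatrix]

lemma IsIsometryAt.abs_det_mul_sqrt_det
    {τ : EuclideanSpace ℝ (Fin n) → EuclideanSpace ℝ (Fin n)}
    {G G' : EuclideanSpace ℝ (Fin n) → Matrix (Fin n) (Fin n) ℝ} {y : EuclideanSpace ℝ (Fin n)}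
    (hτ : IsIsometryAt τ G G' y) :
    √(G y).det = |(fderiv ℝ τ y).det| * √(G' (τ y)).det := by
  rw [det_fderiv_eq_det_jacobian, hτ.metric_eq, Matrix.det_mul, Matrix.det_mul,
    Matrix.det_transpose, ← Real.sqrt_sq_eq_abs, ← Real.sqrt_mul (sq_nonneg _)]
  congr 1
  ring

/-- On the overlap of two charts their volume measures agree, by the change of variables formula. -/
lemma chartVolume_eq_of_subset (he : e ∈ atlas (EuclideanSpace ℝ (Fin n)) M)
    (he' : e' ∈ atlas (EuclideanSpace ℝ (Fin n)) M) {A : Set M} (hA : MeasurableSet A)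
    (hAe : A ⊆ e.source) (hAe' : A ⊆ e'.source) : chartVolume e A = chartVolume e' A := by
  rw [chartVolume_apply hA, chartVolume_apply hA]
  have himg : e'.target ∩ e'.symm ⁻¹' A
      = (fun z => e' (e.symm z)) '' (e.target ∩ e.symm ⁻¹' A) := by
    ext z
    constructor
    · rintro ⟨hz, hzA⟩
      refine ⟨e (e'.symm z), ⟨e.map_source (hAe hzA), ?_⟩, ?_⟩
      · simpa [e.left_inv (hAe hzA)] using hzA
      · simp [e.left_inv (hAe hzA), e'.right_inv hz]
    · rintro ⟨y, ⟨hy, hyA⟩, rfl⟩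
      refine ⟨e'.map_source (hAe' hyA), ?_⟩
      simpa [e'.left_inv (hAe' hyA)] using hyA
  rw [himg, lintegral_image_eq_lintegral_abs_det_fderiv_mul volume (measurableSet_coord hA)
    (f' := fun y => fderiv ℝ (fun z => e' (e.symm z)) y)]
  · refine setLIntegral_congr_fun (measurableSet_coord hA) fun y hy => ?_
    have hτ := isIsometryAt_transition he he' hy.1 (hAe' hy.2)
    rw [hτ.abs_det_mul_sqrt_det, ENNReal.ofReal_mul (abs_nonneg _)]
  · intro y hy
    exact (isIsometryAt_transition he he' hy.1
      (hAe' hy.2)).differentiableAt.hasFDerivAt.hasFDerivWithinAt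
  · intro y hy z hz hyz
    have h1 := e'.injOn (hAe' hy.2) (hAe' hz.2) hyz
    exact e.symm.injOn hy.1 hz.1 h1

lemma chartVolume_le_riemannianVolume (he : e ∈ atlas (EuclideanSpace ℝ (Fin n)) M) :
    chartVolume e ≤ riemannianVolume n M :=
  le_iSup₂ (f := fun (e : OpenPartialHomeomorph M (EuclideanSpace ℝ (Fin n)))
    (_ : e ∈ atlas (EuclideanSpace ℝ (Fin n)) M) => chartVolume e) e he

/-- In the domain of a chart the Riemannian volume is `√(det g_ij) dy`. By the agreement on overlaps,
`chartVolume e + dvol|_{M \ dom e}` bounds the volume measures of all charts, hence also their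
supremum. -/
lemma restrict_riemannianVolume (he : e ∈ atlas (EuclideanSpace ℝ (Fin n)) M) :
    (riemannianVolume n M).restrict e.source = chartVolume e := by
  have hs := e.open_source.measurableSet
  have h : (chartVolume e).restrict e.source = chartVolume e :=
    Measure.restrict_eq_self_of_ae_mem ae_chartVolume_mem_source
  refine le_antisymm ?_ ?_
  · have h1 : riemannianVolume n M
        ≤ chartVolume e + (riemannianVolume n M).restrict e.sourceᶜ := by
      refine iSup₂_le fun e' he' => Measure.le_iff.2 fun A hA => ?_
      rw [← measure_inter_add_sdiff A hs, Measure.add_apply]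
      refine add_le_add ?_ ?_
      · have h2 : chartVolume e' (A ∩ e.source) = chartVolume e' (A ∩ e.source ∩ e'.source) := by
          refine (measure_inter_conull' ?_).symm
          exact measure_mono_null (fun x hx => hx.2) (ae_iff.1 ae_chartVolume_mem_source)
        rw [h2, chartVolume_eq_of_subset he' he ((hA.inter hs).inter e'.open_source.measurableSet)
          Set.inter_subset_right (fun x hx => hx.1.2)]
        exact measure_mono fun x hx => hx.1.1
      · rw [Measure.restrict_apply hA, Set.sdiff_eq]
        exact chartVolume_le_riemannianVolume he' _
    calc (riemannianVolume n M).restrict e.source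
        ≤ (chartVolume e + (riemannianVolume n M).restrict e.sourceᶜ).restrict e.source :=
          Measure.restrict_mono le_rfl h1
      _ = chartVolume e := by
          rw [Measure.restrict_add, h, Measure.restrict_restrict hs, Set.inter_compl_self]
          simp
  · rw [← h]
    exact Measure.restrict_mono le_rfl (chartVolume_le_riemannianVolume he)

/-- A property that holds almost everywhere in coordinates near every point of `U` holds almost
everywhere in `U`. -/
lemma ae_riemannianVolume_of_forall_chart [SecondCountableTopology M] {U : Set M} {P : M → Prop}
    (h : ∀ x ∈ U, ∃ V ∈ 𝓝 (chartAt (EuclideanSpace ℝ (Fin n)) x x),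
      ∀ᵐ y, y ∈ V → P ((chartAt (EuclideanSpace ℝ (Fin n)) x).symm y)) :
    ∀ᵐ x ∂riemannianVolume n M, x ∈ U → P x := by
  rw [ae_iff]
  refine measure_null_of_locally_null _ fun x hx => ?_
  rw [Set.mem_ofPred_eq, Classical.not_imp] at hx
  obtain ⟨V, hV, hVP⟩ := h x hx.1
  set e := chartAt (EuclideanSpace ℝ (Fin n)) x
  have he : e ∈ atlas (EuclideanSpace ℝ (Fin n)) M := chart_mem_atlas _ x
  have hxs : x ∈ e.source := mem_chart_source _ x
  have h1 : ∀ᵐ z ∂chartVolume e, e z ∈ V → P z := by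
    refine ae_chartVolume ?_
    have h2 : ∀ᵐ y ∂coordVolume e, y ∈ V → P (e.symm y) :=
      (((withDensity_absolutelyContinuous _ _).trans
        Measure.restrict_le_self.absolutelyContinuous).ae_le hVP)
    filter_upwards [h2, ae_coordVolume_mem_target] with y hy hyt hyV
    rw [e.right_inv hyt] at hyV
    exact hy hyV
  rw [← restrict_riemannianVolume he, ae_restrict_iff' e.open_source.measurableSet, ae_iff] at h1
  refine ⟨{z | ¬ (z ∈ U → P z)} ∩ (e.source ∩ e ⁻¹' V),
    inter_mem_nhdsWithin _ (Filter.inter_mem (e.open_source.mem_nhds hxs)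
      ((e.continuousAt hxs).preimage_mem_nhds hV)), ?_⟩
  refine measure_mono_null ?_ h1
  rintro z ⟨hz, hz1, hz2⟩
  rw [Set.mem_ofPred_eq, Classical.not_imp] at hz
  exact fun h => hz.2 (h hz1 hz2)

/-- The integral of a function supported in the domain of a chart, in coordinates. -/
lemma integral_riemannianVolume_eq (he : e ∈ atlas (EuclideanSpace ℝ (Fin n)) M) {f : M → ℝ}
    {h : EuclideanSpace ℝ (Fin n) → ℝ} (hf : ∀ x ∉ e.source, f x = 0)
    (hfh : ∀ᵐ y, y ∈ e.target → f (e.symm y) = h y) (h0 : ∀ y ∉ e.target, h y = 0)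
    (hi : Integrable fun y => √(metricMatrix e y).det * h y) :
    Integrable f (riemannianVolume n M) ∧
      ∫ x, f x ∂riemannianVolume n M = ∫ y, √(metricMatrix e y).det * h y := by
  have hs := e.open_source.measurableSet
  have hm : AEMeasurable (fun y => ENNReal.ofReal (Real.sqrt (metricMatrix e y).det))
      (volume.restrict e.target) := by
    refine AEMeasurable.ennreal_ofReal (ContinuousOn.aemeasurable ?_ e.open_target.measurableSet)
    refine ContinuousOn.sqrt ?_
    intro y hy
    exact (contDiffAt_det fun i j =>
      (isMetricAt_metricMatrix he hy).contDiffAt i j).continuousAt.continuousWithinAt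
  have hlt : ∀ᵐ y ∂volume.restrict e.target,
      ENNReal.ofReal (Real.sqrt (metricMatrix e y).det) < ⊤ :=
    ae_of_all _ fun y => ENNReal.ofReal_lt_top
  have hsm (y) : (ENNReal.ofReal (Real.sqrt (metricMatrix e y).det)).toReal • h y
      = √(metricMatrix e y).det * h y := by
    rw [ENNReal.toReal_ofReal (Real.sqrt_nonneg _), smul_eq_mul]
  have hih : Integrable h (coordVolume e) := by
    rw [coordVolume, integrable_withDensity_iff_integrable_smul₀' hm hlt]
    simp only [hsm]
    exact hi.integrableOn
  have hint : ∫ y, h y ∂coordVolume e = ∫ y, √(metricMatrix e y).det * h y := by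
    rw [coordVolume, integral_withDensity_eq_integral_toReal_smul₀ hm hlt]
    simp only [hsm]
    exact setIntegral_eq_integral_of_forall_compl_eq_zero fun y hy => by rw [h0 y hy, mul_zero]
  have hae : f =ᵐ[chartVolume e] h ∘ e := by
    refine ae_chartVolume ?_
    have h2 : ∀ᵐ y ∂coordVolume e, y ∈ e.target → f (e.symm y) = h y :=
      (((withDensity_absolutelyContinuous _ _).trans
        Measure.restrict_le_self.absolutelyContinuous).ae_le hfh)
    filter_upwards [h2, ae_coordVolume_mem_target] with y hy hyt
    rw [hy hyt, Function.comp_apply, e.right_inv hyt]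
  rw [← map_chartVolume] at hih hint
  have hif : Integrable f (chartVolume e) :=
    (hih.comp_aemeasurable aemeasurable_chart).congr hae.symm
  have hindic : e.source.indicator f = f :=
    Set.indicator_eq_self.2 fun x hx => by_contra fun hxs => hx (hf x hxs)
  rw [integral_map aemeasurable_chart hih.aestronglyMeasurable] at hint
  rw [← restrict_riemannianVolume he] at hif hae hint
  refine ⟨hindic ▸ (integrable_indicator_iff hs).2 hif, ?_⟩
  have hint' := (integral_congr_ae hae).trans hint
  rw [← hint']
  exact (setIntegral_eq_integral_of_forall_compl_eq_zero hf).symm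

end Volume

/-! ### Lipschitz functions for the Riemannian distance -/

section Distance

variable {M : Type*} [MetricSpace M] [ChartedSpace (EuclideanSpace ℝ (Fin n)) M]
  [IsManifold 𝓘(ℝ, EuclideanSpace ℝ (Fin n)) ∞ M]
  [RiemannianBundle (fun x : M => TangentSpace 𝓘(ℝ, EuclideanSpace ℝ (Fin n)) x)]
  [IsContMDiffRiemannianBundle 𝓘(ℝ, EuclideanSpace ℝ (Fin n)) ∞ (EuclideanSpace ℝ (Fin n))
    (fun x : M => TangentSpace 𝓘(ℝ, EuclideanSpace ℝ (Fin n)) x)]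
  [IsRiemannianManifold 𝓘(ℝ, EuclideanSpace ℝ (Fin n)) M]
  {e e' : OpenPartialHomeomorph M (EuclideanSpace ℝ (Fin n))}

/-- The distance of the end points of a coordinate segment is at most its length. -/
lemma dist_symm_le_of_segment (he : e ∈ atlas (EuclideanSpace ℝ (Fin n)) M)
    {z v : EuclideanSpace ℝ (Fin n)} {c : ℝ}
    (hseg : ∀ t ∈ Set.Icc (0 : ℝ) 1, z + t • v ∈ e.target)
    (hc : ∀ t ∈ Set.Icc (0 : ℝ) 1, √(bilinOfMatrix (metricMatrix e (z + t • v)) v v) ≤ c) :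
    dist (e.symm z) (e.symm (z + v)) ≤ c := by
  have hc0 : 0 ≤ c := (Real.sqrt_nonneg _).trans (hc 0 (by simp))
  set η : ℝ → EuclideanSpace ℝ (Fin n) := fun t => z + t • v with hη
  have hηs : ContDiff ℝ 1 η := by fun_prop
  have hηd (t : ℝ) : HasFDerivAt η ((ContinuousLinearMap.id ℝ ℝ).smulRight v) t :=
    ((hasFDerivAt_id (𝕜 := ℝ) t).smul_const v).const_add z
  have hsymm : ContMDiffOn 𝓘(ℝ, EuclideanSpace ℝ (Fin n)) 𝓘(ℝ, EuclideanSpace ℝ (Fin n)) 1 e.symm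
      e.target :=
    (contMDiffOn_symm_of_mem_maximalAtlas (I := 𝓘(ℝ, EuclideanSpace ℝ (Fin n))) (n := ∞)
      (IsManifold.subset_maximalAtlas he)).of_le (by norm_num)
  have h1 : Manifold.riemannianEDist 𝓘(ℝ, EuclideanSpace ℝ (Fin n)) (e.symm z) (e.symm (z + v))
      ≤ Manifold.pathELength 𝓘(ℝ, EuclideanSpace ℝ (Fin n)) (e.symm ∘ η) 0 1 := by
    apply Manifold.riemannianEDist_le_pathELength _ _ _ zero_le_one
    · exact hsymm.comp (contMDiff_iff_contDiff.2 hηs).contMDiffOn hseg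
    · simp [hη]
    · simp [hη]
  have h2 : Manifold.pathELength 𝓘(ℝ, EuclideanSpace ℝ (Fin n)) (e.symm ∘ η) 0 1
      ≤ ENNReal.ofReal c := by
    rw [Manifold.pathELength_eq_lintegral_mfderiv_Icc]
    calc _ ≤ ∫⁻ t in Set.Icc (0 : ℝ) 1, ENNReal.ofReal c := by
          refine setLIntegral_mono' measurableSet_Icc fun t ht => ?_
          have h3 : MDifferentiableAt 𝓘(ℝ, EuclideanSpace ℝ (Fin n))
              𝓘(ℝ, EuclideanSpace ℝ (Fin n)) e.symm (η t) :=
            mdifferentiableAt_atlas_symm he (hseg t ht)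
          have h4 := mfderiv_comp (I := 𝓘(ℝ, ℝ)) t h3
            (hηd t).differentiableAt.mdifferentiableAt
          have h5 : (mfderiv 𝓘(ℝ, ℝ) 𝓘(ℝ, EuclideanSpace ℝ (Fin n)) (e.symm ∘ η) t) (1 : ℝ)
              = chartDeriv e (η t) v := by
            rw [h4, mfderiv_eq_fderiv, (hηd t).fderiv]
            change chartDeriv e (η t) ((1 : ℝ) • v) = _
            rw [one_smul]
          have h6 : ‖(mfderiv 𝓘(ℝ, ℝ) 𝓘(ℝ, EuclideanSpace ℝ (Fin n)) (e.symm ∘ η) t) (1 : ℝ)‖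
              = √(bilinOfMatrix (metricMatrix e (z + t • v)) v v) := by
            rw [bilinOfMatrix_metricMatrix, h5]
            exact norm_eq_sqrt_real_inner
              (F := TangentSpace 𝓘(ℝ, EuclideanSpace ℝ (Fin n)) (e.symm (η t))) _
          rw [← ofReal_norm]
          exact ENNReal.ofReal_le_ofReal (h6.le.trans (hc t ht))
      _ = ENNReal.ofReal c := by simp
  have h7 := IsRiemannianManifold.out (I := 𝓘(ℝ, EuclideanSpace ℝ (Fin n))) (e.symm z)
    (e.symm (z + v))
  rw [← h7, edist_dist] at h1
  exact (ENNReal.ofReal_le_ofReal_iff hc0).1 (h1.trans h2)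

/-- The inverse of a chart is locally Lipschitz. -/
lemma lipAt_chart_symm (he : e ∈ atlas (EuclideanSpace ℝ (Fin n)) M)
    {y : EuclideanSpace ℝ (Fin n)} (hy : y ∈ e.target) : LipAt e.symm y := by
  have hB : ContinuousAt (fun z => ‖bilinOfMatrix (metricMatrix e z)‖) y :=
    (isMetricAt_metricMatrix he hy).hasFDerivAt_bilinOfMatrix.continuousAt.norm
  set K := ‖bilinOfMatrix (metricMatrix e y)‖ + 1
  have hK : 0 ≤ K := by positivity
  have h1 : ∀ᶠ z in 𝓝 y, z ∈ e.target ∧ ‖bilinOfMatrix (metricMatrix e z)‖ < K :=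
    (e.open_target.eventually_mem hy).and (hB.eventually_lt_const (lt_add_one _))
  obtain ⟨r, hr, hball⟩ := Metric.eventually_nhds_iff_ball.1 h1
  refine ⟨(√K).toNNReal, Metric.ball y r, Metric.ball_mem_nhds y hr,
    LipschitzOnWith.of_dist_le_mul fun z hz w hw => ?_⟩
  have hseg (t : ℝ) (ht : t ∈ Set.Icc (0 : ℝ) 1) : z + t • (w - z) ∈ Metric.ball y r :=
    (convex_ball y r).add_smul_sub_mem hz hw ht
  have h2 := dist_symm_le_of_segment he (z := z) (v := w - z) (c := √K * ‖w - z‖)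
    (fun t ht => (hball _ (hseg t ht)).1) (fun t ht => by
      rw [← Real.sqrt_sq (norm_nonneg (w - z)), ← Real.sqrt_mul hK]
      refine Real.sqrt_le_sqrt ?_
      calc _ ≤ ‖bilinOfMatrix (metricMatrix e (z + t • (w - z))) (w - z) (w - z)‖ :=
            Real.le_norm_self _
        _ ≤ ‖bilinOfMatrix (metricMatrix e (z + t • (w - z)))‖ * ‖w - z‖ * ‖w - z‖ :=
            ContinuousLinearMap.le_opNorm₂ _ _ _
        _ ≤ K * ‖w - z‖ ^ 2 := by
            rw [sq, ← mul_assoc]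
            gcongr
            exact (hball _ (hseg t ht)).2.le)
  rw [add_sub_cancel, ← dist_eq_norm, dist_comm w z] at h2
  rwa [Real.coe_toNNReal _ (Real.sqrt_nonneg K)]

/-- The derivative of a function that is Lipschitz with constant `L` near a point has norm at most
`L`: over short coordinate segments the distance is at most the length, up to a factor close
to `1`. -/
lemma abs_fderiv_le_of_lipschitz (he : e ∈ atlas (EuclideanSpace ℝ (Fin n)) M)
    {y : EuclideanSpace ℝ (Fin n)} (hy : y ∈ e.target) {f : M → ℝ} {L : ℝ} (hL0 : 0 ≤ L)
    (hL : ∀ᶠ x in 𝓝 (e.symm y), |f x - f (e.symm y)| ≤ L * dist (e.symm y) x)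
    (hf : DifferentiableAt ℝ (fun z => f (e.symm z)) y) (v : EuclideanSpace ℝ (Fin n)) :
    |fderiv ℝ (fun z => f (e.symm z)) y v| ≤ L * √(bilinOfMatrix (metricMatrix e y) v v) := by
  have hB : ContinuousAt (fun z => √(bilinOfMatrix (metricMatrix e z) v v)) y :=
    Real.continuous_sqrt.continuousAt.comp
      (((isMetricAt_metricMatrix he hy).hasFDerivAt_bilinOfMatrix.continuousAt.clm_apply
        continuousAt_const).clm_apply continuousAt_const)
  have hc : ∀ c, √(bilinOfMatrix (metricMatrix e y) v v) < c →
      |fderiv ℝ (fun z => f (e.symm z)) y v| ≤ L * c := by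
    intro c hc
    have h1 : ∀ᶠ z in 𝓝 y, z ∈ e.target ∧ √(bilinOfMatrix (metricMatrix e z) v v) < c :=
      (e.open_target.eventually_mem hy).and (hB.eventually_lt_const hc)
    obtain ⟨r, hr, hball⟩ := Metric.eventually_nhds_iff_ball.1 h1
    have hline : HasDerivAt (fun t : ℝ => f (e.symm (y + t • v)))
        (fderiv ℝ (fun z => f (e.symm z)) y v) 0 := by
      have h2 : HasDerivAt (fun t : ℝ => y + t • v) v 0 := by
        simpa using ((hasDerivAt_id (0 : ℝ)).smul_const v).const_add y
      have h3 : HasFDerivAt (fun z => f (e.symm z)) (fderiv ℝ (fun z => f (e.symm z)) y)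
          (y + (0 : ℝ) • v) := by simpa using hf.hasFDerivAt
      exact h3.comp_hasDerivAt (0 : ℝ) h2
    have h4 := (hasDerivAt_iff_tendsto_slope.1 hline).mono_left
      (nhdsWithin_mono (0 : ℝ) (fun t (ht : t ∈ Set.Ioi (0 : ℝ)) => (ne_of_gt ht)))
    refine le_of_tendsto h4.abs ?_
    have hcont : ContinuousAt (fun t : ℝ => y + t • v) 0 := by fun_prop
    have h5 : ∀ᶠ t : ℝ in 𝓝 0, y + t • v ∈ Metric.ball y r := by
      refine hcont.eventually_mem ?_
      simpa using Metric.ball_mem_nhds y hr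
    have h6 : ∀ᶠ t : ℝ in 𝓝 0, |f (e.symm (y + t • v)) - f (e.symm y)|
        ≤ L * dist (e.symm y) (e.symm (y + t • v)) := by
      have h7 : ContinuousAt (fun t : ℝ => e.symm (y + t • v)) 0 := by
        refine ContinuousAt.comp (g := e.symm) ?_ hcont
        simpa using e.symm.continuousAt hy
      refine h7.eventually (p := fun x => |f x - f (e.symm y)| ≤ L * dist (e.symm y) x) ?_
      simpa using hL
    filter_upwards [h5.filter_mono nhdsWithin_le_nhds, h6.filter_mono nhdsWithin_le_nhds,
      self_mem_nhdsWithin] with t ht1 ht2 ht0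
    have ht0' : 0 < t := ht0
    have h8 := dist_symm_le_of_segment he (z := y) (v := t • v) (c := t * c)
      (fun s hs => (hball _ ((convex_ball y r).add_smul_mem (Metric.mem_ball_self hr) ht1 hs)).1)
      (fun s hs => by
        have h9 := (hball _ ((convex_ball y r).add_smul_mem (Metric.mem_ball_self hr) ht1 hs)).2
        simp only [map_smul, _root_.smul_apply, smul_eq_mul]
        rw [← mul_assoc, ← sq, Real.sqrt_mul (sq_nonneg t), Real.sqrt_sq ht0'.le]
        exact mul_le_mul_of_nonneg_left h9.le ht0'.le)
    rw [slope_def_field, sub_zero, abs_div, abs_of_pos ht0', div_le_iff₀ ht0']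
    simp only [zero_smul, add_zero]
    calc _ ≤ L * dist (e.symm y) (e.symm (y + t • v)) := ht2
      _ ≤ L * (t * c) := by gcongr
      _ = L * c * t := by ring
  have hlim : Tendsto (fun c => L * c) (𝓝[>] √(bilinOfMatrix (metricMatrix e y) v v))
      (𝓝 (L * √(bilinOfMatrix (metricMatrix e y) v v))) :=
    ((continuous_const.mul continuous_id).tendsto _).mono_left nhdsWithin_le_nhds
  exact ge_of_tendsto hlim (eventually_mem_nhdsWithin.mono hc)

/-- A function with local Lipschitz constant `L` pairs with the gradient of `h` to at most
`L |∇h|`. -/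
lemma abs_gradInner_le_of_lipschitz (he : e ∈ atlas (EuclideanSpace ℝ (Fin n)) M)
    {y : EuclideanSpace ℝ (Fin n)} (hy : y ∈ e.target) {f : M → ℝ} {L : ℝ} (hL0 : 0 ≤ L)
    (hL : ∀ᶠ x in 𝓝 (e.symm y), |f x - f (e.symm y)| ≤ L * dist (e.symm y) x)
    (hf : DifferentiableAt ℝ (fun z => f (e.symm z)) y) (h : EuclideanSpace ℝ (Fin n) → ℝ) :
    |gradInner (metricMatrix e) (fun z => f (e.symm z)) h y|
      ≤ L * √(gradInner (metricMatrix e) h h y) := by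
  have hG := isMetricAt_metricMatrix he hy
  have h1 (f : EuclideanSpace ℝ (Fin n) → ℝ) :
      fderiv ℝ f y (gradField (metricMatrix e) h y) = gradInner (metricMatrix e) f h y := by
    rw [fderiv_apply_eq_sum, gradInner_eq_sum]
    exact Finset.sum_congr rfl fun i _ => by simp [gradField, mul_comm]
  have h2 := abs_fderiv_le_of_lipschitz he hy hL0 hL hf (gradField (metricMatrix e) h y)
  rwa [hG.bilinOfMatrix_gradient, h1, h1] at h2

end Distance

/-! ### Gradients and divergences on the manifold -/

section Coordinates

lemma LipAt.clm_comp {X E₁ E₂ E₃ : Type*} [PseudoMetricSpace X] [NormedAddCommGroup E₁]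
    [NormedSpace ℝ E₁] [NormedAddCommGroup E₂] [NormedSpace ℝ E₂] [NormedAddCommGroup E₃]
    [NormedSpace ℝ E₃] {f : X → E₂ →L[ℝ] E₃} {g : X → E₁ →L[ℝ] E₂} {x : X} (hf : LipAt f x)
    (hg : LipAt g x) : LipAt (fun z => (f z).comp (g z)) x := by
  have h : ContDiff ℝ 1 fun q : (E₂ →L[ℝ] E₃) × (E₁ →L[ℝ] E₂) => q.1.comp q.2 :=
    contDiff_fst.clm_comp contDiff_snd
  have h' : LipAt (fun q : (E₂ →L[ℝ] E₃) × (E₁ →L[ℝ] E₂) => q.1.comp q.2) (f x, g x) :=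
    h.contDiffAt.lipAt
  exact LipAt.comp (f := fun q : (E₂ →L[ℝ] E₃) × (E₁ →L[ℝ] E₂) => q.1.comp q.2)
    (g := fun z => (f z, g z)) h' (hf.prodMk hg)

lemma IsC11At.comp {f : EuclideanSpace ℝ (Fin n) → ℝ}
    {τ : EuclideanSpace ℝ (Fin n) → EuclideanSpace ℝ (Fin n)} {y : EuclideanSpace ℝ (Fin n)}
    (hf : IsC11At f (τ y)) (hτ : ContDiffAt ℝ 2 τ y) : IsC11At (f ∘ τ) y := by
  have hτ1 : ∀ᶠ z in 𝓝 y, DifferentiableAt ℝ τ z :=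
    (hτ.eventually (by simp)).mono fun z hz => hz.differentiableAt (by norm_num)
  have hf1 := hτ.continuousAt.eventually hf.eventually_differentiableAt
  refine ⟨?_, ?_⟩
  · filter_upwards [hτ1, hf1] with z h1 h2
    exact h2.comp z h1
  · have h1 : LipAt (fun z => fderiv ℝ f (τ z)) y :=
      hf.lipAt_fderiv.comp (hτ.of_le (by norm_num)).lipAt
    have h2 : LipAt (fderiv ℝ τ) y := (hτ.fderiv_right (m := 1) (by norm_num)).lipAt
    have h3 : LipAt (fun z => (fderiv ℝ f (τ z)).comp (fderiv ℝ τ z)) y := h1.clm_comp h2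
    refine h3.congr ?_
    filter_upwards [hτ1, hf1] with z h4 h5
    exact (fderiv_comp z h5 h4).symm

lemma IsC11At.congr {f g : EuclideanSpace ℝ (Fin n) → ℝ} {y : EuclideanSpace ℝ (Fin n)}
    (hf : IsC11At f y) (h : f =ᶠ[𝓝 y] g) : IsC11At g y := by
  refine ⟨?_, hf.lipAt_fderiv.congr h.fderiv⟩
  filter_upwards [hf.eventually_differentiableAt, h.eventuallyEq_nhds] with z h1 h2
  exact h2.differentiableAt_iff.1 h1

variable {M : Type*} [TopologicalSpace M] [ChartedSpace (EuclideanSpace ℝ (Fin n)) M]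
  {e e' : OpenPartialHomeomorph M (EuclideanSpace ℝ (Fin n))} {x : M} {f h u : M → ℝ}

variable [IsManifold 𝓘(ℝ, EuclideanSpace ℝ (Fin n)) ∞ M]

lemma coord_eventuallyEq (hx : x ∈ e.source) (hx' : x ∈ e'.source) (f : M → ℝ) :
    (fun z => f (e.symm z)) =ᶠ[𝓝 (e x)] (fun z => f (e'.symm z)) ∘ fun z => e' (e.symm z) := by
  filter_upwards [eventually_overlap (e' := e') (e.map_source hx) (by rwa [e.left_inv hx])]
    with z hz
  simp [e'.left_inv hz.2]

lemma contDiffAt_transition_of_mem (he : e ∈ atlas (EuclideanSpace ℝ (Fin n)) M)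
    (he' : e' ∈ atlas (EuclideanSpace ℝ (Fin n)) M) (hx : x ∈ e.source) (hx' : x ∈ e'.source) :
    ContDiffAt ℝ 2 (fun z => e' (e.symm z)) (e x) :=
  contDiffAt_transition (k := 2) he he' (e.map_source hx) (by rwa [e.left_inv hx])

lemma differentiableAt_coord (he : e ∈ atlas (EuclideanSpace ℝ (Fin n)) M)
    (he' : e' ∈ atlas (EuclideanSpace ℝ (Fin n)) M) (hx : x ∈ e.source) (hx' : x ∈ e'.source)
    (hf : DifferentiableAt ℝ (fun z => f (e'.symm z)) (e' x)) :
    DifferentiableAt ℝ (fun z => f (e.symm z)) (e x) := by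
  refine (coord_eventuallyEq hx hx' f).differentiableAt_iff.2 ?_
  refine DifferentiableAt.comp _ (by rwa [e.left_inv hx]) ?_
  exact (contDiffAt_transition_of_mem he he' hx hx').differentiableAt (by norm_num)

lemma isC11At_coord (he : e ∈ atlas (EuclideanSpace ℝ (Fin n)) M)
    (he' : e' ∈ atlas (EuclideanSpace ℝ (Fin n)) M) (hx : x ∈ e.source) (hx' : x ∈ e'.source)
    (hf : IsC11At (fun z => f (e'.symm z)) (e' x)) :
    IsC11At (fun z => f (e.symm z)) (e x) :=
  (IsC11At.comp (by rwa [e.left_inv hx])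
    (contDiffAt_transition_of_mem he he' hx hx')).congr (coord_eventuallyEq hx hx' f).symm

lemma IsC11LocOn.isC11At {U : Set M} (hu : IsC11LocOn n u U)
    (he : e ∈ atlas (EuclideanSpace ℝ (Fin n)) M) (hx : x ∈ e.source) (hxU : x ∈ U) :
    IsC11At (fun z => u (e.symm z)) (e x) := by
  obtain ⟨s, hs, hd, K, hK⟩ := hu x hxU
  refine isC11At_coord he (chart_mem_atlas _ x) hx (mem_chart_source _ x) ⟨?_, K, s, hs, hK⟩
  filter_upwards [hs] with z hz using hd z hz

variable [RiemannianBundle (fun x : M => TangentSpace 𝓘(ℝ, EuclideanSpace ℝ (Fin n)) x)]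
  [IsContMDiffRiemannianBundle 𝓘(ℝ, EuclideanSpace ℝ (Fin n)) ∞ (EuclideanSpace ℝ (Fin n))
    (fun x : M => TangentSpace 𝓘(ℝ, EuclideanSpace ℝ (Fin n)) x)]

lemma isIsometryAt_transition_of_mem (he : e ∈ atlas (EuclideanSpace ℝ (Fin n)) M)
    (he' : e' ∈ atlas (EuclideanSpace ℝ (Fin n)) M) (hx : x ∈ e.source) (hx' : x ∈ e'.source) :
    IsIsometryAt (fun z => e' (e.symm z)) (metricMatrix e) (metricMatrix e') (e x) :=
  isIsometryAt_transition he he' (e.map_source hx) (by rwa [e.left_inv hx])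

lemma isTwiceDiffAt_coord (he : e ∈ atlas (EuclideanSpace ℝ (Fin n)) M)
    (he' : e' ∈ atlas (EuclideanSpace ℝ (Fin n)) M) (hx : x ∈ e.source) (hx' : x ∈ e'.source)
    (hf : IsTwiceDiffAt (fun z => f (e'.symm z)) (e' x)) :
    IsTwiceDiffAt (fun z => f (e.symm z)) (e x) :=
  (isIsometryAt_transition_of_mem he he' hx hx').isTwiceDiffAt (by rwa [e.left_inv hx])
    (coord_eventuallyEq hx hx' f)

lemma gradInner_coord (he : e ∈ atlas (EuclideanSpace ℝ (Fin n)) M)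
    (he' : e' ∈ atlas (EuclideanSpace ℝ (Fin n)) M) (hx : x ∈ e.source) (hx' : x ∈ e'.source)
    (hf : DifferentiableAt ℝ (fun z => f (e'.symm z)) (e' x))
    (hh : DifferentiableAt ℝ (fun z => h (e'.symm z)) (e' x)) :
    gradInner (metricMatrix e) (fun z => f (e.symm z)) (fun z => h (e.symm z)) (e x)
      = gradInner (metricMatrix e') (fun z => f (e'.symm z)) (fun z => h (e'.symm z)) (e' x) := by
  rw [(isIsometryAt_transition_of_mem he he' hx hx').gradInner_eq (by rwa [e.left_inv hx])
    (coord_eventuallyEq hx hx' f) (by rwa [e.left_inv hx]) (coord_eventuallyEq hx hx' h),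
    e.left_inv hx]

lemma gradFlux_coord (he : e ∈ atlas (EuclideanSpace ℝ (Fin n)) M)
    (he' : e' ∈ atlas (EuclideanSpace ℝ (Fin n)) M) (hx : x ∈ e.source) (hx' : x ∈ e'.source)
    (hf : IsTwiceDiffAt (fun z => f (e'.symm z)) (e' x)) (p α : ℝ) :
    gradFlux p α (metricMatrix e) (fun z => f (e.symm z)) (e x)
      = gradFlux p α (metricMatrix e') (fun z => f (e'.symm z)) (e' x) := by
  have hτ := isIsometryAt_transition_of_mem he he' hx hx'
  have hf' : IsTwiceDiffAt (fun z => f (e'.symm z)) (e' (e.symm (e x))) := by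
    rwa [e.left_inv hx]
  simp only [gradFlux]
  rw [hτ.laplacian_eq hf' (coord_eventuallyEq hx hx' f),
    hτ.hessianGrad_eq hf' (coord_eventuallyEq hx hx' f),
    gradInner_coord he he' hx hx' hf.differentiableAt hf.differentiableAt,
    e.left_inv hx, e'.left_inv hx']

end Coordinates

section Manifold

variable {M : Type*} [TopologicalSpace M] [ChartedSpace (EuclideanSpace ℝ (Fin n)) M]
  [RiemannianBundle (fun x : M => TangentSpace 𝓘(ℝ, EuclideanSpace ℝ (Fin n)) x)]
  {e : OpenPartialHomeomorph M (EuclideanSpace ℝ (Fin n))} {x : M} {f h u ζ : M → ℝ} {U : Set M}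
  {p α : ℝ}

variable (n) in
/-- The inner product `⟨∇f, ∇h⟩` of two gradients at a point of the manifold. -/
noncomputable def gradInnerOn (f h : M → ℝ) (x : M) : ℝ :=
  gradInner (metricMatrix (chartAt (EuclideanSpace ℝ (Fin n)) x)) (localRep f x) (localRep h x)
    (chartAt (EuclideanSpace ℝ (Fin n)) x x)

variable (n) in
/-- The divergence of `|∇u|^{p-2} e^{αu} ∇u` at a point of the manifold, in expanded form. -/
noncomputable def gradFluxOn (p α : ℝ) (u : M → ℝ) (x : M) : ℝ :=
  gradFlux p α (metricMatrix (chartAt (EuclideanSpace ℝ (Fin n)) x)) (localRep u x)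
    (chartAt (EuclideanSpace ℝ (Fin n)) x x)

variable (n) in
/-- The integrand `ζ div X + ⟨∇ζ, X⟩ = div (ζ X)` for `X = |∇u|^{p-2} e^{αu} ∇u`. -/
noncomputable def testFlux (p α : ℝ) (u ζ : M → ℝ) (x : M) : ℝ :=
  ζ x * gradFluxOn n p α u x
    + gradNorm n u x ^ (p - 2) * Real.exp (α * u x) * gradInnerOn n ζ u x

variable (n) in
/-- `f` is locally Lipschitz in the charts of the atlas. -/
def IsChartLip (f : M → ℝ) : Prop :=
  ∀ e ∈ atlas (EuclideanSpace ℝ (Fin n)) M, ∀ x ∈ e.source, LipAt (fun z => f (e.symm z)) (e x)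

lemma IsChartLip.mul {f h : M → ℝ} (hf : IsChartLip n f) (hh : IsChartLip n h) :
    IsChartLip n fun x => f x * h x := fun e he x hx => (hf e he x hx).mul (hh e he x hx)

lemma gradNorm_eq : gradNorm n u x = √(gradInnerOn n u u x) := rfl

lemma gradInnerOn_of_eventuallyEq_zero (hf : f =ᶠ[𝓝 x] 0) : gradInnerOn n f h x = 0 := by
  have h1 : localRep f x =ᶠ[𝓝 (chartAt (EuclideanSpace ℝ (Fin n)) x x)] fun _ => 0 := by
    have h2 := (chartAt (EuclideanSpace ℝ (Fin n)) x).symm.continuousAt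
      (mem_chart_target (EuclideanSpace ℝ (Fin n)) x)
    rw [ContinuousAt, (chartAt (EuclideanSpace ℝ (Fin n)) x).left_inv (mem_chart_source _ x)] at h2
    exact h2.eventually hf
  have h3 (i : Fin n) : partialDeriv i (localRep f x)
      (chartAt (EuclideanSpace ℝ (Fin n)) x x) = 0 := by
    rw [partialDeriv, h1.fderiv_eq]; simp
  simp [gradInnerOn, gradInner, h3]

lemma testFlux_of_notMem_tsupport (hx : x ∉ tsupport ζ) : testFlux n p α u ζ x = 0 := by
  have h := notMem_tsupport_iff_eventuallyEq.1 hx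
  rw [testFlux, gradInnerOn_of_eventuallyEq_zero h, h.self_of_nhds]
  simp

variable [IsManifold 𝓘(ℝ, EuclideanSpace ℝ (Fin n)) ∞ M]
  [IsContMDiffRiemannianBundle 𝓘(ℝ, EuclideanSpace ℝ (Fin n)) ∞ (EuclideanSpace ℝ (Fin n))
    (fun x : M => TangentSpace 𝓘(ℝ, EuclideanSpace ℝ (Fin n)) x)]

lemma gradInnerOn_eq (he : e ∈ atlas (EuclideanSpace ℝ (Fin n)) M) (hx : x ∈ e.source)
    (hf : DifferentiableAt ℝ (fun z => f (e.symm z)) (e x))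
    (hh : DifferentiableAt ℝ (fun z => h (e.symm z)) (e x)) :
    gradInnerOn n f h x
      = gradInner (metricMatrix e) (fun z => f (e.symm z)) (fun z => h (e.symm z)) (e x) :=
  gradInner_coord (chart_mem_atlas _ x) he (mem_chart_source _ x) hx hf hh

lemma gradFluxOn_eq (he : e ∈ atlas (EuclideanSpace ℝ (Fin n)) M) (hx : x ∈ e.source)
    (hf : IsTwiceDiffAt (fun z => f (e.symm z)) (e x)) :
    gradFluxOn n p α f x = gradFlux p α (metricMatrix e) (fun z => f (e.symm z)) (e x) :=
  gradFlux_coord (chart_mem_atlas _ x) he (mem_chart_source _ x) hx hf p α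

lemma continuousOn_gradNorm (hu : IsC11LocOn n u U) (hU : IsOpen U) :
    ContinuousOn (gradNorm n u) U := by
  intro x hx
  set e := chartAt (EuclideanSpace ℝ (Fin n)) x with he
  have heA : e ∈ atlas (EuclideanSpace ℝ (Fin n)) M := chart_mem_atlas _ x
  have hxs : x ∈ e.source := mem_chart_source _ x
  have h1 : ContinuousAt (fun z => √(gradInner (metricMatrix e) (fun z => u (e.symm z))
      (fun z => u (e.symm z)) z)) (e x) :=
    ((isMetricAt_metricMatrix heA (e.map_source hxs)).lipAt_sqrt_gradInner
      (hu.isC11At heA hxs hx)).continuousAt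
  have h2 := ContinuousAt.comp h1 (e.continuousAt hxs)
  refine (h2.congr ?_).continuousWithinAt
  filter_upwards [e.open_source.mem_nhds hxs, hU.mem_nhds hx] with z hz hzU
  have h3 := (hu.isC11At heA hz hzU).eventually_differentiableAt.self_of_nhds
  rw [gradNorm_eq, gradInnerOn_eq heA hz h3 h3]
  rfl

lemma IsC11LocOn.continuousOn (hu : IsC11LocOn n u U) : ContinuousOn u U := by
  intro x hx
  have hxs := mem_chart_source (EuclideanSpace ℝ (Fin n)) x
  have h1 := (hu.isC11At (chart_mem_atlas (EuclideanSpace ℝ (Fin n)) x)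
    hxs hx).eventually_differentiableAt.self_of_nhds.continuousAt
  have h2 := ContinuousAt.comp h1 ((chartAt (EuclideanSpace ℝ (Fin n)) x).continuousAt hxs)
  refine (h2.congr ?_).continuousWithinAt
  filter_upwards [(chartAt (EuclideanSpace ℝ (Fin n)) x).open_source.mem_nhds hxs] with z hz
  simp [(chartAt (EuclideanSpace ℝ (Fin n)) x).left_inv hz]

variable [MeasurableSpace M] [BorelSpace M]

lemma ae_differentiableAt_localRep [SecondCountableTopology M] (hf : IsChartLip n f) :
    ∀ᵐ x ∂riemannianVolume n M,
      DifferentiableAt ℝ (localRep f x) (chartAt (EuclideanSpace ℝ (Fin n)) x x) := by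
  have h : ∀ᵐ x ∂riemannianVolume n M, x ∈ (Set.univ : Set M) →
      DifferentiableAt ℝ (localRep f x) (chartAt (EuclideanSpace ℝ (Fin n)) x x) := by
    refine ae_riemannianVolume_of_forall_chart fun x _ => ?_
    set e := chartAt (EuclideanSpace ℝ (Fin n)) x with he
    have heA : e ∈ atlas (EuclideanSpace ℝ (Fin n)) M := chart_mem_atlas _ x
    refine ⟨e.target, e.open_target.mem_nhds (mem_chart_target _ x), ?_⟩
    filter_upwards [ae_differentiableAt_of_lipAt volume (f := fun z => f (e.symm z))
      (S := e.target) fun y hy => by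
        have := hf e heA (e.symm y) (e.map_target hy)
        rwa [e.right_inv hy] at this] with y hy hyt
    refine differentiableAt_coord (chart_mem_atlas _ _) heA (mem_chart_source _ _)
      (e.map_target hyt) ?_
    rw [e.right_inv hyt]
    exact hy hyt
  exact h.mono fun x hx => hx trivial

lemma ae_isTwiceDiffAt_localRep [SecondCountableTopology M] (hu : IsC11LocOn n u U)
    (hU : IsOpen U) :
    ∀ᵐ x ∂riemannianVolume n M, x ∈ U →
      IsTwiceDiffAt (localRep u x) (chartAt (EuclideanSpace ℝ (Fin n)) x x) := by
  refine ae_riemannianVolume_of_forall_chart fun x hx => ?_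
  set e := chartAt (EuclideanSpace ℝ (Fin n)) x with he
  have heA : e ∈ atlas (EuclideanSpace ℝ (Fin n)) M := chart_mem_atlas _ x
  have hxs : x ∈ e.source := mem_chart_source _ x
  have hC (y : EuclideanSpace ℝ (Fin n)) (hy : y ∈ e.target ∩ e.symm ⁻¹' U) :
      IsC11At (fun z => u (e.symm z)) y := by
    have := hu.isC11At heA (e.map_target hy.1) hy.2
    rwa [e.right_inv hy.1] at this
  refine ⟨e.target ∩ e.symm ⁻¹' U, Filter.inter_mem
    (e.open_target.mem_nhds (mem_chart_target _ x))
    ((e.symm.continuousAt (e.map_source hxs)).preimage_mem_nhds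
      (by rw [e.left_inv hxs]; exact hU.mem_nhds hx)), ?_⟩
  filter_upwards [ae_differentiableAt_of_lipAt volume (f := fderiv ℝ fun z => u (e.symm z))
    (S := e.target ∩ e.symm ⁻¹' U) fun y hy => (hC y hy).lipAt_fderiv] with y hy hyt
  refine isTwiceDiffAt_coord (chart_mem_atlas _ _) heA (mem_chart_source _ _)
    (e.map_target hyt.1) ?_
  rw [e.right_inv hyt.1]
  exact (hC y hyt).isTwiceDiffAt (hy hyt)

/-- The divergence theorem for a test function supported in one chart. -/
lemma integral_testFlux_eq_zero_of_chart
    (he : e ∈ atlas (EuclideanSpace ℝ (Fin n)) M)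
    (hu : IsC11LocOn n u U) (hp : 3 ≤ p) (hζ : IsChartLip n ζ)
    (hc : HasCompactSupport ζ) (hζU : tsupport ζ ⊆ U) (hζe : tsupport ζ ⊆ e.source) :
    Integrable (testFlux n p α u ζ) (riemannianVolume n M) ∧
      ∫ x, testFlux n p α u ζ x ∂riemannianVolume n M = 0 := by
  classical
  set ψ : EuclideanSpace ℝ (Fin n) → ℝ := fun y => if y ∈ e.target then ζ (e.symm y) else 0
    with hψ
  set G := metricMatrix e with hGdef
  set v : EuclideanSpace ℝ (Fin n) → ℝ := fun z => u (e.symm z) with hv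
  set Ω := e.target ∩ e.symm ⁻¹' U with hΩ
  have hψt {y : EuclideanSpace ℝ (Fin n)} (hy : y ∈ e.target) :
      ψ =ᶠ[𝓝 y] fun z => ζ (e.symm z) := by
    filter_upwards [e.open_target.mem_nhds hy] with z hz
    simp [hψ, hz]
  have hKc : IsCompact (e '' tsupport ζ) := hc.isCompact.image_of_continuousOn
    (e.continuousOn.mono hζe)
  have hsub : tsupport ψ ⊆ e '' tsupport ζ := by
    refine closure_minimal (fun y hy => ?_) hKc.isClosed
    have hyt : y ∈ e.target := by
      by_contra hyt
      exact hy (by simp [hψ, hyt])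
    refine ⟨e.symm y, subset_tsupport _ ?_, e.right_inv hyt⟩
    simpa [hψ, hyt] using hy
  have hKt : e '' tsupport ζ ⊆ Ω := by
    rintro _ ⟨x, hx, rfl⟩
    refine ⟨e.map_source (hζe hx), ?_⟩
    simpa [e.left_inv (hζe hx)] using hζU hx
  have hψc : HasCompactSupport ψ := hKc.of_isClosed_subset (isClosed_tsupport _) hsub
  have hψL (y : EuclideanSpace ℝ (Fin n)) : LipAt ψ y := by
    by_cases hy : y ∈ tsupport ψ
    · have hyt := (hKt (hsub hy)).1
      have h1 := hζ e he (e.symm y) (e.map_target hyt)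
      rw [e.right_inv hyt] at h1
      exact h1.congr (hψt hyt).symm
    · exact (LipAt.const 0 y).congr (notMem_tsupport_iff_eventuallyEq.1 hy).symm
  have hG (y) (hy : y ∈ Ω) : IsMetricAt G y := isMetricAt_metricMatrix he hy.1
  have hC (y) (hy : y ∈ Ω) : IsC11At v y := by
    have := hu.isC11At he (e.map_target hy.1) hy.2
    rwa [e.right_inv hy.1] at this
  obtain ⟨hi, h0⟩ := integral_divergence_eq_zero (F := gradWeight p α G v) hG hC
    (fun y hy => (hG y hy).lipAt_gradWeight (hC y hy) hp) hψL hψc (hsub.trans hKt)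
  have key := integral_riemannianVolume_eq he (f := testFlux n p α u ζ)
    (fun x hx => testFlux_of_notMem_tsupport fun h => hx (hζe h)) ?_ ?_ hi
  · rwa [h0] at key
  · filter_upwards [ae_differentiableAt_of_lipAt volume (f := ψ) (S := Set.univ)
      fun y _ => hψL y, ae_differentiableAt_of_lipAt volume (f := fderiv ℝ v)
      (S := Ω) fun y hy => (hC y hy).lipAt_fderiv] with y hy1 hy2 hyt
    have hψ' := notMem_tsupport_iff_eventuallyEq (f := ψ) (x := y)
    by_cases hyζ : e.symm y ∈ tsupport ζ
    · have hyΩ : y ∈ Ω := ⟨hyt, hζU hyζ⟩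
      have hxs : e.symm y ∈ e.source := e.map_target hyt
      have h2 : IsTwiceDiffAt v y := (hC y hyΩ).isTwiceDiffAt (hy2 hyΩ)
      have h3 : DifferentiableAt ℝ (fun z => ζ (e.symm z)) y :=
        (hψt hyt).differentiableAt_iff.1 (hy1 trivial)
      have h4 : gradFluxOn n p α u (e.symm y) = gradFlux p α G v y := by
        rw [gradFluxOn_eq he hxs (by rwa [e.right_inv hyt]), e.right_inv hyt]
      have h5 : gradInnerOn n ζ u (e.symm y) = gradInner G ψ v y := by
        rw [gradInnerOn_eq he hxs (by rwa [e.right_inv hyt])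
          (by rw [e.right_inv hyt]; exact h2.differentiableAt), e.right_inv hyt]
        simp only [gradInner, partialDeriv, (hψt hyt).fderiv_eq]
        rfl
      have h6 : gradNorm n u (e.symm y) = √(gradInner G v v y) := by
        rw [gradNorm_eq, gradInnerOn_eq he hxs (by rw [e.right_inv hyt]; exact h2.differentiableAt)
          (by rw [e.right_inv hyt]; exact h2.differentiableAt), e.right_inv hyt]
      rw [testFlux, h4, h5, h6, (hG y hyΩ).gradWeight_mul_laplacian_add h2 hp]
      simp only [hψ, hyt, if_true, gradWeight, hv]
    · rw [testFlux_of_notMem_tsupport hyζ]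
      have hyψ : y ∉ tsupport ψ := fun hy => by
        obtain ⟨x, hx, rfl⟩ := hsub hy
        rw [e.left_inv (hζe hx)] at hyζ
        exact hyζ hx
      have h1 := hψ'.1 hyψ
      have h2 (i : Fin n) : partialDeriv i ψ y = 0 := by
        rw [partialDeriv, h1.fderiv_eq]; simp
      simp [gradInner, h2, h1.self_of_nhds]
  · intro y hy
    have h1 := notMem_tsupport_iff_eventuallyEq.1 fun h => hy (hKt (hsub h)).1
    have h2 (i : Fin n) : partialDeriv i ψ y = 0 := by
      rw [partialDeriv, h1.fderiv_eq]; simp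
    have h3 : ψ y = 0 := h1.self_of_nhds
    simp [gradInner, h2, h3]

end Manifold

/-! ### The divergence theorem on the manifold -/

section Global

variable {M : Type*} [TopologicalSpace M] [T2Space M] [SecondCountableTopology M]
  [ChartedSpace (EuclideanSpace ℝ (Fin n)) M]
  [IsManifold 𝓘(ℝ, EuclideanSpace ℝ (Fin n)) ∞ M]
  [RiemannianBundle (fun x : M => TangentSpace 𝓘(ℝ, EuclideanSpace ℝ (Fin n)) x)]
  [IsContMDiffRiemannianBundle 𝓘(ℝ, EuclideanSpace ℝ (Fin n)) ∞ (EuclideanSpace ℝ (Fin n))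
    (fun x : M => TangentSpace 𝓘(ℝ, EuclideanSpace ℝ (Fin n)) x)]
  [MeasurableSpace M] [BorelSpace M]
  {e : OpenPartialHomeomorph M (EuclideanSpace ℝ (Fin n))} {x : M} {f h u ζ : M → ℝ} {U : Set M}
  {p α : ℝ}

lemma isChartLip_of_contMDiff
    (hf : ContMDiff 𝓘(ℝ, EuclideanSpace ℝ (Fin n)) 𝓘(ℝ, ℝ) ∞ f) : IsChartLip n f := by
  intro e he x hx
  have h1 : ContMDiffAt 𝓘(ℝ, EuclideanSpace ℝ (Fin n)) 𝓘(ℝ, EuclideanSpace ℝ (Fin n)) ∞ e.symm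
      (e x) :=
    contMDiffAt_symm_of_mem_maximalAtlas (IsManifold.subset_maximalAtlas he) (e.map_source hx)
  have h2 := contMDiffAt_iff_contDiffAt.1 (hf.contMDiffAt.comp (e x) h1)
  exact (h2.of_le (by norm_num)).lipAt

lemma testFlux_sum {ι : Type*} (s : Finset ι) (φ : ι → M → ℝ)
    (hφ : ∀ i ∈ s, DifferentiableAt ℝ (localRep (φ i) x)
      (chartAt (EuclideanSpace ℝ (Fin n)) x x)) :
    testFlux n p α u (fun z => ∑ i ∈ s, φ i z) x = ∑ i ∈ s, testFlux n p α u (φ i) x := by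
  have h1 : gradInnerOn n (fun z => ∑ i ∈ s, φ i z) u x = ∑ i ∈ s, gradInnerOn n (φ i) u x := by
    have h2 (j : Fin n) : partialDeriv j (localRep (fun z => ∑ i ∈ s, φ i z) x)
        (chartAt (EuclideanSpace ℝ (Fin n)) x x)
        = ∑ i ∈ s, partialDeriv j (localRep (φ i) x)
          (chartAt (EuclideanSpace ℝ (Fin n)) x x) :=
      partialDeriv_sum j s hφ
    simp only [gradInnerOn, gradInner_eq_sum, h2, Finset.sum_mul]
    exact Finset.sum_comm
  simp only [testFlux, h1, Finset.sum_add_distrib, Finset.sum_mul, Finset.mul_sum]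

/-- The divergence theorem for a compactly supported Lipschitz test function: a smooth partition of
unity reduces it to test functions supported in one chart. -/
lemma integral_testFlux_eq_zero (hu : IsC11LocOn n u U) (hp : 3 ≤ p) (hζ : IsChartLip n ζ)
    (hc : HasCompactSupport ζ) (hζU : tsupport ζ ⊆ U) :
    Integrable (testFlux n p α u ζ) (riemannianVolume n M) ∧
      ∫ x, testFlux n p α u ζ x ∂riemannianVolume n M = 0 := by
  have : LocallyCompactSpace M := ChartedSpace.locallyCompactSpace (EuclideanSpace ℝ (Fin n)) M
  obtain ⟨φ, hφ⟩ := SmoothPartitionOfUnity.exists_isSubordinate 𝓘(ℝ, EuclideanSpace ℝ (Fin n))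
    (isClosed_tsupport ζ) (fun x : M => (chartAt (EuclideanSpace ℝ (Fin n)) x).source)
    (fun x => (chartAt (EuclideanSpace ℝ (Fin n)) x).open_source)
    (fun x _ => Set.mem_iUnion.2 ⟨x, mem_chart_source _ x⟩)
  set s := (φ.locallyFinite.finite_nonempty_inter_compact hc.isCompact).toFinset
  have hsum : ζ = fun x => ∑ i ∈ s, φ i x * ζ x := by
    funext x
    by_cases hx : x ∈ tsupport ζ
    · have h1 : ∑ i ∈ s, φ i x = 1 := by
        rw [← φ.sum_eq_one hx]
        refine (finsum_eq_sum_of_support_subset _ fun i hi => ?_).symm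
        simp only [s, Set.Finite.coe_toFinset]
        exact ⟨x, hi, hx⟩
      rw [← Finset.sum_mul, h1, one_mul]
    · simp [image_eq_zero_of_notMem_tsupport hx]
  have hlip (i : M) : IsChartLip n fun x => φ i x * ζ x :=
    (isChartLip_of_contMDiff (φ i).contMDiff).mul hζ
  have key (i : M) : Integrable (testFlux n p α u fun x => φ i x * ζ x) (riemannianVolume n M) ∧
      ∫ x, testFlux n p α u (fun x => φ i x * ζ x) x ∂riemannianVolume n M = 0 :=
    integral_testFlux_eq_zero_of_chart (chart_mem_atlas _ i) hu hp (hlip i) hc.mul_left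
      ((tsupport_mul_subset_right (f := φ i) (g := ζ)).trans hζU)
      ((tsupport_mul_subset_left (f := φ i) (g := ζ)).trans (hφ i))
  have hae : testFlux n p α u ζ =ᵐ[riemannianVolume n M]
      fun x => ∑ i ∈ s, testFlux n p α u (fun x => φ i x * ζ x) x := by
    have h1 : ∀ᵐ x ∂riemannianVolume n M, ∀ i ∈ s, DifferentiableAt ℝ
        (localRep (fun x => φ i x * ζ x) x) (chartAt (EuclideanSpace ℝ (Fin n)) x x) :=
      (ae_ball_iff s.countable_toSet).2 fun i _ => ae_differentiableAt_localRep (hlip i)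
    filter_upwards [h1] with x hx
    conv_lhs => rw [hsum]
    exact testFlux_sum s _ hx
  refine ⟨(integrable_finsetSum _ fun i _ => (key i).1).congr hae.symm, ?_⟩
  rw [integral_congr_ae hae, integral_finsetSum _ fun i _ => (key i).1]
  exact Finset.sum_eq_zero fun i _ => (key i).2

end Global

/-! ### The pointwise inequality -/

section Young

/-- Young's inequality with a small constant in front of the first term. -/
lemma exists_young {s t ε K : ℝ} (ht : 0 < t) (hts : t < s) (hε : 0 < ε) (hK : 0 ≤ K) :
    ∃ C, 0 ≤ C ∧ ∀ N b : ℝ, 0 ≤ N → 0 ≤ b →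
      K * b * N ^ (s - t) ≤ ε * N ^ s + C * b ^ (s / t) := by
  have hs : 0 < s := ht.trans hts
  refine ⟨K * (K / ε) ^ ((s - t) / t), by positivity, fun N b hN hb => ?_⟩
  -- either the left-hand side is absorbed by the first term, or `N` is bounded by a power of `b`
  rcases le_total (K * b) (ε * N ^ t) with h | h
  · have h1 : N ^ s = N ^ t * N ^ (s - t) := by
      rw [← Real.rpow_add' hN (by linarith)]
      congr 1
      ring
    have h2 : K * b * N ^ (s - t) ≤ ε * N ^ t * N ^ (s - t) := by gcongr
    have h3 : 0 ≤ K * (K / ε) ^ ((s - t) / t) * b ^ (s / t) := by positivity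
    rw [h1]
    linarith
  · have h1 : N ^ (s - t) = (N ^ t) ^ ((s - t) / t) := by
      rw [← Real.rpow_mul hN]
      congr 1
      field_simp
    have h2 : N ^ t ≤ K / ε * b := by
      rw [div_mul_eq_mul_div, le_div_iff₀ hε]
      linarith
    have h3 : (N ^ t) ^ ((s - t) / t) ≤ (K / ε * b) ^ ((s - t) / t) := by
      refine Real.rpow_le_rpow (by positivity) h2 (div_nonneg (by linarith) ht.le)
    have h4 : b ^ (s / t) = b * b ^ ((s - t) / t) := by
      rw [← Real.rpow_one_add' hb]
      · congr 1
        field_simp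
        ring
      · have : 0 ≤ (s - t) / t := div_nonneg (by linarith) ht.le
        linarith
    have h5 : 0 ≤ ε * N ^ s := by positivity
    calc K * b * N ^ (s - t) ≤ K * b * (K / ε * b) ^ ((s - t) / t) := by
          rw [h1]; gcongr
      _ = K * (K / ε) ^ ((s - t) / t) * b ^ (s / t) := by
          rw [Real.mul_rpow (by positivity) hb, h4]; ring
      _ ≤ _ := by linarith

end Young

section Pointwise

variable {G : EuclideanSpace ℝ (Fin n) → Matrix (Fin n) (Fin n) ℝ}
  {f : EuclideanSpace ℝ (Fin n) → ℝ} {y : EuclideanSpace ℝ (Fin n)}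

/-- The pinching condition bounds `div (|∇f|^{p-2} e^{αf} ∇f)` from below by
`e^{αf} ((α - α_δ) |∇f|^p - C |Ric| |∇f|^{p-2})`. The gain `α - α_δ > 0` comes from the derivative of
the exponential. -/
lemma IsMetricAt.le_gradFlux (hG : IsMetricAt G y) (hf : IsTwiceDiffAt f y) {δ α : ℝ} (hn : 3 ≤ n)
    (hδ₀ : 0 ≤ δ) (hδ : δ < 1 / 2) (hp : 3 ≤ gradExponent n δ)
    (hpin : ∀ ξ : Fin n → ℝ, 0 ≤ ξ ⬝ᵥ (ricci (conformalMetric G f) y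
      - (2 * δ * sigmaOne (G y) (schouten (conformalMetric G f) y)) • G y).mulVec ξ) :
    Real.exp (α * f y) * ((α - alphaDelta n δ) * √(gradInner G f f y) ^ gradExponent n δ
      - (1 + n) / (1 - 2 * δ) * tensorNorm (G y) (ricci G y)
        * √(gradInner G f f y) ^ (gradExponent n δ - 2))
      ≤ gradFlux (gradExponent n δ) α G f y := by
  have key := hG.pinched_gradient hn hδ₀ hδ hf hpin
  set p := gradExponent n δ
  have hs0 := hG.gradInner_self_nonneg f
  rw [gradFlux]
  refine mul_le_mul_of_nonneg_left ?_ (Real.exp_pos _).le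
  rcases hs0.eq_or_lt with h0 | h0
  · have hpd := hG.partialDeriv_eq_zero h0.symm
    have hgv (k) : gradVec G f k y = 0 := by simp [gradVec, hpd]
    have hH : hessianGrad G f y = 0 := by simp [hessianGrad, hgv]
    have h1 : (0 : ℝ) ^ p = 0 := Real.zero_rpow (by linarith)
    have h2 : (0 : ℝ) ^ (p - 2) = 0 := Real.zero_rpow (by linarith)
    rw [← h0, Real.sqrt_zero, h1, h2, hH]
    simp
  · set N := √(gradInner G f f y) with hN
    have hN0 : 0 < N := Real.sqrt_pos.2 h0
    have hsq : gradInner G f f y = N ^ 2 := (Real.sq_sqrt hs0).symm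
    rw [hsq] at key
    have e2 : N ^ (p - 2) = N ^ (p - 4) * N ^ 2 := by
      rw [← Real.rpow_natCast, ← Real.rpow_add hN0]; congr 1; push_cast; ring
    have e4 : N ^ p = N ^ (p - 4) * (N ^ 2) ^ 2 := by
      rw [← pow_mul, ← Real.rpow_natCast, ← Real.rpow_add hN0]; congr 1; push_cast; ring
    have h1 := mul_nonneg (Real.rpow_nonneg hN0.le (p - 4)) key
    rw [e2, e4]
    nlinarith [h1]

end Pointwise

/-! ### The cutoff function -/

section Cutoff

/-- A piecewise linear cutoff: it vanishes for `t ≤ 5/8 r₁` and for `t ≥ 15/8 r₂`, and equals `1`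
for `7/8 r₁ ≤ t ≤ 9/8 r₂`. -/
noncomputable def radialCutoff (r₁ r₂ t : ℝ) : ℝ :=
  max 0 (min 1 (min (4 * t / r₁ - 5 / 2) (5 / 2 - 4 * t / (3 * r₂))))

/-- A local Lipschitz constant of `radialCutoff` at `t`; it vanishes for `r₁ ≤ t ≤ r₂`, where the
cutoff is locally constant. -/
noncomputable def cutoffSlope (r₁ r₂ t : ℝ) : ℝ :=
  if t < r₁ then 4 / r₁ else if r₂ < t then 4 / (3 * r₂) else 0

variable {r₁ r₂ t : ℝ}

lemma radialCutoff_nonneg : 0 ≤ radialCutoff r₁ r₂ t := le_max_left _ _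

lemma radialCutoff_le_one : radialCutoff r₁ r₂ t ≤ 1 :=
  max_le zero_le_one (min_le_left _ _)

lemma abs_clamp_sub_le (a b : ℝ) : |max 0 (min 1 a) - max 0 (min 1 b)| ≤ |a - b| := by
  have h := ((LipschitzWith.id (α := ℝ)).const_min 1).const_max 0
  simpa [Real.dist_eq] using h.dist_le_mul a b

lemma four_mul_div_sub_le (hr₁ : 0 < r₁) (ht : 7 / 8 * r₁ ≤ t) :
    1 ≤ 4 * t / r₁ - 5 / 2 := by
  rw [le_sub_iff_add_le, le_div_iff₀ hr₁]
  linarith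

lemma le_sub_four_mul_div (hr₁ : 0 < r₁) (hr : r₁ < r₂) (ht : t ≤ 9 / 8 * r₂) :
    1 ≤ 5 / 2 - 4 * t / (3 * r₂) := by
  rw [le_sub_comm, div_le_iff₀ (by linarith)]
  linarith

lemma radialCutoff_of_le (hr₁ : 0 < r₁) (hr : r₁ < r₂) (ht : t ≤ 9 / 8 * r₂) :
    radialCutoff r₁ r₂ t = max 0 (min 1 (4 * t / r₁ - 5 / 2)) := by
  have h := le_sub_four_mul_div hr₁ hr ht
  rw [radialCutoff, ← min_assoc, min_eq_left ((min_le_left _ _).trans h)]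

lemma radialCutoff_of_ge (hr₁ : 0 < r₁) (ht : 7 / 8 * r₁ ≤ t) :
    radialCutoff r₁ r₂ t = max 0 (min 1 (5 / 2 - 4 * t / (3 * r₂))) := by
  have h := four_mul_div_sub_le hr₁ ht
  rw [radialCutoff, ← min_assoc, min_eq_left h]

lemma radialCutoff_eq_one (hr₁ : 0 < r₁) (hr : r₁ < r₂) (h₁ : 7 / 8 * r₁ ≤ t)
    (h₂ : t ≤ 9 / 8 * r₂) : radialCutoff r₁ r₂ t = 1 := by
  rw [radialCutoff_of_le hr₁ hr h₂, min_eq_left (four_mul_div_sub_le hr₁ h₁)]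
  simp

lemma mem_Icc_of_radialCutoff_ne_zero (hr₁ : 0 < r₁) (hr : r₁ < r₂)
    (h : radialCutoff r₁ r₂ t ≠ 0) : 5 / 8 * r₁ ≤ t ∧ t ≤ 15 / 8 * r₂ := by
  have h1 : 0 < min 1 (min (4 * t / r₁ - 5 / 2) (5 / 2 - 4 * t / (3 * r₂))) := by
    by_contra h0
    exact h (max_eq_left (not_lt.1 h0))
  have h2 := lt_min_iff.1 (lt_min_iff.1 h1).2
  constructor
  · have := h2.1
    rw [lt_sub_iff_add_lt, lt_div_iff₀ hr₁] at this
    linarith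
  · have := h2.2
    rw [lt_sub_comm, div_lt_iff₀ (by linarith)] at this
    linarith

lemma cutoffSlope_nonneg (hr₁ : 0 < r₁) (hr : r₁ < r₂) : 0 ≤ cutoffSlope r₁ r₂ t := by
  have : 0 < r₂ := hr₁.trans hr
  unfold cutoffSlope
  split_ifs <;> positivity

lemma eventually_abs_radialCutoff_sub_le (hr₁ : 0 < r₁) (hr : r₁ < r₂) :
    ∀ᶠ s in 𝓝 t, |radialCutoff r₁ r₂ s - radialCutoff r₁ r₂ t|
      ≤ cutoffSlope r₁ r₂ t * |s - t| := by
  have hr₂ : 0 < r₂ := hr₁.trans hr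
  unfold cutoffSlope
  split_ifs with h1 h2
  · filter_upwards [eventually_lt_nhds h1] with s hs
    rw [radialCutoff_of_le hr₁ hr (by linarith), radialCutoff_of_le hr₁ hr (by linarith)]
    refine (abs_clamp_sub_le _ _).trans (le_of_eq ?_)
    rw [← abs_of_pos (a := 4 / r₁) (by positivity), ← abs_mul]
    congr 1
    ring
  · filter_upwards [eventually_gt_nhds h2] with s hs
    rw [radialCutoff_of_ge hr₁ (by linarith), radialCutoff_of_ge hr₁ (by linarith)]
    refine (abs_clamp_sub_le _ _).trans (le_of_eq ?_)
    rw [← abs_of_pos (a := 4 / (3 * r₂)) (by positivity), ← abs_mul, ← abs_neg]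
    congr 1
    ring
  · filter_upwards [eventually_gt_nhds (show 7 / 8 * r₁ < t by linarith),
      eventually_lt_nhds (show t < 9 / 8 * r₂ by linarith)] with s hs1 hs2
    rw [radialCutoff_eq_one hr₁ hr hs1.le hs2.le,
      radialCutoff_eq_one hr₁ hr (by linarith) (by linarith)]
    simp

lemma lipAt_radialCutoff : LipAt (radialCutoff r₁ r₂) t := by
  have h1 : LipAt (fun t : ℝ => 4 * t / r₁ - 5 / 2) t :=
    ContDiffAt.lipAt (by fun_prop)
  have h2 : LipAt (fun t : ℝ => 5 / 2 - 4 * t / (3 * r₂)) t :=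
    ContDiffAt.lipAt (by fun_prop)
  have hmin (q : ℝ × ℝ) : LipAt (fun q : ℝ × ℝ => min q.1 q.2) q :=
    ⟨1, Set.univ, univ_mem, lipschitzWith_min.lipschitzOnWith⟩
  have hmax (q : ℝ × ℝ) : LipAt (fun q : ℝ × ℝ => max q.1 q.2) q :=
    ⟨1, Set.univ, univ_mem, lipschitzWith_max.lipschitzOnWith⟩
  have h3 := LipAt.comp (g := fun t : ℝ => (4 * t / r₁ - 5 / 2, 5 / 2 - 4 * t / (3 * r₂)))
    (hmin _) (h1.prodMk h2)
  have h4 := LipAt.comp (g := fun t : ℝ =>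
    ((1 : ℝ), min (4 * t / r₁ - 5 / 2) (5 / 2 - 4 * t / (3 * r₂)))) (hmin _)
    ((LipAt.const (1 : ℝ) t).prodMk h3)
  exact LipAt.comp (g := fun t : ℝ =>
    ((0 : ℝ), min 1 (min (4 * t / r₁ - 5 / 2) (5 / 2 - 4 * t / (3 * r₂))))) (hmax _)
    ((LipAt.const (0 : ℝ) t).prodMk h4)

end Cutoff

/-! ### The integral estimate -/

/-- If `T` has integral zero, the integral of a nonnegative `X` is at most that of the positive part
of `X - T`. Neither integral is assumed to be finite. -/
lemma lintegral_ofReal_le_of_integral_eq_zero {Ω : Type*} [MeasurableSpace Ω] {μ : Measure Ω}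
    {X T : Ω → ℝ} (hX : AEStronglyMeasurable X μ) (hX0 : ∀ x, 0 ≤ X x) (hT : Integrable T μ)
    (hT0 : ∫ x, T x ∂μ = 0) :
    ∫⁻ x, ENNReal.ofReal (X x) ∂μ ≤ ∫⁻ x, ENNReal.ofReal (X x - T x) ∂μ := by
  by_cases htop : ∫⁻ x, ENNReal.ofReal (X x - T x) ∂μ = ⊤
  · rw [htop]; exact le_top
  have hmeas : AEMeasurable (fun x => ENNReal.ofReal |T x|) μ :=
    hT.1.aemeasurable.abs.ennreal_ofReal
  have hTfin : ∫⁻ x, ENNReal.ofReal |T x| ∂μ < ⊤ := by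
    have := hT.2
    rw [hasFiniteIntegral_iff_norm] at this
    simpa [Real.norm_eq_abs] using this
  have hXi : Integrable X μ := by
    refine ⟨hX, ?_⟩
    rw [hasFiniteIntegral_iff_ofReal (ae_of_all _ hX0)]
    calc ∫⁻ x, ENNReal.ofReal (X x) ∂μ
        ≤ ∫⁻ x, (ENNReal.ofReal (X x - T x) + ENNReal.ofReal |T x|) ∂μ := by
          refine lintegral_mono fun x => ?_
          refine le_trans (ENNReal.ofReal_le_ofReal ?_) ENNReal.ofReal_add_le
          linarith [le_abs_self (T x)]
      _ = ∫⁻ x, ENNReal.ofReal (X x - T x) ∂μ + ∫⁻ x, ENNReal.ofReal |T x| ∂μ :=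
          lintegral_add_right' _ hmeas
      _ < ⊤ := ENNReal.add_lt_top.2 ⟨lt_top_iff_ne_top.2 htop, hTfin⟩
  have hXT : Integrable (fun x => X x - T x) μ := hXi.sub hT
  have h1 : ∫ x, X x ∂μ = ∫ x, (X x - T x) ∂μ := by
    rw [integral_sub hXi hT, hT0, sub_zero]
  rw [← ofReal_integral_eq_lintegral_ofReal hXi (ae_of_all _ hX0), h1]
  calc ENNReal.ofReal (∫ x, (X x - T x) ∂μ)
      ≤ ENNReal.ofReal (∫ x, max (X x - T x) 0 ∂μ) :=
        ENNReal.ofReal_le_ofReal (integral_mono hXT hXT.pos_part fun x => le_max_left _ _)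
    _ = ∫⁻ x, ENNReal.ofReal (max (X x - T x) 0) ∂μ :=
        ofReal_integral_eq_lintegral_ofReal hXT.pos_part (ae_of_all _ fun x => le_max_right _ _)
    _ = ∫⁻ x, ENNReal.ofReal (X x - T x) ∂μ := by simp

/-- The algebra that combines the lower bound `hD` for the divergence, the bound `hI` for the
derivative of the cutoff, and the two applications `hC₁`, `hC₂` of Young's inequality, each of which
costs a quarter of the coercive term `c η^p |∇u|^p`. -/
lemma absorb_le {p c B C₁ C₂ w η N R L D I : ℝ} (hp : 3 ≤ p) (hw : 0 ≤ w)
    (hη0 : 0 ≤ η) (hη1 : η ≤ 1) (hN : 0 ≤ N) (hR : 0 ≤ R) (hC₁0 : 0 ≤ C₁)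
    (hD : w * (c * N ^ p - B * R * N ^ (p - 2)) ≤ D) (hI : |I| ≤ L * N)
    (hC₁ : B * R * N ^ (p - 2) ≤ c / 4 * N ^ p + C₁ * R ^ (p / 2))
    (hC₂ : p * L * (η * N) ^ (p - 1) ≤ c / 4 * (η * N) ^ p + C₂ * L ^ p) :
    c / 2 * (η ^ p * N ^ p * w) - (η ^ p * D + N ^ (p - 2) * w * (p * η ^ (p - 1) * I))
      ≤ C₁ * (R ^ (p / 2) * w) + C₂ * (L ^ p * w) := by
  have hηp : 0 ≤ η ^ p := Real.rpow_nonneg hη0 _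
  have hηp1 : η ^ p ≤ 1 := Real.rpow_le_one hη0 hη1 (by linarith)
  have h1 : η ^ p * (w * (c * N ^ p - B * R * N ^ (p - 2))) ≤ η ^ p * D :=
    mul_le_mul_of_nonneg_left hD hηp
  have h2 : -(N ^ (p - 2) * w * (p * η ^ (p - 1) * I)) ≤ w * (p * L * (η * N) ^ (p - 1)) := by
    have e : N ^ (p - 1) = N ^ (p - 2) * N := by
      rw [← Real.rpow_add_one' hN (by linarith)]; congr 1; ring
    rw [Real.mul_rpow hη0 hN, e]
    have h3 : -I ≤ L * N := (neg_le_abs I).trans hI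
    have h4 : 0 ≤ N ^ (p - 2) * w * (p * η ^ (p - 1)) := by positivity
    nlinarith [mul_le_mul_of_nonneg_left h3 h4]
  have h5 : w * (p * L * (η * N) ^ (p - 1)) ≤ w * (c / 4 * (η ^ p * N ^ p) + C₂ * L ^ p) := by
    rw [← Real.mul_rpow hη0 hN]
    exact mul_le_mul_of_nonneg_left hC₂ hw
  have h6 : η ^ p * (w * (B * R * N ^ (p - 2)))
      ≤ η ^ p * (w * (c / 4 * N ^ p + C₁ * R ^ (p / 2))) :=
    mul_le_mul_of_nonneg_left (mul_le_mul_of_nonneg_left hC₁ hw) hηp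
  have h7 : η ^ p * (w * (C₁ * R ^ (p / 2))) ≤ w * (C₁ * R ^ (p / 2)) :=
    mul_le_of_le_one_left (by positivity) hηp1
  nlinarith [h1, h2, h5, h6, h7]

section Estimate

variable {M : Type*} [MetricSpace M] [SecondCountableTopology M] [MeasurableSpace M]
  [BorelSpace M] [ChartedSpace (EuclideanSpace ℝ (Fin n)) M]
  [IsManifold 𝓘(ℝ, EuclideanSpace ℝ (Fin n)) ∞ M]
  [RiemannianBundle (fun x : M => TangentSpace 𝓘(ℝ, EuclideanSpace ℝ (Fin n)) x)]
  [IsContMDiffRiemannianBundle 𝓘(ℝ, EuclideanSpace ℝ (Fin n)) ∞ (EuclideanSpace ℝ (Fin n))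
    (fun x : M => TangentSpace 𝓘(ℝ, EuclideanSpace ℝ (Fin n)) x)]
  [IsRiemannianManifold 𝓘(ℝ, EuclideanSpace ℝ (Fin n)) M]
  {x₀ x : M} {r₁ r₂ δ α : ℝ} {u η : M → ℝ} {U : Set M}

lemma isOpen_annulus {a b : ℝ} : IsOpen (annulus x₀ a b) :=
  Metric.isOpen_ball.sdiff isClosed_closure

lemma mem_annulus {a b : ℝ} (ha : a < dist x x₀) (hb : dist x x₀ < b) : x ∈ annulus x₀ a b :=
  ⟨hb, fun h => not_le.2 ha (Metric.closure_ball_subset_closedBall h)⟩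

lemma le_dist_of_mem_annulus {a b : ℝ} (h : x ∈ annulus x₀ a b) : a ≤ dist x x₀ :=
  not_lt.1 fun h' => h.2 (subset_closure h')

lemma isChartLip_of_lipAt (hη : ∀ x, LipAt η x) : IsChartLip n η := fun _ he _ hx =>
  (hη _).comp (lipAt_chart_symm he (OpenPartialHomeomorph.map_source _ hx))

lemma gradInnerOn_rpow {p : ℝ} (hp : 1 ≤ p)
    (hη : DifferentiableAt ℝ (localRep η x) (chartAt (EuclideanSpace ℝ (Fin n)) x x)) :
    gradInnerOn n (fun z => η z ^ p) u x = p * η x ^ (p - 1) * gradInnerOn n η u x := by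
  have h0 : localRep η x (chartAt (EuclideanSpace ℝ (Fin n)) x x) = η x := by
    simp [localRep, (chartAt (EuclideanSpace ℝ (Fin n)) x).left_inv (mem_chart_source _ x)]
  have h1 (i : Fin n) : partialDeriv i (localRep (fun z => η z ^ p) x)
      (chartAt (EuclideanSpace ℝ (Fin n)) x x)
      = p * η x ^ (p - 1) * partialDeriv i (localRep η x)
        (chartAt (EuclideanSpace ℝ (Fin n)) x x) := by
    rw [← h0]
    exact partialDeriv_comp i (Real.hasDerivAt_rpow_const (Or.inr hp)) hη
  simp only [gradInnerOn, gradInner_eq_sum, h1, Finset.mul_sum]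
  exact Finset.sum_congr rfl fun i _ => by ring

lemma abs_gradInnerOn_le {L : ℝ} (hL0 : 0 ≤ L)
    (hL : ∀ᶠ z in 𝓝 x, |η z - η x| ≤ L * dist x z)
    (hη : DifferentiableAt ℝ (localRep η x) (chartAt (EuclideanSpace ℝ (Fin n)) x x)) :
    |gradInnerOn n η u x| ≤ L * gradNorm n u x := by
  have hx := (chartAt (EuclideanSpace ℝ (Fin n)) x).left_inv (mem_chart_source _ x)
  exact abs_gradInner_le_of_lipschitz (chart_mem_atlas _ x) (mem_chart_target _ x) hL0
    (by rwa [hx]) hη _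

lemma le_gradFluxOn (hn : 3 ≤ n) (hδ₀ : 0 ≤ δ) (hδ : δ < 1 / 2) (hp : 3 ≤ gradExponent n δ)
    (hu : IsTwiceDiffAt (localRep u x) (chartAt (EuclideanSpace ℝ (Fin n)) x x))
    (hpin : RicciPinchedAt n δ u x) :
    Real.exp (α * u x) * ((α - alphaDelta n δ) * gradNorm n u x ^ gradExponent n δ
      - (1 + n) / (1 - 2 * δ) * ricciNorm n x * gradNorm n u x ^ (gradExponent n δ - 2))
      ≤ gradFluxOn n (gradExponent n δ) α u x := by
  have hx : localRep u x (chartAt (EuclideanSpace ℝ (Fin n)) x x) = u x := by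
    simp [localRep, (chartAt (EuclideanSpace ℝ (Fin n)) x).left_inv (mem_chart_source _ x)]
  have h := (isMetricAt_metricMatrix (chart_mem_atlas (EuclideanSpace ℝ (Fin n)) x)
    (mem_chart_target _ x)).le_gradFlux (α := α) hu hn hδ₀ hδ hp hpin
  rw [hx] at h
  exact h

lemma alphaDelta_nonneg (hn : 3 ≤ n) (hδ₀ : 0 ≤ δ) (hδ : δ < 1 / 2) : 0 ≤ alphaDelta n δ := by
  have hn' : (3 : ℝ) ≤ n := by exact_mod_cast hn
  exact mul_nonneg (div_nonneg (by linarith) (by linarith)) hδ₀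

lemma le_gradExponent (hn : 3 ≤ n) (hδ₀ : 0 ≤ δ) (hδ : δ < 1 / 2) :
    (n : ℝ) ≤ gradExponent n δ := by
  have := alphaDelta_nonneg hn hδ₀ hδ
  rw [gradExponent]
  linarith

/-- The integral estimate, with the constants `C₁` and `C₂` of Young's inequality as parameters. -/
lemma lintegral_gradNorm_le (hn : 3 ≤ n) (hδ₀ : 0 ≤ δ) (hδ : δ < 1 / 2)
    (hα : alphaDelta n δ < α) {C₁ C₂ : ℝ} (hC₁0 : 0 ≤ C₁) (hC₂0 : 0 ≤ C₂)
    (hC₁ : ∀ N b : ℝ, 0 ≤ N → 0 ≤ b →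
      (1 + n) / (1 - 2 * δ) * b * N ^ (gradExponent n δ - 2)
        ≤ (α - alphaDelta n δ) / 4 * N ^ gradExponent n δ + C₁ * b ^ (gradExponent n δ / 2))
    (hC₂ : ∀ N b : ℝ, 0 ≤ N → 0 ≤ b →
      gradExponent n δ * b * N ^ (gradExponent n δ - 1)
        ≤ (α - alphaDelta n δ) / 4 * N ^ gradExponent n δ + C₂ * b ^ gradExponent n δ)
    (hr₁ : 0 < r₁) (hr : r₁ < r₂) (hcpt : IsCompact (Metric.closedBall x₀ (2 * r₂)))
    (hu : IsC11LocOn n u (annulus x₀ (r₁ / 2) (2 * r₂)))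
    (hpin : ∀ᵐ x ∂(riemannianVolume n M).restrict (annulus x₀ (r₁ / 2) (2 * r₂)),
      RicciPinchedAt n δ u x) :
    ENNReal.ofReal ((α - alphaDelta n δ) / 2) * ∫⁻ x in annulus x₀ r₁ r₂,
        ENNReal.ofReal (gradNorm n u x ^ gradExponent n δ * Real.exp (α * u x))
          ∂riemannianVolume n M
      ≤ ENNReal.ofReal C₁ * ∫⁻ x in annulus x₀ (r₁ / 2) (2 * r₂),
          ENNReal.ofReal (ricciNorm n x ^ (gradExponent n δ / 2) * Real.exp (α * u x))
            ∂riemannianVolume n M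
        + (ENNReal.ofReal (C₂ * 4 ^ gradExponent n δ * r₁ ^ (-gradExponent n δ)) *
            ∫⁻ x in annulus x₀ (r₁ / 2) r₁,
              ENNReal.ofReal (Real.exp (α * u x)) ∂riemannianVolume n M
          + ENNReal.ofReal (C₂ * 4 ^ gradExponent n δ * r₂ ^ (-gradExponent n δ)) *
            ∫⁻ x in annulus x₀ r₂ (2 * r₂),
              ENNReal.ofReal (Real.exp (α * u x)) ∂riemannianVolume n M) := by
  have hr₂ : 0 < r₂ := hr₁.trans hr
  have hpn : (n : ℝ) ≤ gradExponent n δ := le_gradExponent hn hδ₀ hδ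
  have hp : 3 ≤ gradExponent n δ := le_trans (by exact_mod_cast hn) hpn
  set p := gradExponent n δ with hpdef
  set c := α - alphaDelta n δ with hc
  have hc0 : 0 < c := sub_pos.2 hα
  set U := annulus x₀ (r₁ / 2) (2 * r₂) with hUdef
  have hU : IsOpen U := isOpen_annulus
  set η : M → ℝ := fun x => radialCutoff r₁ r₂ (dist x x₀) with hη
  -- the cutoff lives on a compact subset of the open annulus
  set K : Set M := {x | 5 / 8 * r₁ ≤ dist x x₀ ∧ dist x x₀ ≤ 15 / 8 * r₂} with hK
  have hKc : IsClosed K :=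
    (isClosed_le continuous_const (continuous_id.dist continuous_const)).inter
      (isClosed_le (continuous_id.dist continuous_const) continuous_const)
  have hKU : K ⊆ U := fun x hx => mem_annulus (by linarith [hx.1]) (by linarith [hx.2])
  have hKcpt : IsCompact K := hcpt.of_isClosed_subset hKc fun x hx => by
    rw [Metric.mem_closedBall]; linarith [hx.2]
  have hp0 : p ≠ 0 := by linarith
  have hηK {x : M} (hx : x ∉ K) : η x = 0 := by
    by_contra h
    exact hx (mem_Icc_of_radialCutoff_ne_zero hr₁ hr h)
  set ζ : M → ℝ := fun x => η x ^ p with hζ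
  have hζK : tsupport ζ ⊆ K := closure_minimal (fun x hx => by
    by_contra h
    exact hx (by simp [hζ, hηK h, hp0])) hKc
  have hζc : HasCompactSupport ζ := hKcpt.of_isClosed_subset (isClosed_tsupport _) hζK
  have hηLip (x : M) : LipAt η x :=
    LipAt.comp (g := fun z => dist z x₀) lipAt_radialCutoff
      ⟨1, Set.univ, univ_mem, (LipschitzWith.dist_left x₀).lipschitzOnWith⟩
  have hζLip (x : M) : LipAt ζ x :=
    LipAt.comp (f := fun t : ℝ => t ^ p)
      (Real.contDiff_rpow_const_of_le (n := 1) (by norm_num; linarith)).contDiffAt.lipAt (hηLip x)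
  have hηcl : IsChartLip n η := isChartLip_of_lipAt hηLip
  obtain ⟨hTi, hT0⟩ := integral_testFlux_eq_zero (α := α) hu hp
    (isChartLip_of_lipAt (n := n) hζLip) hζc (hζK.trans hKU)
  set T := testFlux n p α u ζ with hT
  set w : M → ℝ := fun x => Real.exp (α * u x) with hw
  set X : M → ℝ := fun x => c / 2 * (η x ^ p * gradNorm n u x ^ p * w x) with hX
  have hX0 (x : M) : 0 ≤ X x := by
    have h1 : 0 ≤ gradNorm n u x := Real.sqrt_nonneg _
    have h2 : 0 ≤ η x := radialCutoff_nonneg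
    have h3 : 0 ≤ w x := (Real.exp_pos _).le
    positivity
  have hXU {x : M} (hx : x ∉ U) : X x = 0 := by
    simp [hX, hηK fun h => hx (hKU h), hp0]
  have hwU : ContinuousOn w U := (continuousOn_const.mul (hu.continuousOn)).rexp
  have hXm : AEStronglyMeasurable X (riemannianVolume n M) := by
    have h1 : ContinuousOn X U := by
      refine continuousOn_const.mul (ContinuousOn.mul (ContinuousOn.mul ?_ ?_) hwU)
      · exact fun x _ => (hζLip x).continuousAt.continuousWithinAt
      · exact (continuousOn_gradNorm hu hU).rpow_const fun x _ => Or.inr (by linarith)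
    have h2 : U.indicator X = X := Set.indicator_eq_self.2 fun x hx => by
      by_contra h
      exact hx (hXU h)
    rw [← h2]
    exact (aestronglyMeasurable_indicator_iff hU.measurableSet).2
      (h1.aestronglyMeasurable hU.measurableSet)
  have hA₁ : MeasurableSet (annulus x₀ (r₁ / 2) r₁) := isOpen_annulus.measurableSet
  have hA₂ : MeasurableSet (annulus x₀ r₂ (2 * r₂)) := isOpen_annulus.measurableSet
  set c₁ := C₂ * 4 ^ p * r₁ ^ (-p) with hc₁
  set c₂ := C₂ * 4 ^ p * r₂ ^ (-p) with hc₂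
  set Y₀ : M → ℝ≥0∞ := U.indicator fun x => ENNReal.ofReal (ricciNorm n x ^ (p / 2) * w x)
  set Y₁ : M → ℝ≥0∞ := (annulus x₀ (r₁ / 2) r₁).indicator fun x => ENNReal.ofReal (w x) with hY₁
  set Y₂ : M → ℝ≥0∞ := (annulus x₀ r₂ (2 * r₂)).indicator fun x => ENNReal.ofReal (w x) with hY₂
  -- the slope of the cutoff is at most `4 / r₁` resp. `4 / r₂`, and zero outside the outer zones
  have hzone {x : M} (hx : x ∈ U) :
      ENNReal.ofReal (C₂ * (cutoffSlope r₁ r₂ (dist x x₀) ^ p * w x))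
        ≤ ENNReal.ofReal c₁ * Y₁ x + ENNReal.ofReal c₂ * Y₂ x := by
    have hw0 : 0 < w x := Real.exp_pos _
    unfold cutoffSlope
    split_ifs with h1 h2
    · have h3 : Y₁ x = ENNReal.ofReal (w x) := Set.indicator_of_mem (s := annulus x₀ (r₁ / 2) r₁) ⟨h1, hx.2⟩ _
      refine le_trans ?_ le_self_add
      rw [h3, ← ENNReal.ofReal_mul (by positivity)]
      refine ENNReal.ofReal_le_ofReal (le_of_eq ?_)
      rw [Real.div_rpow (by norm_num) hr₁.le, hc₁, Real.rpow_neg hr₁.le]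
      ring
    · have h3 : Y₂ x = ENNReal.ofReal (w x) :=
        Set.indicator_of_mem (mem_annulus h2 hx.1) _
      refine le_trans ?_ le_add_self
      rw [h3, ← ENNReal.ofReal_mul (by positivity)]
      refine ENNReal.ofReal_le_ofReal ?_
      have h4 : (4 / (3 * r₂)) ^ p ≤ 4 ^ p * r₂ ^ (-p) := by
        rw [Real.rpow_neg hr₂.le, ← div_eq_mul_inv, ← Real.div_rpow (by norm_num) hr₂.le]
        refine Real.rpow_le_rpow (by positivity) ?_ (by linarith)
        exact div_le_div_of_nonneg_left (by norm_num) hr₂ (by linarith)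
      calc C₂ * ((4 / (3 * r₂)) ^ p * w x) ≤ C₂ * (4 ^ p * r₂ ^ (-p) * w x) := by gcongr
        _ = c₂ * w x := by rw [hc₂]; ring
    · simp [Real.zero_rpow hp0]
  -- the pointwise estimate of what remains after subtracting the divergence `T`
  have hpt : ∀ᵐ x ∂riemannianVolume n M, ENNReal.ofReal (X x - T x)
      ≤ ENNReal.ofReal C₁ * Y₀ x + (ENNReal.ofReal c₁ * Y₁ x + ENNReal.ofReal c₂ * Y₂ x) := by
    filter_upwards [ae_isTwiceDiffAt_localRep hu hU, ae_differentiableAt_localRep hηcl,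
      (ae_restrict_iff' hU.measurableSet).1 hpin] with x hx1 hx2 hx3
    by_cases hxU : x ∈ U
    · have hL : ∀ᶠ z in 𝓝 x, |η z - η x| ≤ cutoffSlope r₁ r₂ (dist x x₀) * dist x z := by
        have h1 : ContinuousAt (fun z => dist z x₀) x :=
          (continuous_id.dist continuous_const).continuousAt
        filter_upwards [h1.eventually (eventually_abs_radialCutoff_sub_le hr₁ hr)] with z hz
        refine hz.trans (mul_le_mul_of_nonneg_left ?_ (cutoffSlope_nonneg hr₁ hr))
        rw [dist_comm x z]
        exact abs_dist_sub_le z x x₀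
      have hN : 0 ≤ gradNorm n u x := Real.sqrt_nonneg _
      have hη0 : 0 ≤ η x := radialCutoff_nonneg
      have key := absorb_le (R := ricciNorm n x) hp (Real.exp_pos (α * u x)).le hη0 radialCutoff_le_one hN
        (Real.sqrt_nonneg _) hC₁0 (le_gradFluxOn hn hδ₀ hδ hp (hx1 hxU) (hx3 hxU))
        (abs_gradInnerOn_le (u := u) (cutoffSlope_nonneg hr₁ hr) hL hx2)
        (hC₁ _ _ hN (Real.sqrt_nonneg _))
        (hC₂ _ _ (mul_nonneg hη0 hN) (cutoffSlope_nonneg hr₁ hr))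
      rw [← gradInnerOn_rpow (by linarith) hx2] at key
      refine (ENNReal.ofReal_le_ofReal key).trans (ENNReal.ofReal_add_le.trans ?_)
      have hY₀ : Y₀ x = ENNReal.ofReal (ricciNorm n x ^ (p / 2) * w x) :=
        Set.indicator_of_mem hxU _
      refine add_le_add (le_of_eq ?_) (hzone hxU)
      rw [ENNReal.ofReal_mul hC₁0, hY₀]
    · rw [hXU hxU, hT, testFlux_of_notMem_tsupport fun h => hxU (hKU (hζK h))]
      simp
  have hYm {A : Set M} (hA : MeasurableSet A) (hAU : A ⊆ U) :
      AEMeasurable (A.indicator fun x => ENNReal.ofReal (w x)) (riemannianVolume n M) :=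
    (aemeasurable_indicator_iff hA).2 ((hwU.mono hAU).aemeasurable hA).ennreal_ofReal
  have hA₁U : annulus x₀ (r₁ / 2) r₁ ⊆ U := fun x hx =>
    ⟨Metric.ball_subset_ball (by linarith) hx.1, hx.2⟩
  have hA₂U : annulus x₀ r₂ (2 * r₂) ⊆ U := fun x hx =>
    ⟨hx.1, fun h => hx.2 (closure_mono (Metric.ball_subset_ball (by linarith)) h)⟩
  have hY₁m : AEMeasurable (fun x => ENNReal.ofReal c₁ * Y₁ x) (riemannianVolume n M) :=
    (hYm hA₁ hA₁U).const_mul _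
  have hY₂m : AEMeasurable (fun x => ENNReal.ofReal c₂ * Y₂ x) (riemannianVolume n M) :=
    (hYm hA₂ hA₂U).const_mul _
  calc ENNReal.ofReal (c / 2) * ∫⁻ x in annulus x₀ r₁ r₂,
        ENNReal.ofReal (gradNorm n u x ^ p * w x) ∂riemannianVolume n M
      = ∫⁻ x in annulus x₀ r₁ r₂, ENNReal.ofReal (X x) ∂riemannianVolume n M := by
        rw [← lintegral_const_mul' _ _ ENNReal.ofReal_ne_top]
        refine setLIntegral_congr_fun isOpen_annulus.measurableSet fun x hx => ?_
        have h1 : η x = 1 := radialCutoff_eq_one hr₁ hr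
          (by linarith [le_dist_of_mem_annulus hx]) (by linarith [Metric.mem_ball.1 hx.1])
        simp only [hX, h1, Real.one_rpow, one_mul]
        rw [ENNReal.ofReal_mul (p := c / 2) (by linarith)]
    _ ≤ ∫⁻ x, ENNReal.ofReal (X x) ∂riemannianVolume n M := setLIntegral_le_lintegral _ _
    _ ≤ ∫⁻ x, ENNReal.ofReal (X x - T x) ∂riemannianVolume n M :=
        lintegral_ofReal_le_of_integral_eq_zero hXm hX0 hTi hT0
    _ ≤ ∫⁻ x, (ENNReal.ofReal C₁ * Y₀ x + (ENNReal.ofReal c₁ * Y₁ x + ENNReal.ofReal c₂ * Y₂ x))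
          ∂riemannianVolume n M := lintegral_mono_ae hpt
    _ = _ := by
        rw [lintegral_add_right' _ (show AEMeasurable (fun x => ENNReal.ofReal c₁ * Y₁ x
            + ENNReal.ofReal c₂ * Y₂ x) _ from hY₁m.add hY₂m), lintegral_add_right' _ hY₂m,
          lintegral_const_mul' _ _ ENNReal.ofReal_ne_top,
          lintegral_const_mul' _ _ ENNReal.ofReal_ne_top,
          lintegral_const_mul' _ _ ENNReal.ofReal_ne_top,
          lintegral_indicator hU.measurableSet, lintegral_indicator hA₁, lintegral_indicator hA₂]

end Estimate

end Proof

end ConformalRicci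

/-- The weighted integral gradient estimate on annuli. The integrals are taken in `[0, ∞]`. -/
theorem theorem3p4 (n : ℕ) (hn : 3 ≤ n) (δ α : ℝ) (hδ₀ : 0 ≤ δ) (hδ : δ < 1 / 2)
    (hα : ConformalRicci.alphaDelta n δ < α) :
    0 ≤ ConformalRicci.alphaDelta n δ ∧ (n : ℝ) ≤ ConformalRicci.gradExponent n δ ∧
    ∃ C : ℝ, 0 < C ∧
      ∀ (M : Type*) [MetricSpace M] [SecondCountableTopology M] [MeasurableSpace M] [BorelSpace M]
        [ChartedSpace (EuclideanSpace ℝ (Fin n)) M]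
        [IsManifold 𝓘(ℝ, EuclideanSpace ℝ (Fin n)) ∞ M]
        [RiemannianBundle (fun x : M => TangentSpace 𝓘(ℝ, EuclideanSpace ℝ (Fin n)) x)]
        [IsContMDiffRiemannianBundle 𝓘(ℝ, EuclideanSpace ℝ (Fin n)) ∞ (EuclideanSpace ℝ (Fin n))
          (fun x : M => TangentSpace 𝓘(ℝ, EuclideanSpace ℝ (Fin n)) x)]
        [IsRiemannianManifold 𝓘(ℝ, EuclideanSpace ℝ (Fin n)) M]
        (x₀ : M) (r₁ r₂ : ℝ), 0 < r₁ → r₁ < r₂ →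
        IsCompact (Metric.closedBall x₀ (2 * r₂)) →
        ∀ u : M → ℝ,
          ConformalRicci.IsC11LocOn n u (ConformalRicci.annulus x₀ (r₁ / 2) (2 * r₂)) →
          (∀ᵐ x ∂(ConformalRicci.riemannianVolume n M).restrict
              (ConformalRicci.annulus x₀ (r₁ / 2) (2 * r₂)),
            ConformalRicci.RicciPinchedAt n δ u x) →
          ∫⁻ x in ConformalRicci.annulus x₀ r₁ r₂,
              ENNReal.ofReal (ConformalRicci.gradNorm n u x ^ ConformalRicci.gradExponent n δ
                * Real.exp (α * u x)) ∂ConformalRicci.riemannianVolume n M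
            ≤ ENNReal.ofReal C *
              (∫⁻ x in ConformalRicci.annulus x₀ (r₁ / 2) (2 * r₂),
                  ENNReal.ofReal (ConformalRicci.ricciNorm n x ^
                    (ConformalRicci.gradExponent n δ / 2) * Real.exp (α * u x))
                  ∂ConformalRicci.riemannianVolume n M
                + ENNReal.ofReal (r₁ ^ (-ConformalRicci.gradExponent n δ)) *
                  ∫⁻ x in ConformalRicci.annulus x₀ (r₁ / 2) r₁,
                    ENNReal.ofReal (Real.exp (α * u x)) ∂ConformalRicci.riemannianVolume n M
                + ENNReal.ofReal (r₂ ^ (-ConformalRicci.gradExponent n δ)) *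
                  ∫⁻ x in ConformalRicci.annulus x₀ r₂ (2 * r₂),
                    ENNReal.ofReal (Real.exp (α * u x))
                    ∂ConformalRicci.riemannianVolume n M) := by
  have hp3 : 3 ≤ ConformalRicci.gradExponent n δ :=
    le_trans (by exact_mod_cast hn) (ConformalRicci.le_gradExponent hn hδ₀ hδ)
  have hc : 0 < α - ConformalRicci.alphaDelta n δ := sub_pos.2 hα
  have hδ' : 0 < 1 - 2 * δ := by linarith
  refine ⟨ConformalRicci.alphaDelta_nonneg hn hδ₀ hδ, ConformalRicci.le_gradExponent hn hδ₀ hδ, ?_⟩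
  obtain ⟨C₁, hC₁0, hC₁⟩ := ConformalRicci.exists_young
    (s := ConformalRicci.gradExponent n δ) (t := 2)
    (ε := (α - ConformalRicci.alphaDelta n δ) / 4) (K := (1 + n) / (1 - 2 * δ)) (by norm_num)
    (by linarith) (by linarith) (by positivity)
  obtain ⟨C₂, hC₂0, hC₂⟩ := ConformalRicci.exists_young
    (s := ConformalRicci.gradExponent n δ) (t := 1)
    (ε := (α - ConformalRicci.alphaDelta n δ) / 4) (K := ConformalRicci.gradExponent n δ)
    (by norm_num) (by linarith) (by linarith) (by linarith)
  simp only [div_one] at hC₂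
  set p := ConformalRicci.gradExponent n δ with hp
  set c := α - ConformalRicci.alphaDelta n δ with hcdef
  refine ⟨2 / c * (C₁ + C₂ * 4 ^ p + 1), by positivity, ?_⟩
  intro M _ _ _ _ _ _ _ _ _ x₀ r₁ r₂ hr₁ hr hcpt u hu hpin
  have key := ConformalRicci.lintegral_gradNorm_le hn hδ₀ hδ hα hC₁0 hC₂0 hC₁ hC₂ hr₁ hr hcpt hu hpin
  rw [← hp, ← hcdef] at key
  have hr₂ : 0 < r₂ := hr₁.trans hr
  have h1 : ENNReal.ofReal (2 / c) * ENNReal.ofReal (c / 2) = 1 := by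
    rw [← ENNReal.ofReal_mul (by positivity), div_mul_div_cancel₀ hc.ne', div_self two_ne_zero,
      ENNReal.ofReal_one]
  have h2 : ENNReal.ofReal C₁ ≤ ENNReal.ofReal (C₁ + C₂ * 4 ^ p + 1) := by
    refine ENNReal.ofReal_le_ofReal ?_
    have : 0 ≤ C₂ * 4 ^ p := by positivity
    linarith
  have h3 (r : ℝ) (hr : 0 < r) : ENNReal.ofReal (C₂ * 4 ^ p * r ^ (-p))
      ≤ ENNReal.ofReal (C₁ + C₂ * 4 ^ p + 1) * ENNReal.ofReal (r ^ (-p)) := by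
    rw [← ENNReal.ofReal_mul (by positivity)]
    refine ENNReal.ofReal_le_ofReal (mul_le_mul_of_nonneg_right ?_ (by positivity))
    linarith
  rw [ENNReal.ofReal_mul (by positivity), ← one_mul (∫⁻ x in ConformalRicci.annulus x₀ r₁ r₂, _ ∂_),
    ← h1, mul_assoc, mul_assoc]
  refine mul_le_mul_right (key.trans ?_) _
  rw [mul_add, mul_add, ← mul_assoc, ← mul_assoc, add_assoc]
  exact add_le_add (mul_le_mul_left h2 _)
    (add_le_add (mul_le_mul_left (h3 r₁ hr₁) _) (mul_le_mul_left (h3 r₂ hr₂) _))
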